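/- Let $\Omega=(A,B)\times(C,D)\subset\mathbb{R}^2$ be an open rectangle and let $G(x;y)$ be the Green's function of $-\Delta$ on $\Omega$ with homogeneous Dirichlet boundary conditions ($-\Delta G(\cdot;y)=\delta_y$ in $\Omega$, $G(\cdot;y)=0$ on $\partial\Omega$), with the derivatives $\partial_{y_i}G(\cdot;y)$, $i=1,2$, understood for all $y\in\overline\Omega$. Let $(E,dz)$ be a measure space, let $1\le p<2$ and let $K:L^p(\Omega)\to L^1(E)$ be a bounded linear operator (recall that $BV(\Omega)\subset L^p(\Omega)$ and $\partial_{y_i}G(\cdot;y)\in L^p(\Omega)$). For $y\in\overline\Omega$ put $$w_i(y)=\int_E\left|K\partial_{y_i}G(\cdot;y)\right|dz,\qquad i=1,2,$$ and for $f\in BV(\Omega)$ define the extended weighted total variation $$\overline{TV}_w(f)=\sup\left\{\int_\Omega f\,\mathrm{div}\,\phi\,dx \;:\; \phi\in C^1(\overline\Omega;\mathbb{R}^2),\ |\phi_i(x)|\le w_i(x)\ \ \forall x\in\overline\Omega,\ i=1,2\right\}$$ (the test fields need not vanish on $\partial\Omega$, so that this equals $\sum_i\int_\Omega w_i|D_if|+\int_{\partial\Omega}w_\partial|f|\,dS$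 with the boundary weight $w_\partial=\sum_i|n_i|w_i=\int_E|K\partial_{\mathbf n}G(\cdot;y)|dz$). Let $R=(a,b)\times(c,d)\subset\Omega$ with $a<b$ and $c<d$, let $\Gamma_1,\Gamma_2,\Gamma_3,\Gamma_4$ be its left, bottom, right and top sides (without the corners), and let $\mathbf n$ be its outer unit normal. Assume that $E$ is the union of mutually disjoint measurable sets $E_1,\dots,E_4$ such that for each $j\in\{1,2,3,4\}$: (i) for every $y\in\Gamma_j$, $K(\nabla_y G(\cdot;y)\cdot\mathbf n(y))$ vanishes almost everywhere outside $E_j$; (ii) there is a function $c_j:E_j\to\{-1,0,1\}$ (for instance a constant) such that for every $y\in\Gamma_j$, $\mathrm{sgn}\left[K(\nabla_y G(\cdot;y)\cdot\mathbf n(y))(z)\right]=c_j(z)$ for almost every $z\in E_j$; that is, for fixed $z$ the sign does not depend on $y\in\Gamma_j$. Then $\chi_R\in BV(\Omega)$ and $$\chi_R\in\operatorname*{arg\,min}_{f\in BV(\Omega)}\overline{TV}_w(f)\quad\text{subject to}\quad Kf=K\chi_R .$$ -/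

import Mathlib

open MeasureTheory Set
open scoped ENNReal

namespace WeightedTV

noncomputable section

/-- The Euclidean plane. -/
abbrev Plane : Type := EuclideanSpace ℝ (Fin 2)

/-- The open rectangle `(a, b) × (c, d)`. -/
def rect (a b c d : ℝ) : Set Plane := {x | x 0 ∈ Ioo a b ∧ x 1 ∈ Ioo c d}

/-- The left, bottom, right and top sides of the rectangle, without the corners. -/
def side (a b c d : ℝ) : Fin 4 → Set Plane :=
  ![{y | y 0 = a ∧ y 1 ∈ Ioo c d},
    {y | y 0 ∈ Ioo a b ∧ y 1 = c},
    {y | y 0 = b ∧ y 1 ∈ Ioo c d},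
    {y | y 0 ∈ Ioo a b ∧ y 1 = d}]

/-- The outer unit normals of a rectangle on its left, bottom, right and top sides. -/
def normal : Fin 4 → Plane := ![!₂[-1, 0], !₂[0, -1], !₂[1, 0], !₂[0, 1]]

/-- The divergence of a planar vector field. -/
def div (φ : Plane → Plane) (x : Plane) : ℝ :=
  ∑ i : Fin 2, (fderiv ℝ φ x (EuclideanSpace.single i 1)) i

/-- Vector fields of class `C¹` with compact support in `Ω` and components bounded by one. -/
def testFields (Ω : Set Plane) : Set (Plane → Plane) :=
  {φ | ContDiff ℝ 1 φ ∧ HasCompactSupport φ ∧ tsupport φ ⊆ Ω ∧ ∀ x ∈ Ω, ∀ i, |φ x i| ≤ 1}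

/-- The (anisotropic) total variation of `f` on `Ω`. -/
def tv (Ω : Set Plane) (f : Plane → ℝ) : EReal :=
  ⨆ φ ∈ testFields Ω, ((∫ x in Ω, f x * div φ x : ℝ) : EReal)

/-- `f ∈ BV(Ω)`: `f` is integrable on `Ω` and of finite total variation there. -/
def IsBV (Ω : Set Plane) (f : Plane → ℝ) : Prop :=
  IntegrableOn f Ω ∧ tv Ω f < ⊤

/-- Vector fields of class `C¹` up to the boundary of `Ω`, without any support condition, whose
`i`-th component is bounded by the weight `w i` on the closure of `Ω`. -/
def extTestFields (Ω : Set Plane) (w : Fin 2 → Plane → ℝ) : Set (Plane → Plane) :=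
  {φ | ContDiffOn ℝ 1 φ (closure Ω) ∧ ∀ x ∈ closure Ω, ∀ i, |φ x i| ≤ w i x}

/-- The extended weighted total variation of `f` on `Ω`. The test fields need not vanish on the
boundary, where they are bounded by the weights, so that the boundary values of `f` are penalized
with the boundary weight `∑ i, |nᵢ| wᵢ`, where `n` is the normal of `∂Ω`. -/
def extTV (Ω : Set Plane) (w : Fin 2 → Plane → ℝ) (f : Plane → ℝ) : EReal :=
  ⨆ φ ∈ extTestFields Ω w, ((∫ x in Ω, f x * div φ x : ℝ) : EReal)

/-- `G x y` is the Green's function of `-Δ` on `Ω`, with pole `y` and homogeneous Dirichlet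
boundary values: for `y ∈ Ω` one has `-Δ G(·; y) = δ_y` in `Ω`, i.e. `G(·; y)` differs from the
fundamental solution `-log |x - y| / (2 π)` by a function that is harmonic in `Ω` and continuous up
to the boundary, and `G(·; y) = 0` on `∂Ω`. For a pole on `∂Ω` we use the continuous extension,
which is zero, so that `G(x; y)` can be differentiated in `y` up to the boundary. -/
structure IsDirichletGreen (Ω : Set Plane) (G : Plane → Plane → ℝ) : Prop where
  exists_corrector : ∀ y ∈ Ω, ∃ h : Plane → ℝ,
    InnerProductSpace.HarmonicOnNhd h Ω ∧ ContinuousOn h (closure Ω) ∧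
    ∀ x ∈ closure Ω, x ≠ y → G x y = -(1 / (2 * Real.pi)) * Real.log ‖x - y‖ + h x
  boundary : ∀ y ∈ Ω, ∀ x ∈ frontier Ω, G x y = 0
  boundary_pole : ∀ y ∈ frontier Ω, ∀ x ∈ Ω, G x y = 0

/-- The directional derivative `∇_y G(x; y) · v`, one-sided if `y` lies on the boundary of `Ω`. -/
def dG (Ω : Set Plane) (G : Plane → Plane → ℝ) (v : Plane) (y x : Plane) : ℝ :=
  fderivWithin ℝ (fun y' => G x y') (closure Ω) y v

variable {E : Type*} [MeasurableSpace E] {ν : Measure E} {p : ℝ≥0∞} [Fact (1 ≤ p)] {Ω : Set Plane}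

open Classical in
/-- The operator `K : L^p(Ω) → L¹(E)`, applied to (the class of) a function on `Ω`. The value for
functions outside `L^p(Ω)` is a dummy; for `p < 2` and a rectangle `Ω` both the functions of
`BV(Ω)` and the derivatives `∂_{yᵢ} G(·; y)` are in `L^p(Ω)`. -/
def app (K : Lp ℝ p (volume.restrict Ω) →L[ℝ] Lp ℝ 1 ν) (g : Plane → ℝ) : Lp ℝ 1 ν :=
  if h : MemLp g p (volume.restrict Ω) then K (h.toLp g) else 0

/-- The weights `wᵢ(y) = ∫_E |K ∂_{yᵢ} G(·; y)| dz`, for `y` in the closure of `Ω`. -/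
def weight (K : Lp ℝ p (volume.restrict Ω) →L[ℝ] Lp ℝ 1 ν) (G : Plane → Plane → ℝ)
    (i : Fin 2) (y : Plane) : ℝ :=
  ∫ z, |app K (dG Ω G (EuclideanSpace.single i 1) y) z| ∂ν

/-- The functions `f ∈ BV(Ω)` with `K f = K g`. -/
def feasible (K : Lp ℝ p (volume.restrict Ω) →L[ℝ] Lp ℝ 1 ν) (g : Plane → ℝ) :
    Set (Plane → ℝ) :=
  {f | IsBV Ω f ∧ app K f = app K g}

end

end WeightedTV

/-!
The proof is by convex duality, with a dual certificate that is read off from the data.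

*The certificate.* The hypotheses on the sets `F j` and the signs `s j` say that one measurable
function `q` on the data space, `|q| ≤ 1`, has the sign of `K (∇_y G(·; y) · n)` for all `y` on the
four sides of the rectangle `R` at once. The functional `ℓ u = ∫ q u` on `L¹` then defines a vector
field `φ*` on the closure of `Ω` by `φ*ᵢ(y) = ℓ (K ∂_{yᵢ} G(·; y))`. It satisfies `|φ*ᵢ| ≤ wᵢ`, and
on the sides of `R` its outer normal component is equal to the weight. By the definition of the
Green's function, `-div φ* = ℓ ∘ K` in the weak sense, so that `∫ f div φ* = -ℓ (K f)` depends only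
on the data `K f`. Hence `φ*` is optimal for `χ_R`, by the divergence theorem on `R`, and for a
competitor `f` with the same data the field `φ*` gives the same value.

*Regularity.* `φ*` need not be of class `C¹`, as test fields are required to be. The functional
`ℓ ∘ K` is approximated by densities `k` of class `C¹` with compact support in `Ω`
(`exists_contDiff_approx`). The corresponding fields `greenField` are of class `C¹`, have divergence
`-k` (`div_greenField`) and are uniformly close to `φ*`, since the derivatives `∂_{yᵢ} G(·; y)` are
bounded in `L^s(Ω)` for some `s < 2`, uniformly in `y` (`exists_eLpNorm_dG_le`). A smooth soft
thresholding of the components brings them below the weights again (`abs_softThreshold_le`). For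
`f ∈ BV(Ω)` the error is controlled by `IsBV.exists_abs_integral_div_le`, which bounds `∫ f div φ`
by the maximum of `|φ|` for fields `φ` that need not vanish on `∂Ω`. These steps make up
`extTV_indicator_le_of_certificate`.

*The Green's function.* The properties of `G` come from an explicit formula: on a rectangle the
method of images expresses `G` through the logarithm of the modulus of a theta function with zeros
on the lattice of reflected poles (`theta`, `greenFun`). By the maximum principle it is the only
function that satisfies the definition (`eq_greenFun`). Its derivative in the pole is a combination
of logarithmic derivatives of `theta` (`dG_eq_greenKernel`), which have simple poles; this gives the
`L^s` bounds, and the Cauchy–Pompeiu formula gives the divergence of `greenField`.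

*`BV(Ω) ⊆ L^s(Ω)`* is needed for `K f` to be meaningful. It follows from the same ingredients: a
density in the dual space `L^{s'}` is the divergence of a bounded `C¹` field, up to approximation,
and the converse of Hölder's inequality applies (`IsBV.memLp`).
-/

namespace WeightedTV

open Filter Topology Real
open scoped ComplexConjugate

/-! ### Rectangles -/

lemma mem_rect_iff (lo hi : Fin 2 → ℝ) (x : Plane) :
    x ∈ rect (lo 0) (hi 0) (lo 1) (hi 1) ↔ ∀ i, x i ∈ Ioo (lo i) (hi i) := by
  simp [rect, Fin.forall_fin_two]

lemma isOpen_rect (A B C D : ℝ) : IsOpen (rect A B C D) := by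
  have h0 : Continuous fun x : Plane => x 0 := by fun_prop
  have h1 : Continuous fun x : Plane => x 1 := by fun_prop
  exact (isOpen_Ioo.preimage h0).inter (isOpen_Ioo.preimage h1)

lemma measurableSet_rect (A B C D : ℝ) : MeasurableSet (rect A B C D) :=
  (isOpen_rect A B C D).measurableSet

lemma closure_rect {A B C D : ℝ} (hAB : A < B) (hCD : C < D) :
    closure (rect A B C D) = {x : Plane | x 0 ∈ Icc A B ∧ x 1 ∈ Icc C D} := by
  let h : Plane ≃ₜ (Fin 2 → ℝ) := (EuclideanSpace.equiv (Fin 2) ℝ).toHomeomorph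
  have e1 : rect A B C D = h ⁻¹' (Set.univ.pi ![Ioo A B, Ioo C D]) := by
    ext x; simp [rect, h, Set.mem_pi, Fin.forall_fin_two]
  rw [e1, ← h.preimage_closure, closure_pi_set]
  ext x
  simp [h, Set.mem_pi, Fin.forall_fin_two, closure_Ioo hAB.ne, closure_Ioo hCD.ne]

lemma mem_closure_rect_iff {lo hi : Fin 2 → ℝ} (h : ∀ i, lo i < hi i) (x : Plane) :
    x ∈ closure (rect (lo 0) (hi 0) (lo 1) (hi 1)) ↔ ∀ i, x i ∈ Icc (lo i) (hi i) := by
  simp [closure_rect (h 0) (h 1), Fin.forall_fin_two]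

lemma convex_rect (A B C D : ℝ) : Convex ℝ (rect A B C D) := by
  have h0 : IsLinearMap ℝ fun x : Plane => x 0 := ⟨fun _ _ => rfl, fun _ _ => rfl⟩
  have h1 : IsLinearMap ℝ fun x : Plane => x 1 := ⟨fun _ _ => rfl, fun _ _ => rfl⟩
  exact ((convex_Ioo A B).is_linear_preimage h0).inter ((convex_Ioo C D).is_linear_preimage h1)

lemma isBounded_rect (A B C D : ℝ) : Bornology.IsBounded (rect A B C D) := by
  rw [isBounded_iff_forall_norm_le]
  refine ⟨√((|A| + |B|) ^ 2 + (|C| + |D|) ^ 2), fun x hx => ?_⟩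
  rw [EuclideanSpace.norm_eq]
  have h0 : |x 0| ≤ |A| + |B| := by
    have := hx.1
    rw [abs_le]; constructor
    · linarith [this.1, neg_abs_le A, abs_nonneg B]
    · linarith [this.2, le_abs_self B, abs_nonneg A]
  have h1 : |x 1| ≤ |C| + |D| := by
    have := hx.2
    rw [abs_le]; constructor
    · linarith [this.1, neg_abs_le C, abs_nonneg D]
    · linarith [this.2, le_abs_self D, abs_nonneg C]
  apply Real.sqrt_le_sqrt
  simp only [Fin.sum_univ_two, Real.norm_eq_abs]
  gcongr

lemma isCompact_closure_rect (A B C D : ℝ) : IsCompact (closure (rect A B C D)) :=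
  (isBounded_rect A B C D).isCompact_closure

lemma volume_rect_lt_top (A B C D : ℝ) : volume (rect A B C D) < ⊤ :=
  (isBounded_rect A B C D).measure_lt_top

instance (A B C D : ℝ) : IsFiniteMeasure (volume.restrict (rect A B C D)) :=
  ⟨by simpa using volume_rect_lt_top A B C D⟩

lemma div_smul_single (u : Plane → ℝ) (hu : Differentiable ℝ u) (i : Fin 2) (x : Plane) :
    div (fun x => u x • EuclideanSpace.single i (1 : ℝ)) x =
      fderiv ℝ u x (EuclideanSpace.single i 1) := by
  have h : ∀ v, fderiv ℝ (fun x => u x • EuclideanSpace.single i (1 : ℝ)) x v =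
      fderiv ℝ u x v • EuclideanSpace.single i (1 : ℝ) := by
    intro v
    rw [fderiv_smul_const (hu x)]; rfl
  simp only [div, h]
  fin_cases i <;> simp

lemma div_eq_sum (φ : Plane → Plane) {x : Plane} (hφ : DifferentiableAt ℝ φ x) :
    div φ x = ∑ i : Fin 2, fderiv ℝ (fun y => φ y i) x (EuclideanSpace.single i 1) := by
  unfold div
  refine Finset.sum_congr rfl fun i _ => ?_
  have := ((EuclideanSpace.proj (𝕜 := ℝ) i).hasFDerivAt.comp x hφ.hasFDerivAt).fderiv
  change _ = fderiv ℝ (⇑(EuclideanSpace.proj i) ∘ φ) x _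
  rw [this]; rfl

/-! ### Smooth cutoffs and soft thresholding -/

lemma exists_bound_deriv_smoothTransition :
    ∃ c, ∀ t, |deriv smoothTransition t| ≤ c := by
  have hc : Continuous (deriv smoothTransition) :=
    (Real.smoothTransition.contDiff (n := 1)).continuous_deriv le_rfl
  obtain ⟨c, hc⟩ := (isCompact_Icc (a := (-1 : ℝ)) (b := 2)).exists_bound_of_continuousOn
    hc.continuousOn
  refine ⟨max c 0, fun t => ?_⟩
  by_cases ht : t ∈ Icc (-1 : ℝ) 2
  · exact (hc t ht).trans (le_max_left _ _)
  · have : deriv smoothTransition t = 0 := by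
      rw [mem_Icc, not_and_or, not_le, not_le] at ht
      rcases ht with ht | ht
      · have : smoothTransition =ᶠ[𝓝 t] fun _ => 0 := by
          filter_upwards [Iio_mem_nhds (show t < 0 by linarith)] with s hs
          exact smoothTransition.zero_of_nonpos (le_of_lt hs)
        rw [this.deriv_eq]; simp
      · have : smoothTransition =ᶠ[𝓝 t] fun _ => 1 := by
          filter_upwards [Ioi_mem_nhds (show 1 < t by linarith)] with s hs
          exact smoothTransition.one_of_one_le (le_of_lt hs)
        rw [this.deriv_eq]; simp
    simp [this]

lemma deriv_smoothTransition_of_one_lt {t : ℝ} (ht : 1 < t) : deriv smoothTransition t = 0 := by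
  have : smoothTransition =ᶠ[𝓝 t] fun _ => 1 := by
    filter_upwards [Ioi_mem_nhds ht] with s hs
    exact smoothTransition.one_of_one_le (le_of_lt hs)
  rw [this.deriv_eq]; simp

/-- A smooth function on the line that vanishes at distance less than `1 / k` from the complement of
`(a, b)`, and is `1` at distance at least `2 / k` from it. -/
noncomputable def cutoff (a b k t : ℝ) : ℝ :=
  smoothTransition (k * (t - a) - 1) * smoothTransition (k * (b - t) - 1)

lemma contDiff_cutoff (a b k : ℝ) {n : ℕ∞} : ContDiff ℝ n (cutoff a b k) := by
  unfold cutoff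
  exact (smoothTransition.contDiff.comp (by fun_prop)).mul
    (smoothTransition.contDiff.comp (by fun_prop))

lemma cutoff_nonneg (a b k t : ℝ) : 0 ≤ cutoff a b k t :=
  mul_nonneg (smoothTransition.nonneg _) (smoothTransition.nonneg _)

lemma cutoff_le_one (a b k t : ℝ) : cutoff a b k t ≤ 1 :=
  mul_le_one₀ (smoothTransition.le_one _) (smoothTransition.nonneg _) (smoothTransition.le_one _)

lemma mem_Icc_of_cutoff_ne_zero {a b k t : ℝ} (hk : 0 < k) (h : cutoff a b k t ≠ 0) :
    t ∈ Icc (a + 1 / k) (b - 1 / k) := by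
  have h1 : 0 < k * (t - a) - 1 := by
    by_contra h'
    exact h (by simp [cutoff, smoothTransition.zero_of_nonpos (not_lt.1 h')])
  have h2 : 0 < k * (b - t) - 1 := by
    by_contra h'
    exact h (by simp [cutoff, smoothTransition.zero_of_nonpos (not_lt.1 h')])
  have e1 : 1 / k < t - a := by rw [div_lt_iff₀ hk]; linarith
  have e2 : 1 / k < b - t := by rw [div_lt_iff₀ hk]; linarith
  constructor <;> linarith

lemma eventually_cutoff_eventuallyEq_one {a b t : ℝ} (ht : t ∈ Ioo a b) :
    ∀ᶠ k : ℕ in atTop, cutoff a b k =ᶠ[𝓝 t] fun _ => 1 := by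
  obtain ⟨ha, hb⟩ := ht
  set δ := min (t - a) (b - t) with hδ
  have hδ0 : 0 < δ := lt_min (by linarith) (by linarith)
  filter_upwards [eventually_ge_atTop (⌈4 / δ⌉₊)] with k hk
  have hk' : 4 ≤ k * δ := by
    have := (Nat.le_ceil (4 / δ)).trans (Nat.cast_le.2 hk)
    rwa [div_le_iff₀ hδ0] at this
  have hk0 : (0 : ℝ) ≤ k := Nat.cast_nonneg k
  filter_upwards [Ioo_mem_nhds (show t - δ / 2 < t by linarith) (show t < t + δ / 2 by linarith)]
    with s hs
  have h1 : δ / 2 ≤ s - a := by linarith [hs.1, min_le_left (t - a) (b - t)]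
  have h2 : δ / 2 ≤ b - s := by linarith [hs.2, min_le_right (t - a) (b - t)]
  rw [cutoff, smoothTransition.one_of_one_le, smoothTransition.one_of_one_le, one_mul]
  · nlinarith
  · nlinarith

/-- The cutoff may have a steep derivative only where the distance to the end points is small. -/
lemma exists_abs_deriv_cutoff_mul_le :
    ∃ c, 0 ≤ c ∧ ∀ (a b k t r : ℝ), 0 < k → t ∈ Ioo a b → 0 ≤ r → r ≤ t - a → r ≤ b - t →
      |deriv (cutoff a b k) t| * r ≤ c := by
  obtain ⟨c, hc⟩ := exists_bound_deriv_smoothTransition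
  have hc0 : 0 ≤ c := (abs_nonneg _).trans (hc 0)
  refine ⟨2 * c + 2 * c, by positivity, fun a b k t r hk ht hr h1 h2 => ?_⟩
  have hst : Differentiable ℝ smoothTransition :=
    (smoothTransition.contDiff (n := 1)).differentiable one_ne_zero
  have hd1 : HasDerivAt (fun t => smoothTransition (k * (t - a) - 1))
      (deriv smoothTransition (k * (t - a) - 1) * k) t := by
    have : HasDerivAt (fun t => k * (t - a) - 1) k t := by
      simpa using (((hasDerivAt_id t).sub_const a).const_mul k).sub_const 1
    exact (hst _).hasDerivAt.comp t this
  have hd2 : HasDerivAt (fun t => smoothTransition (k * (b - t) - 1))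
      (deriv smoothTransition (k * (b - t) - 1) * (-k)) t := by
    have : HasDerivAt (fun t => k * (b - t) - 1) (-k) t := by
      simpa using (((hasDerivAt_id t).const_sub b).const_mul k).sub_const 1
    exact (hst _).hasDerivAt.comp t this
  have hd : deriv (cutoff a b k) t = _ := (hd1.mul hd2).deriv
  rw [hd]
  -- the derivative of a transition at distance `s` vanishes unless `k s ≤ 2`
  have key : ∀ s, r ≤ s → |deriv smoothTransition (k * s - 1)| * (k * r) ≤ 2 * c := by
    intro s hs
    by_cases hks : 1 < k * s - 1
    · rw [deriv_smoothTransition_of_one_lt hks]; simp [hc0]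
    · have : k * r ≤ 2 := by nlinarith
      have h0 : 0 ≤ k * r := by positivity
      calc _ ≤ c * 2 := mul_le_mul (hc _) this h0 hc0
        _ = _ := by ring
  have b1 : ∀ s, |smoothTransition s| ≤ 1 := fun s => by
    rw [abs_of_nonneg (smoothTransition.nonneg _)]; exact smoothTransition.le_one _
  refine (mul_le_mul_of_nonneg_right (abs_add_le _ _) hr).trans ?_
  rw [add_mul]
  apply add_le_add
  · calc _ = (|deriv smoothTransition (k * (t - a) - 1)| * (k * r)) *
          |smoothTransition (k * (b - t) - 1)| := by
          rw [abs_mul, abs_mul, abs_of_pos hk]; ring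
      _ ≤ 2 * c * 1 := mul_le_mul (key _ h1) (b1 _) (abs_nonneg _) (by positivity)
      _ = _ := by ring
  · calc _ = (|deriv smoothTransition (k * (b - t) - 1)| * (k * r)) *
          |smoothTransition (k * (t - a) - 1)| := by
          rw [abs_mul, abs_mul, abs_neg, abs_of_pos hk]; ring
      _ ≤ 2 * c * 1 := mul_le_mul (key _ h2) (b1 _) (abs_nonneg _) (by positivity)
      _ = _ := by ring

/-- A smooth soft thresholding: it vanishes on `[-ε, ε]` and differs from the identity by at most
`2 ε`. -/
noncomputable def softThreshold (ε t : ℝ) : ℝ :=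
  (t - ε) * smoothTransition ((t - ε) / ε) + (t + ε) * smoothTransition (-(t + ε) / ε)

lemma contDiff_softThreshold (ε : ℝ) {n : ℕ∞} : ContDiff ℝ n (softThreshold ε) := by
  unfold softThreshold
  exact (ContDiff.mul (by fun_prop) (smoothTransition.contDiff.comp (by fun_prop))).add
    (ContDiff.mul (by fun_prop) (smoothTransition.contDiff.comp (by fun_prop)))

lemma softThreshold_neg (ε t : ℝ) : softThreshold ε (-t) = -softThreshold ε t := by
  unfold softThreshold
  rw [show -(-t + ε) / ε = (t - ε) / ε by ring, show (-t - ε) / ε = -(t + ε) / ε by ring]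
  ring

lemma softThreshold_of_nonneg {ε t : ℝ} (hε : 0 < ε) (ht : 0 ≤ t) :
    softThreshold ε t = (t - ε) * smoothTransition ((t - ε) / ε) := by
  have : -(t + ε) / ε ≤ 0 := div_nonpos_of_nonpos_of_nonneg (by linarith) hε.le
  rw [softThreshold, smoothTransition.zero_of_nonpos this, mul_zero, add_zero]

lemma softThreshold_bounds_of_nonneg {ε t : ℝ} (hε : 0 < ε) (ht : 0 ≤ t) :
    |softThreshold ε t| ≤ max (t - ε) 0 ∧ |softThreshold ε t - t| ≤ 2 * ε := by
  rw [softThreshold_of_nonneg hε ht]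
  rcases le_total t ε with h | h
  · have : (t - ε) / ε ≤ 0 := div_nonpos_of_nonpos_of_nonneg (by linarith) hε.le
    rw [smoothTransition.zero_of_nonpos this]
    simp only [mul_zero, abs_zero, zero_sub, abs_neg, abs_of_nonneg ht]
    exact ⟨le_max_right _ _, by linarith⟩
  · have h0 := smoothTransition.nonneg ((t - ε) / ε)
    have h1 := smoothTransition.le_one ((t - ε) / ε)
    have h2 : 0 ≤ t - ε := by linarith
    constructor
    · rw [abs_of_nonneg (by positivity)]
      exact (mul_le_of_le_one_right h2 h1).trans (le_max_left _ _)
    · rcases le_total t (2 * ε) with h3 | h3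
      · rw [abs_le]; constructor <;> nlinarith
      · rw [smoothTransition.one_of_one_le ((one_le_div hε).2 (by linarith))]
        simp only [mul_one, sub_sub_cancel_left, abs_neg, abs_of_pos hε]
        linarith

lemma softThreshold_bounds {ε : ℝ} (hε : 0 < ε) (t : ℝ) :
    |softThreshold ε t| ≤ max (|t| - ε) 0 ∧ |softThreshold ε t - t| ≤ 2 * ε := by
  rcases le_total 0 t with h | h
  · rw [abs_of_nonneg h]; exact softThreshold_bounds_of_nonneg hε h
  · have := softThreshold_bounds_of_nonneg hε (neg_nonneg.2 h)
    rw [softThreshold_neg, abs_neg] at this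
    rw [abs_of_nonpos h]
    refine ⟨this.1, ?_⟩
    rw [← abs_neg]; convert this.2 using 2; ring

/-- If `|t - s| ≤ ε`, soft thresholding of `t` at `ε` stays below `|s|`. -/
lemma abs_softThreshold_le {ε t s : ℝ} (hε : 0 < ε) (h : |t - s| ≤ ε) :
    |softThreshold ε t| ≤ |s| := by
  refine (softThreshold_bounds hε t).1.trans (max_le ?_ (abs_nonneg _))
  have := abs_sub_abs_le_abs_sub t s
  linarith

/-! ### Functions of bounded variation tested against fields that do not vanish on the boundary -/

lemma exists_abs_integral_div_le {Ω : Set Plane} {f : Plane → ℝ} (hf : tv Ω f < ⊤) :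
    ∃ T : ℝ, 0 ≤ T ∧ ∀ φ ∈ testFields Ω, |∫ x in Ω, f x * div φ x| ≤ T := by
  have hle : ∀ φ ∈ testFields Ω, ((∫ x in Ω, f x * div φ x : ℝ) : EReal) ≤ tv Ω f :=
    fun φ hφ => le_iSup₂_of_le φ hφ le_rfl
  refine ⟨max (tv Ω f).toReal 0, le_max_right _ _, fun φ hφ => ?_⟩
  have key : ∀ φ ∈ testFields Ω, (∫ x in Ω, f x * div φ x) ≤ max (tv Ω f).toReal 0 := by
    intro φ hφ
    have h := hle φ hφ
    have hbot : tv Ω f ≠ ⊥ := fun hb => by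
      rw [hb] at h; simp at h
    rw [← EReal.coe_toReal hf.ne hbot] at h
    exact (EReal.coe_le_coe_iff.1 h).trans (le_max_left _ _)
  have hneg : (fun x => -φ x) ∈ testFields Ω := by
    obtain ⟨h1, h2, h3, h4⟩ := hφ
    refine ⟨h1.neg, h2.neg, ?_, fun x hx i => by simpa using h4 x hx i⟩
    rwa [show tsupport (fun x => -φ x) = tsupport φ by
      simp only [tsupport]; congr 1; ext x; simp]
  have h2 := key _ hneg
  have : ∀ x, div (fun x => -φ x) x = -div φ x := by
    intro x
    simp only [div, ← Finset.sum_neg_distrib]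
    refine Finset.sum_congr rfl fun i _ => ?_
    rw [fderiv_fun_neg]; simp
  simp only [this, mul_neg, integral_neg] at h2
  rw [abs_le]
  exact ⟨by linarith, key φ hφ⟩

/-- The bound for test fields with a single nonzero component. -/
lemma integral_mul_fderiv_le_of_testFields {Ω : Set Plane} {f : Plane → ℝ} {T : ℝ}
    (hT : ∀ φ ∈ testFields Ω, |∫ x in Ω, f x * div φ x| ≤ T) {u : Plane → ℝ}
    (hu : ContDiff ℝ 1 u) (hc : HasCompactSupport u) (hs : tsupport u ⊆ Ω) {m : ℝ} (hm : 0 < m)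
    (hb : ∀ x ∈ Ω, |u x| ≤ m) (i : Fin 2) :
    |∫ x in Ω, f x * fderiv ℝ u x (EuclideanSpace.single i 1)| ≤ T * m := by
  set φ : Plane → Plane := fun x => (m⁻¹ * u x) • EuclideanSpace.single i (1 : ℝ) with hφ
  have hsub : tsupport φ ⊆ tsupport u := by
    apply closure_mono
    intro x hx
    rw [Function.mem_support] at hx ⊢
    intro h; apply hx; simp [hφ, h]
  have hmem : φ ∈ testFields Ω := by
    refine ⟨(contDiff_const.mul hu).smul contDiff_const, hc.mono' ?_, hsub.trans hs,
      fun x hx j => ?_⟩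
    · exact subset_closure.trans hsub
    · have h1 : |m⁻¹ * u x| ≤ 1 := by
        rw [abs_mul, abs_of_pos (inv_pos.2 hm), inv_mul_le_iff₀ hm, mul_one]; exact hb x hx
      by_cases hij : j = i
      · subst hij; simpa [hφ] using h1
      · simp [hφ, hij]
  have hd : ∀ x, div φ x = m⁻¹ * fderiv ℝ u x (EuclideanSpace.single i 1) := by
    intro x
    have hud := hu.differentiable one_ne_zero
    rw [hφ, div_smul_single _ (hud.const_mul _), fderiv_const_mul (hud x)]
    rfl
  have h := hT φ hmem
  simp only [hd] at h
  simp only [mul_left_comm _ m⁻¹, integral_const_mul, abs_mul, abs_of_pos (inv_pos.2 hm)] at h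
  rwa [inv_mul_le_iff₀ hm, mul_comm] at h

/-- A smooth function on the plane, supported in `rect A B C D` and equal to `1` away from the
boundary. -/
noncomputable def rectCutoff (A B C D : ℝ) (k : ℕ) (x : Plane) : ℝ :=
  cutoff A B k (x 0) * cutoff C D k (x 1)

lemma contDiff_rectCutoff (A B C D : ℝ) (k : ℕ) : ContDiff ℝ 1 (rectCutoff A B C D k) :=
  ((contDiff_cutoff _ _ _).comp (by fun_prop)).mul ((contDiff_cutoff _ _ _).comp (by fun_prop))

lemma rectCutoff_nonneg (A B C D : ℝ) (k : ℕ) (x : Plane) : 0 ≤ rectCutoff A B C D k x :=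
  mul_nonneg (cutoff_nonneg _ _ _ _) (cutoff_nonneg _ _ _ _)

lemma rectCutoff_le_one (A B C D : ℝ) (k : ℕ) (x : Plane) : rectCutoff A B C D k x ≤ 1 :=
  mul_le_one₀ (cutoff_le_one _ _ _ _) (cutoff_nonneg _ _ _ _) (cutoff_le_one _ _ _ _)

lemma tsupport_rectCutoff_subset {A B C D : ℝ} {k : ℕ} (hk : 0 < k) :
    tsupport (rectCutoff A B C D k) ⊆ rect A B C D := by
  have hk' : (0 : ℝ) < k := Nat.cast_pos.2 hk
  have hcl : IsClosed {x : Plane | x 0 ∈ Icc (A + 1 / (k : ℝ)) (B - 1 / k) ∧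
      x 1 ∈ Icc (C + 1 / (k : ℝ)) (D - 1 / k)} := by
    have h0 : Continuous fun x : Plane => x 0 := by fun_prop
    have h1 : Continuous fun x : Plane => x 1 := by fun_prop
    exact (isClosed_Icc.preimage h0).inter (isClosed_Icc.preimage h1)
  have hk1 : 0 < 1 / (k : ℝ) := by positivity
  refine (closure_minimal (fun x hx => ?_) hcl).trans (fun x hx => ?_)
  · exact ⟨mem_Icc_of_cutoff_ne_zero hk' (left_ne_zero_of_mul hx),
      mem_Icc_of_cutoff_ne_zero hk' (right_ne_zero_of_mul hx)⟩
  · exact ⟨⟨by linarith [hx.1.1], by linarith [hx.1.2]⟩,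
      ⟨by linarith [hx.2.1], by linarith [hx.2.2]⟩⟩

lemma eventually_rectCutoff_eventuallyEq_one {A B C D : ℝ} {x : Plane} (hx : x ∈ rect A B C D) :
    ∀ᶠ k in atTop, rectCutoff A B C D k =ᶠ[𝓝 x] fun _ => 1 := by
  filter_upwards [eventually_cutoff_eventuallyEq_one hx.1,
    eventually_cutoff_eventuallyEq_one hx.2] with k h1 h2
  have c0 : Continuous fun y : Plane => y 0 := by fun_prop
  have c1 : Continuous fun y : Plane => y 1 := by fun_prop
  filter_upwards [(c0.tendsto x).eventually h1, (c1.tendsto x).eventually h2] with y hy1 hy2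
  simp [rectCutoff, hy1, hy2]

/-- The orthogonal projection onto the hyperplane `x i = c`. -/
noncomputable def face (i : Fin 2) (c : ℝ) (x : Plane) : Plane :=
  x + (c - x i) • EuclideanSpace.single i (1 : ℝ)

lemma face_apply_same (i : Fin 2) (c : ℝ) (x : Plane) : face i c x i = c := by
  simp [face]

lemma face_apply_of_ne {i j : Fin 2} (h : j ≠ i) (c : ℝ) (x : Plane) : face i c x j = x j := by
  simp [face, h]

lemma contDiff_face (i : Fin 2) (c : ℝ) : ContDiff ℝ 1 (face i c) := by
  unfold face; fun_prop

lemma norm_sub_face (i : Fin 2) (c : ℝ) (x : Plane) : ‖x - face i c x‖ = |x i - c| := by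
  simp [face, norm_smul, abs_sub_comm]

lemma fderiv_comp_face {u : Plane → ℝ} (hu : ContDiff ℝ 1 u) (i : Fin 2) (c : ℝ) (x : Plane) :
    fderiv ℝ (fun x => u (face i c x)) x (EuclideanSpace.single i 1) = 0 := by
  set e : Plane := EuclideanSpace.single i 1
  have h1 : ∀ t : ℝ, face i c (x + t • e) = face i c x := by
    intro t
    ext j
    by_cases h : j = i
    · subst h; simp [face_apply_same]
    · simp [face_apply_of_ne h, e, h]
  have hd : DifferentiableAt ℝ (fun x => u (face i c x)) x :=
    ((hu.comp (contDiff_face i c)).differentiable one_ne_zero) x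
  rw [← hd.lineDeriv_eq_fderiv, lineDeriv]
  simp [h1]

lemma face_mem_closure_rect {lo hi : Fin 2 → ℝ} (h : ∀ i, lo i < hi i) {x : Plane}
    (hx : x ∈ closure (rect (lo 0) (hi 0) (lo 1) (hi 1))) {i : Fin 2} {c : ℝ}
    (hc : c ∈ Icc (lo i) (hi i)) :
    face i c x ∈ closure (rect (lo 0) (hi 0) (lo 1) (hi 1)) := by
  rw [mem_closure_rect_iff h] at hx ⊢
  intro j
  by_cases hj : j = i
  · subst hj; rwa [face_apply_same]
  · rw [face_apply_of_ne hj]; exact hx j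

/-- A function vanishing on the two sides `x i = lo i`, `x i = hi i` can be cut off without
increasing the limit of the integral of its `i`-th derivative. -/
lemma integral_mul_fderiv_le_of_eq_zero {lo hi : Fin 2 → ℝ} (h : ∀ i, lo i < hi i)
    {f : Plane → ℝ} (hf : IntegrableOn f (rect (lo 0) (hi 0) (lo 1) (hi 1))) {T : ℝ}
    (hT : ∀ φ ∈ testFields (rect (lo 0) (hi 0) (lo 1) (hi 1)),
      |∫ x in rect (lo 0) (hi 0) (lo 1) (hi 1), f x * div φ x| ≤ T)
    {u : Plane → ℝ} (hu : ContDiff ℝ 1 u) {m : ℝ} (hm : 0 < m)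
    (hb : ∀ x ∈ closure (rect (lo 0) (hi 0) (lo 1) (hi 1)), |u x| ≤ m) (i : Fin 2)
    (h0 : ∀ x ∈ closure (rect (lo 0) (hi 0) (lo 1) (hi 1)), x i = lo i ∨ x i = hi i → u x = 0) :
    |∫ x in rect (lo 0) (hi 0) (lo 1) (hi 1), f x * fderiv ℝ u x (EuclideanSpace.single i 1)|
      ≤ T * m := by
  set Ω := rect (lo 0) (hi 0) (lo 1) (hi 1) with hΩ
  set e : Plane := EuclideanSpace.single i 1 with he
  have hud := hu.differentiable one_ne_zero
  have hcont : Continuous (fderiv ℝ u) := hu.continuous_fderiv one_ne_zero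
  obtain ⟨M, hM⟩ :=
    (isCompact_closure_rect (lo 0) (hi 0) (lo 1) (hi 1)).exists_bound_of_continuousOn
      hcont.continuousOn
  have hΩc : ∀ x ∈ Ω, x ∈ closure Ω := fun x hx => subset_closure hx
  have hne : Ω.Nonempty := by
    refine ⟨WithLp.toLp 2 (fun i => (lo i + hi i) / 2), ?_⟩
    rw [hΩ, mem_rect_iff]
    intro j; constructor <;> simp <;> linarith [h j]
  have hM0 : 0 ≤ M := by
    obtain ⟨x, hx⟩ := hne
    exact (norm_nonneg _).trans (hM x (hΩc x hx))
  -- by the boundary values, `u` is bounded by a multiple of the distance to the two sides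
  have hlip : ∀ x ∈ Ω, ∀ c, c = lo i ∨ c = hi i → |u x| ≤ M * |x i - c| := by
    intro x hx c hc
    have hmem : face i c x ∈ closure Ω := face_mem_closure_rect h (hΩc x hx) (by
      rcases hc with rfl | rfl
      · exact ⟨le_rfl, (h i).le⟩
      · exact ⟨(h i).le, le_rfl⟩)
    have hz : u (face i c x) = 0 := h0 _ hmem (by rw [face_apply_same]; exact hc)
    have := (convex_rect (lo 0) (hi 0) (lo 1) (hi 1)).closure.norm_image_sub_le_of_norm_fderiv_le
      (fun y _ => hud y) hM hmem (hΩc x hx)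
    rwa [hz, sub_zero, norm_sub_face] at this
  obtain ⟨c, hc0, hc⟩ := exists_abs_deriv_cutoff_mul_le
  let χ : ℕ → Plane → ℝ := rectCutoff (lo 0) (hi 0) (lo 1) (hi 1)
  have hχ : ∀ k, ContDiff ℝ 1 (χ k) := fun k => contDiff_rectCutoff _ _ _ _ k
  have hχ0 : ∀ k x, 0 ≤ χ k x := fun k x => rectCutoff_nonneg _ _ _ _ k x
  have hχ1 : ∀ k x, χ k x ≤ 1 := fun k x => rectCutoff_le_one _ _ _ _ k x
  -- the cutoff in the other coordinate does not contribute to the `i`-th derivative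
  have hχi : ∀ k x, |fderiv ℝ (χ k) x e| ≤ |deriv (cutoff (lo i) (hi i) k) (x i)| := by
    intro k x
    have hdc : ∀ a b : ℝ, Differentiable ℝ (cutoff a b k) := fun a b =>
      (contDiff_cutoff a b k (n := 1)).differentiable one_ne_zero
    rw [← (((hχ k).differentiable one_ne_zero) x).lineDeriv_eq_fderiv, lineDeriv]
    have hlin : HasDerivAt (fun t : ℝ => x i + t) 1 0 := by
      simpa using (hasDerivAt_id (0 : ℝ)).const_add (x i)
    have hdi : HasDerivAt (fun t => cutoff (lo i) (hi i) k (x i + t))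
        (deriv (cutoff (lo i) (hi i) k) (x i)) 0 := by
      have := (hdc (lo i) (hi i) (x i + 0)).hasDerivAt.comp (0 : ℝ) hlin
      simpa [Function.comp_def] using this
    have hj : ∀ a b t : ℝ, |cutoff a b k t| ≤ 1 := fun a b t => by
      rw [abs_of_nonneg (cutoff_nonneg _ _ _ _)]; exact cutoff_le_one _ _ _ _
    fin_cases i
    · have : (fun t : ℝ => χ k (x + t • e)) =
          fun t => cutoff (lo 0) (hi 0) k (x 0 + t) * cutoff (lo 1) (hi 1) k (x 1) := by
        funext t; simp [χ, rectCutoff, e]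
      have hdi' : HasDerivAt (fun t => cutoff (lo 0) (hi 0) k (x 0 + t))
          (deriv (cutoff (lo 0) (hi 0) k) (x 0)) 0 := hdi
      rw [this, (hdi'.mul_const _).deriv, abs_mul]
      exact mul_le_of_le_one_right (abs_nonneg _) (hj _ _ _)
    · have : (fun t : ℝ => χ k (x + t • e)) =
          fun t => cutoff (lo 0) (hi 0) k (x 0) * cutoff (lo 1) (hi 1) k (x 1 + t) := by
        funext t; simp [χ, rectCutoff, e]
      have hdi' : HasDerivAt (fun t => cutoff (lo 1) (hi 1) k (x 1 + t))
          (deriv (cutoff (lo 1) (hi 1) k) (x 1)) 0 := hdi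
      rw [this, (hdi'.const_mul _).deriv, abs_mul]
      exact mul_le_of_le_one_left (abs_nonneg _) (hj _ _ _)
  have hχe : ∀ x ∈ Ω, ∀ᶠ k in atTop, χ k =ᶠ[𝓝 x] fun _ => 1 := fun x hx =>
    eventually_rectCutoff_eventuallyEq_one hx
  have hsupp : ∀ k : ℕ, 0 < k → tsupport (χ k) ⊆ Ω := fun k hk => tsupport_rectCutoff_subset hk
  have hfd : ∀ k x, fderiv ℝ (fun y => u y * χ k y) x e =
      u x * fderiv ℝ (χ k) x e + χ k x * fderiv ℝ u x e := by
    intro k x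
    rw [fderiv_fun_mul (hud x) (((hχ k).differentiable one_ne_zero) x)]
    rfl
  have hbound : ∀ k : ℕ, 0 < k → |∫ x in Ω, f x * fderiv ℝ (fun y => u y * χ k y) x e| ≤ T * m := by
    intro k hk
    have hsub : tsupport (fun y => u y * χ k y) ⊆ tsupport (χ k) := by
      apply closure_mono
      intro x hx
      exact right_ne_zero_of_mul hx
    refine integral_mul_fderiv_le_of_testFields hT (hu.mul (hχ k)) ?_ (hsub.trans (hsupp k hk)) hm
      (fun x hx => ?_) i
    · exact (isCompact_closure_rect (lo 0) (hi 0) (lo 1) (hi 1)).of_isClosed_subset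
        (isClosed_tsupport _) ((hsub.trans (hsupp k hk)).trans subset_closure)
    · rw [abs_mul, abs_of_nonneg (hχ0 k x)]
      exact (mul_le_of_le_one_right (abs_nonneg _) (hχ1 k x)).trans (hb x (hΩc x hx))
  have hen : ‖e‖ = 1 := by simp [he]
  have hlim : Tendsto (fun k : ℕ => ∫ x in Ω, f x * fderiv ℝ (fun y => u y * χ k y) x e) atTop
      (𝓝 (∫ x in Ω, f x * fderiv ℝ u x e)) := by
    apply tendsto_integral_filter_of_dominated_convergence (fun x => |f x| * (M * c + M))
    · refine Eventually.of_forall fun k => hf.aestronglyMeasurable.mul ?_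
      have : Continuous fun x => fderiv ℝ (fun y => u y * χ k y) x e :=
        ((hu.mul (hχ k)).continuous_fderiv one_ne_zero).clm_apply continuous_const
      exact this.aestronglyMeasurable
    · filter_upwards [eventually_gt_atTop 0] with k hk
      filter_upwards [ae_restrict_mem (measurableSet_rect _ _ _ _)] with x hx
      have hxi := (mem_rect_iff lo hi x).1 hx i
      have hk' : (0 : ℝ) < k := Nat.cast_pos.2 hk
      rw [norm_mul, hfd, Real.norm_eq_abs]
      refine mul_le_mul_of_nonneg_left ((norm_add_le _ _).trans (add_le_add ?_ ?_)) (abs_nonneg _)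
      · rw [norm_mul, Real.norm_eq_abs, Real.norm_eq_abs]
        set r := min (x i - lo i) (hi i - x i)
        have hr : 0 ≤ r := le_min (by linarith [hxi.1]) (by linarith [hxi.2])
        have hur : |u x| ≤ M * r := by
          rcases min_choice (x i - lo i) (hi i - x i) with hr' | hr'
          · have := hlip x hx (lo i) (Or.inl rfl)
            rwa [abs_of_pos (by linarith [hxi.1] : 0 < x i - lo i), ← hr'] at this
          · have := hlip x hx (hi i) (Or.inr rfl)
            rwa [abs_of_neg (by linarith [hxi.2] : x i - hi i < 0), neg_sub, ← hr'] at this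
        calc |u x| * |fderiv ℝ (χ k) x e| ≤ (M * r) * |deriv (cutoff (lo i) (hi i) k) (x i)| :=
              mul_le_mul hur (hχi k x) (abs_nonneg _) (by positivity)
          _ = M * (|deriv (cutoff (lo i) (hi i) k) (x i)| * r) := by ring
          _ ≤ M * c := mul_le_mul_of_nonneg_left
              (hc _ _ _ _ _ hk' hxi hr (min_le_left _ _) (min_le_right _ _)) hM0
      · rw [norm_mul, Real.norm_eq_abs, abs_of_nonneg (hχ0 k x)]
        have h1 : ‖fderiv ℝ u x e‖ ≤ M := by
          have := (fderiv ℝ u x).le_opNorm e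
          rw [hen, mul_one] at this
          exact this.trans (hM x (hΩc x hx))
        calc _ ≤ 1 * M := mul_le_mul (hχ1 k x) h1 (norm_nonneg _) zero_le_one
          _ = M := one_mul M
    · exact hf.abs.mul_const _
    · filter_upwards [ae_restrict_mem (measurableSet_rect _ _ _ _)] with x hx
      apply tendsto_const_nhds.congr'
      filter_upwards [hχe x hx] with k hk
      rw [hfd, hk.fderiv_eq, hk.eq_of_nhds]
      simp
  refine le_of_tendsto hlim.abs ?_
  filter_upwards [eventually_gt_atTop 0] with k hk using hbound k hk

/-- Linear interpolation between the values on two opposite sides of the rectangle removes the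
boundary values of a function at the cost of an integrable term. -/
lemma integral_mul_fderiv_le {lo hi : Fin 2 → ℝ} (h : ∀ i, lo i < hi i)
    {f : Plane → ℝ} (hf : IsBV (rect (lo 0) (hi 0) (lo 1) (hi 1)) f) (i : Fin 2) :
    ∃ C, 0 ≤ C ∧ ∀ u : Plane → ℝ, ContDiff ℝ 1 u → ∀ m > 0,
      (∀ x ∈ closure (rect (lo 0) (hi 0) (lo 1) (hi 1)), |u x| ≤ m) →
      |∫ x in rect (lo 0) (hi 0) (lo 1) (hi 1), f x * fderiv ℝ u x (EuclideanSpace.single i 1)|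
        ≤ C * m := by
  obtain ⟨T, hT0, hT⟩ := exists_abs_integral_div_le hf.2
  set Ω := rect (lo 0) (hi 0) (lo 1) (hi 1) with hΩ
  set e : Plane := EuclideanSpace.single i 1 with he
  have hd0 : 0 < hi i - lo i := sub_pos.2 (h i)
  refine ⟨T * 2 + 2 / (hi i - lo i) * ∫ x in Ω, |f x|, ?_, fun u hu m hm hb => ?_⟩
  · have : 0 ≤ ∫ x in Ω, |f x| := integral_nonneg fun _ => abs_nonneg _
    positivity
  set a : Plane → ℝ := fun x => u (face i (lo i) x)
  set b : Plane → ℝ := fun x => u (face i (hi i) x)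
  have ha : ContDiff ℝ 1 a := hu.comp (contDiff_face _ _)
  have hb' : ContDiff ℝ 1 b := hu.comp (contDiff_face _ _)
  -- the linear interpolation between the values of `u` on the two sides
  set v : Plane → ℝ := fun x =>
    ((hi i - x i) * a x + (x i - lo i) * b x) / (hi i - lo i) with hv
  have hpr : ContDiff ℝ 1 fun x : Plane => x i := by fun_prop
  have hvc : ContDiff ℝ 1 v :=
    (((contDiff_const.sub hpr).mul ha).add ((hpr.sub contDiff_const).mul hb')).div_const _
  have hvd : ∀ x, fderiv ℝ v x e = (b x - a x) / (hi i - lo i) := by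
    intro x
    have da := (ha.differentiable one_ne_zero) x
    have db := (hb'.differentiable one_ne_zero) x
    have dp := (hpr.differentiable one_ne_zero) x
    have fa : fderiv ℝ a x e = 0 := fderiv_comp_face hu i _ x
    have fb : fderiv ℝ b x e = 0 := fderiv_comp_face hu i _ x
    have fp : fderiv ℝ (fun x : Plane => x i) x e = 1 := by
      have : (fun x : Plane => x i) = ⇑(EuclideanSpace.proj (𝕜 := ℝ) i : Plane →L[ℝ] ℝ) := rfl
      rw [this, ContinuousLinearMap.fderiv]; simp [he]
    have hA := (((hasFDerivAt_const (hi i) x).sub dp.hasFDerivAt).mul da.hasFDerivAt).add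
      ((dp.hasFDerivAt.sub (hasFDerivAt_const (lo i) x)).mul db.hasFDerivAt)
    have hB := (hA.mul_const (hi i - lo i)⁻¹).fderiv
    have : v = fun x => ((hi i - x i) * a x + (x i - lo i) * b x) * (hi i - lo i)⁻¹ := by
      funext x; simp only [hv, div_eq_mul_inv]
    rw [this]
    erw [hB]
    simp [fa, fb, fp, div_eq_mul_inv]
    ring
  have hab : ∀ x ∈ closure Ω, |a x| ≤ m ∧ |b x| ≤ m := fun x hx =>
    ⟨hb _ (face_mem_closure_rect h hx ⟨le_rfl, (h i).le⟩),
      hb _ (face_mem_closure_rect h hx ⟨(h i).le, le_rfl⟩)⟩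
  have hvb : ∀ x ∈ closure Ω, |v x| ≤ m := by
    intro x hx
    have hxi := (mem_closure_rect_iff h x).1 hx i
    obtain ⟨h1, h2⟩ := hab x hx
    rw [abs_le] at h1 h2
    have h3 : 0 ≤ hi i - x i := by linarith [hxi.2]
    have h4 : 0 ≤ x i - lo i := by linarith [hxi.1]
    rw [hv, abs_le, le_div_iff₀ hd0, div_le_iff₀ hd0]
    constructor <;> nlinarith
  have hw := integral_mul_fderiv_le_of_eq_zero h hf.1 hT (u := fun x => u x - v x) (hu.sub hvc)
    (m := 2 * m) (by positivity) (fun x hx => by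
      have := abs_sub (u x) (v x)
      linarith [hb x hx, hvb x hx]) i (by
      intro x hx hxi
      have hself : ∀ c, x i = c → face i c x = x := by
        intro c hc; simp [face, hc]
      rcases hxi with hxi | hxi
      · simp only [hv, a, hself _ hxi, hxi, sub_self, zero_mul, add_zero]
        rw [mul_div_cancel_left₀ _ hd0.ne', sub_self]
      · simp only [hv, b, hself _ hxi, hxi, sub_self, zero_mul, zero_add]
        rw [mul_div_cancel_left₀ _ hd0.ne', sub_self])
  have hfdsub : ∀ x, fderiv ℝ (fun x => u x - v x) x e = fderiv ℝ u x e - fderiv ℝ v x e := by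
    intro x
    rw [fderiv_fun_sub ((hu.differentiable one_ne_zero) x) ((hvc.differentiable one_ne_zero) x)]
    rfl
  have hint : ∀ w : Plane → ℝ, ContDiff ℝ 1 w → IntegrableOn (fun x => f x * fderiv ℝ w x e) Ω := by
    intro w hw
    have hc : Continuous fun x => fderiv ℝ w x e :=
      (hw.continuous_fderiv one_ne_zero).clm_apply continuous_const
    obtain ⟨M, hM⟩ :=
      (isCompact_closure_rect (lo 0) (hi 0) (lo 1) (hi 1)).exists_bound_of_continuousOn
        hc.continuousOn
    refine Integrable.mul_bdd (c := M) hf.1 hc.aestronglyMeasurable ?_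
    filter_upwards [ae_restrict_mem (measurableSet_rect _ _ _ _)] with x hx
      using hM x (subset_closure hx)
  have hv2 : |∫ x in Ω, f x * fderiv ℝ v x e| ≤ (2 / (hi i - lo i) * ∫ x in Ω, |f x|) * m := by
    refine (abs_integral_le_integral_abs).trans ?_
    rw [mul_comm (2 / _), mul_assoc, ← integral_mul_const]
    refine setIntegral_mono_on (hint v hvc).abs (hf.1.abs.mul_const _) (measurableSet_rect _ _ _ _)
      fun x hx => ?_
    rw [abs_mul, hvd, abs_div, abs_of_pos hd0]
    refine mul_le_mul_of_nonneg_left ?_ (abs_nonneg _)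
    rw [div_mul_eq_mul_div]
    gcongr
    have := abs_sub (b x) (a x)
    linarith [(hab x (subset_closure hx)).1, (hab x (subset_closure hx)).2]
  have hsplit : ∫ x in Ω, f x * fderiv ℝ u x e =
      (∫ x in Ω, f x * fderiv ℝ (fun x => u x - v x) x e) + ∫ x in Ω, f x * fderiv ℝ v x e := by
    rw [← integral_add (hint _ (hu.sub hvc)) (hint v hvc)]
    refine integral_congr_ae (Eventually.of_forall fun x => ?_)
    simp only [hfdsub]; ring
  rw [hsplit]
  refine (abs_add_le _ _).trans ?_
  rw [add_mul]
  refine add_le_add (hw.trans (le_of_eq (by ring))) hv2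

/-- The integral of a `BV` function against the divergence of a `C¹` field is controlled by the
maximum of the field on the closed rectangle, even if the field does not vanish on the boundary. -/
theorem IsBV.exists_abs_integral_div_le {A B C D : ℝ} (hAB : A < B) (hCD : C < D)
    {f : Plane → ℝ} (hf : IsBV (rect A B C D) f) :
    ∃ c, 0 ≤ c ∧ ∀ φ : Plane → Plane, ContDiff ℝ 1 φ → ∀ m > 0,
      (∀ x ∈ closure (rect A B C D), ∀ i, |φ x i| ≤ m) →
      |∫ x in rect A B C D, f x * div φ x| ≤ c * m := by
  have h : ∀ i, (![A, C] : Fin 2 → ℝ) i < (![B, D] : Fin 2 → ℝ) i := by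
    simp [Fin.forall_fin_two, hAB, hCD]
  obtain ⟨c0, h00, h0⟩ := integral_mul_fderiv_le h (f := f) (by simpa using hf) 0
  obtain ⟨c1, h10, h1⟩ := integral_mul_fderiv_le h (f := f) (by simpa using hf) 1
  simp only [Matrix.cons_val_zero, Matrix.cons_val_one] at h0 h1
  refine ⟨c0 + c1, by positivity, fun φ hφ m hm hb => ?_⟩
  have hcomp : ∀ i, ContDiff ℝ 1 fun x => φ x i := fun i => by fun_prop
  have e1 : ∀ x, div φ x = fderiv ℝ (fun y => φ y 0) x (EuclideanSpace.single 0 1) +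
      fderiv ℝ (fun y => φ y 1) x (EuclideanSpace.single 1 1) := by
    intro x
    rw [div_eq_sum φ ((hφ.differentiable one_ne_zero) x), Fin.sum_univ_two]
  have hint : ∀ i j, IntegrableOn
      (fun x => f x * fderiv ℝ (fun y => φ y i) x (EuclideanSpace.single j 1)) (rect A B C D) := by
    intro i j
    have hc : Continuous fun x => fderiv ℝ (fun y => φ y i) x (EuclideanSpace.single j 1) :=
      ((hcomp i).continuous_fderiv one_ne_zero).clm_apply continuous_const
    obtain ⟨M, hM⟩ := (isCompact_closure_rect A B C D).exists_bound_of_continuousOn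
      hc.continuousOn
    refine Integrable.mul_bdd (c := M) hf.1 hc.aestronglyMeasurable ?_
    filter_upwards [ae_restrict_mem (measurableSet_rect _ _ _ _)] with x hx
      using hM x (subset_closure hx)
  simp only [e1, mul_add]
  rw [integral_add (hint 0 0) (hint 1 1)]
  refine (abs_add_le _ _).trans ?_
  rw [add_mul]
  exact add_le_add (h0 _ (hcomp 0) m hm fun x hx => hb x hx 0)
    (h1 _ (hcomp 1) m hm fun x hx => hb x hx 1)

/-! ### The divergence theorem on a rectangle -/

/-- The outward flux of a vector field through the boundary of the rectangle `(a, b) × (c, d)`. -/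
noncomputable def flux (a b c d : ℝ) (φ : Plane → Plane) : ℝ :=
  (∫ x in a..b, φ !₂[x, d] 1) - (∫ x in a..b, φ !₂[x, c] 1) +
    (∫ y in c..d, φ !₂[b, y] 0) - ∫ y in c..d, φ !₂[a, y] 0

lemma measurePreserving_prodToPlane :
    MeasurePreserving (fun x : ℝ × ℝ => (!₂[x.1, x.2] : Plane)) :=
  (PiLp.volume_preserving_toLp (Fin 2)).comp (volume_preserving_finTwoArrow ℝ).symm

lemma measurableEmbedding_prodToPlane :
    MeasurableEmbedding (fun x : ℝ × ℝ => (!₂[x.1, x.2] : Plane)) :=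
  (MeasurableEquiv.toLp 2 (Fin 2 → ℝ)).measurableEmbedding.comp
    (MeasurableEquiv.finTwoArrow (α := ℝ)).symm.measurableEmbedding

/-- The divergence theorem, transported from `ℝ × ℝ` to the Euclidean plane. -/
lemma integral_div_eq_flux {a b c d : ℝ} (hab : a < b) (hcd : c < d) {φ : Plane → Plane}
    (hc : ContinuousOn φ (closure (rect a b c d)))
    (hd : ∀ x ∈ rect a b c d, DifferentiableAt ℝ φ x)
    (hi : IntegrableOn (div φ) (rect a b c d)) :
    ∫ x in rect a b c d, div φ x = flux a b c d φ := by
  let p : ℝ × ℝ → Plane := fun x => !₂[x.1, x.2]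
  let pL : ℝ × ℝ →L[ℝ] Plane :=
    (ContinuousLinearMap.fst ℝ ℝ ℝ).smulRight (EuclideanSpace.single 0 (1 : ℝ)) +
      (ContinuousLinearMap.snd ℝ ℝ ℝ).smulRight (EuclideanSpace.single 1 (1 : ℝ))
  have hpL : ⇑pL = p := by
    funext x; ext i; fin_cases i <;> simp [pL, p]
  have hp : ∀ x, HasFDerivAt p pL x := fun x => hpL ▸ pL.hasFDerivAt
  have hpc : Continuous p := hpL ▸ pL.continuous
  have hpre : p ⁻¹' rect a b c d = Ioo a b ×ˢ Ioo c d := by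
    ext x; simp [rect, p]
  have hpcl : ∀ x ∈ Icc (a, c) (b, d), p x ∈ closure (rect a b c d) := by
    intro x hx
    rw [closure_rect hab hcd]
    exact ⟨⟨hx.1.1, hx.2.1⟩, ⟨hx.1.2, hx.2.2⟩⟩
  have hcomp : ∀ i, ContinuousOn (fun x => φ (p x) i) (Icc (a, c) (b, d)) := by
    intro i
    have h1 : ContinuousOn (fun x => φ (p x)) (Icc (a, c) (b, d)) :=
      hc.comp hpc.continuousOn hpcl
    exact (EuclideanSpace.proj (𝕜 := ℝ) i).continuous.comp_continuousOn h1
  have hder : ∀ i, ∀ x ∈ Ioo (a, c).1 (b, d).1 ×ˢ Ioo (a, c).2 (b, d).2,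
      HasFDerivAt (fun x => φ (p x) i)
        (((EuclideanSpace.proj (𝕜 := ℝ) i).comp (fderiv ℝ φ (p x))).comp pL) x := by
    intro i x hx
    have hx' : p x ∈ rect a b c d := by
      have : x ∈ p ⁻¹' rect a b c d := by rw [hpre]; exact hx
      exact this
    exact ((EuclideanSpace.proj (𝕜 := ℝ) i).hasFDerivAt.comp (p x)
      (hd _ hx').hasFDerivAt).comp x (hp x)
  have hdiv : ∀ x, (((EuclideanSpace.proj (𝕜 := ℝ) 0).comp (fderiv ℝ φ (p x))).comp pL) (1, 0) +
      (((EuclideanSpace.proj (𝕜 := ℝ) 1).comp (fderiv ℝ φ (p x))).comp pL) (0, 1) =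
      div φ (p x) := by
    intro x
    simp [div, Fin.sum_univ_two, pL]
  have hae : (Ioo a b ×ˢ Ioo c d : Set (ℝ × ℝ)) =ᵐ[volume] Icc (a, c) (b, d) := by
    rw [Icc_prod_eq]
    exact Measure.set_prod_ae_eq Ioo_ae_eq_Icc Ioo_ae_eq_Icc
  have hIntOn : IntegrableOn (fun x => div φ (p x)) (Icc (a, c) (b, d)) := by
    refine IntegrableOn.congr_set_ae ?_ hae.symm
    rw [← hpre]
    exact (measurePreserving_prodToPlane.integrableOn_comp_preimage
      measurableEmbedding_prodToPlane).2 hi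
  have key := integral_divergence_prod_Icc_of_hasFDerivAt_of_le
    (fun x => φ (p x) 0) (fun x => φ (p x) 1) _ _ (a, c) (b, d) ⟨hab.le, hcd.le⟩
    (hcomp 0) (hcomp 1) (hder 0) (hder 1) (by simpa only [hdiv] using hIntOn)
  simp only [hdiv] at key
  rw [← setIntegral_congr_set hae, ← hpre,
    measurePreserving_prodToPlane.setIntegral_preimage_emb measurableEmbedding_prodToPlane
      (div φ) (rect a b c d)] at key
  exact key

/-- Comparison of fluxes from a comparison of the normal components on the open sides. -/
lemma flux_le_flux_add {a b c d : ℝ} (hab : a < b) (hcd : c < d) {φ ψ : Plane → Plane}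
    (hφ : ContinuousOn φ (closure (rect a b c d))) (hψ : ContinuousOn ψ (closure (rect a b c d)))
    {ε : ℝ} (h : ∀ j, ∀ y ∈ side a b c d j,
      ∑ i, normal j i * φ y i ≤ ∑ i, normal j i * ψ y i + ε) :
    flux a b c d φ ≤ flux a b c d ψ + ε * (2 * (b - a) + 2 * (d - c)) := by
  have hcl := closure_rect hab hcd
  have cx : ∀ χ : Plane → Plane, ContinuousOn χ (closure (rect a b c d)) → ∀ t ∈ Icc c d,
      ∀ i, IntervalIntegrable (fun x => χ !₂[x, t] i) volume a b := by
    intro χ hχ t ht i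
    apply ContinuousOn.intervalIntegrable_of_Icc hab.le
    refine (EuclideanSpace.proj (𝕜 := ℝ) i).continuous.comp_continuousOn
      (hχ.comp (f := fun x => (!₂[x, t] : Plane)) ?_ ?_)
    · refine Continuous.continuousOn ?_
      exact (PiLp.continuous_toLp 2 _).comp (by fun_prop)
    · intro x hx; rw [hcl]; exact ⟨hx, ht⟩
  have cy : ∀ χ : Plane → Plane, ContinuousOn χ (closure (rect a b c d)) → ∀ t ∈ Icc a b,
      ∀ i, IntervalIntegrable (fun y => χ !₂[t, y] i) volume c d := by
    intro χ hχ t ht i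
    apply ContinuousOn.intervalIntegrable_of_Icc hcd.le
    refine (EuclideanSpace.proj (𝕜 := ℝ) i).continuous.comp_continuousOn
      (hχ.comp (f := fun x => (!₂[t, x] : Plane)) ?_ ?_)
    · refine Continuous.continuousOn ?_
      exact (PiLp.continuous_toLp 2 _).comp (by fun_prop)
    · intro x hx; rw [hcl]; exact ⟨ht, hx⟩
  have hl : a ∈ Icc a b := ⟨le_rfl, hab.le⟩
  have hr : b ∈ Icc a b := ⟨hab.le, le_rfl⟩
  have hbo : c ∈ Icc c d := ⟨le_rfl, hcd.le⟩
  have hto : d ∈ Icc c d := ⟨hcd.le, le_rfl⟩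
  have mono : ∀ {u v : ℝ} (_ : u ≤ v) {f g : ℝ → ℝ} (_ : IntervalIntegrable f volume u v)
      (_ : IntervalIntegrable g volume u v), (∀ x ∈ Ioo u v, f x ≤ g x + ε) →
      ∫ x in u..v, f x ≤ (∫ x in u..v, g x) + ε * (v - u) := by
    intro u v huv f g hf hg hfg
    have h1 : ∫ x in u..v, (g x + ε) = (∫ x in u..v, g x) + ε * (v - u) := by
      rw [intervalIntegral.integral_add hg intervalIntegrable_const,
        intervalIntegral.integral_const, smul_eq_mul, mul_comm]
    rw [← h1]
    exact intervalIntegral.integral_mono_on_of_le_Ioo huv hf (hg.add intervalIntegrable_const) hfg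
  have h3 := mono hab.le (cx φ hφ d hto 1) (cx ψ hψ d hto 1) fun x hx => by
    have := h 3 !₂[x, d] (by simpa [side] using hx)
    simpa [normal, Fin.sum_univ_two] using this
  have h1 := mono hab.le (cx φ hφ c hbo 1).neg (cx ψ hψ c hbo 1).neg fun x hx => by
    have := h 1 !₂[x, c] (by simpa [side] using hx)
    simpa [normal, Fin.sum_univ_two] using this
  have h2 := mono hcd.le (cy φ hφ b hr 0) (cy ψ hψ b hr 0) fun x hx => by
    have := h 2 !₂[b, x] (by simpa [side] using hx)
    simpa [normal, Fin.sum_univ_two] using this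
  have h0 := mono hcd.le (cy φ hφ a hl 0).neg (cy ψ hψ a hl 0).neg fun x hx => by
    have := h 0 !₂[a, x] (by simpa [side] using hx)
    simpa [normal, Fin.sum_univ_two] using this
  simp only [Pi.neg_apply, intervalIntegral.integral_neg] at h0 h1
  unfold flux
  linarith

lemma integrableOn_div_of_contDiffOn {A B C D : ℝ} (hAB : A < B) (hCD : C < D)
    {φ : Plane → Plane} (hφ : ContDiffOn ℝ 1 φ (closure (rect A B C D))) :
    IntegrableOn (div φ) (rect A B C D) := by
  set Ω := rect A B C D with hΩ
  have hopen : IsOpen Ω := isOpen_rect A B C D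
  have hne : Ω.Nonempty := by
    refine ⟨!₂[(A + B) / 2, (C + D) / 2], ?_⟩
    constructor <;> constructor <;> simp <;> linarith
  have hu : UniqueDiffOn ℝ (closure Ω) := by
    refine uniqueDiffOn_convex (convex_rect A B C D).closure ?_
    exact hne.mono (interior_maximal subset_closure hopen)
  have hc : ContinuousOn (fderivWithin ℝ φ (closure Ω)) (closure Ω) :=
    hφ.continuousOn_fderivWithin hu le_rfl
  have hd : ContinuousOn (fun x => ∑ i : Fin 2,
      (fderivWithin ℝ φ (closure Ω) x (EuclideanSpace.single i 1)) i) (closure Ω) := by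
    refine continuousOn_finsetSum _ fun i _ => ?_
    exact (EuclideanSpace.proj (𝕜 := ℝ) i).continuous.comp_continuousOn
      (hc.clm_apply continuousOn_const)
  have h1 := (hd.integrableOn_compact (μ := volume) (isCompact_closure_rect A B C D)).mono_set
    (subset_closure : Ω ⊆ closure Ω)
  refine h1.congr_fun (fun x hx => ?_) hopen.measurableSet
  simp only [div]
  rw [fderivWithin_of_mem_nhds (mem_of_superset (hopen.mem_nhds hx) subset_closure)]

lemma lt_and_lt_of_rect_subset {A B C D a b c d : ℝ} (hab : a < b) (hcd : c < d)
    (hR : rect a b c d ⊆ rect A B C D) : A < B ∧ C < D := by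
  have hm : (!₂[(a + b) / 2, (c + d) / 2] : Plane) ∈ rect a b c d := by
    constructor <;> constructor <;> simp <;> linarith
  obtain ⟨h1, h2⟩ := hR hm
  exact ⟨h1.1.trans h1.2, h2.1.trans h2.2⟩

lemma setIntegral_indicator_one_mul {R Ω : Set Plane} (hR : R ⊆ Ω) (hm : MeasurableSet R)
    (g : Plane → ℝ) :
    ∫ x in Ω, R.indicator (fun _ => (1 : ℝ)) x * g x = ∫ x in R, g x := by
  have : (fun x => R.indicator (fun _ => (1 : ℝ)) x * g x) = R.indicator g := by
    funext x
    by_cases hx : x ∈ R <;> simp [hx]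
  rw [this, setIntegral_indicator hm, inter_eq_self_of_subset_right hR]

lemma integral_indicator_mul_div_eq_flux {A B C D a b c d : ℝ} (hab : a < b) (hcd : c < d)
    (hR : rect a b c d ⊆ rect A B C D) {φ : Plane → Plane}
    (hφ : ContDiffOn ℝ 1 φ (closure (rect A B C D))) :
    ∫ x in rect A B C D, (rect a b c d).indicator (fun _ => (1 : ℝ)) x * div φ x =
      flux a b c d φ := by
  obtain ⟨hAB, hCD⟩ := lt_and_lt_of_rect_subset hab hcd hR
  rw [setIntegral_indicator_one_mul hR (measurableSet_rect a b c d)]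
  refine integral_div_eq_flux hab hcd (hφ.continuousOn.mono (closure_mono hR)) (fun x hx => ?_)
    ((integrableOn_div_of_contDiffOn hAB hCD hφ).mono_set hR)
  exact (hφ.differentiableOn one_ne_zero).differentiableAt
    (mem_of_superset ((isOpen_rect A B C D).mem_nhds (hR hx)) subset_closure)

/-- The indicator function of a rectangle has bounded variation: its total variation is at most the
perimeter. -/
lemma isBV_indicator_rect {A B C D a b c d : ℝ} (hab : a < b) (hcd : c < d)
    (hR : rect a b c d ⊆ rect A B C D) :
    IsBV (rect A B C D) ((rect a b c d).indicator fun _ => (1 : ℝ)) := by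
  constructor
  · have : IntegrableOn (fun _ : Plane => (1 : ℝ)) (rect A B C D) :=
      integrableOn_const (volume_rect_lt_top A B C D).ne
    exact this.indicator (measurableSet_rect a b c d)
  · refine lt_of_le_of_lt (b := ((2 * (b - a) + 2 * (d - c) : ℝ) : EReal)) ?_ (EReal.coe_lt_top _)
    refine iSup₂_le fun φ hφ => EReal.coe_le_coe_iff.2 ?_
    obtain ⟨h1, -, h3, h4⟩ := hφ
    have hle : ∀ x i, |φ x i| ≤ 1 := by
      intro x i
      by_cases hx : x ∈ rect A B C D
      · exact h4 x hx i
      · rw [image_eq_zero_of_notMem_tsupport fun h => hx (h3 h)]; simp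
    rw [integral_indicator_mul_div_eq_flux hab hcd hR h1.contDiffOn]
    have := flux_le_flux_add hab hcd h1.continuous.continuousOn
      (ψ := fun _ => 0) continuousOn_const (ε := 1) fun j y _ => by
        have l0 := abs_le.1 (hle y 0)
        have l1 := abs_le.1 (hle y 1)
        fin_cases j <;> simp [normal, Fin.sum_univ_two] <;> linarith
    refine this.trans (le_of_eq ?_)
    simp [flux]

/-! ### A theta function -/

/-- The infinite product `∏ (1 - qⁿ X)` over `n ≥ 0`. -/
noncomputable def qProd (q X : ℂ) : ℂ := ∏' n : ℕ, (1 - q ^ n * X)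

lemma summable_norm_pow_mul {q : ℂ} (hq : ‖q‖ < 1) (X : ℂ) :
    Summable fun n : ℕ => ‖-(q ^ n * X)‖ := by
  simpa using (summable_geometric_of_lt_one (norm_nonneg _) hq).mul_right ‖X‖

lemma multipliable_qProd {q : ℂ} (hq : ‖q‖ < 1) (X : ℂ) :
    Multipliable fun n : ℕ => 1 - q ^ n * X := by
  simp_rw [sub_eq_add_neg]
  exact multipliable_one_add_of_summable (summable_norm_pow_mul hq X)

lemma qProd_eq {q : ℂ} (hq : ‖q‖ < 1) (X : ℂ) : qProd q X = (1 - X) * qProd q (q * X) := by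
  have e : ∀ n : ℕ, 1 - q ^ (n + 1) * X = 1 - q ^ n * (q * X) := fun n => by ring
  have h1 : Multipliable fun n : ℕ => 1 - q ^ (n + 1) * X := by
    simp only [e]; exact multipliable_qProd hq (q * X)
  have h2 := tprod_eq_zero_mul' (f := fun n : ℕ => 1 - q ^ n * X) h1
  simp only [e, pow_zero, one_mul] at h2
  exact h2

lemma qProd_ne_zero {q : ℂ} (hq : ‖q‖ < 1) {X : ℂ} (h : ∀ n : ℕ, q ^ n * X ≠ 1) :
    qProd q X ≠ 0 := by
  unfold qProd
  simp_rw [sub_eq_add_neg]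
  refine tprod_one_add_ne_zero_of_summable (fun n h0 => h n ?_) (summable_norm_pow_mul hq X)
  linear_combination -h0

lemma differentiable_qProd {q : ℂ} (hq : ‖q‖ < 1) : Differentiable ℂ (qProd q) := by
  have h : HasProdLocallyUniformlyOn (fun (n : ℕ) X => 1 - q ^ n * X) (qProd q) univ := by
    simp_rw [sub_eq_add_neg]
    have : qProd q = fun X => ∏' n : ℕ, (1 + -(q ^ n * X)) := by
      funext X; simp only [qProd, sub_eq_add_neg]
    rw [this]
    apply hasProdLocallyUniformlyOn_of_forall_compact isOpen_univ
    intro K _ hK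
    obtain ⟨R, hR⟩ := hK.isBounded.exists_norm_le
    have hs := (summable_geometric_of_lt_one (norm_nonneg _) hq).mul_right R
    refine hs.hasProdUniformlyOn_nat_one_add hK (.of_forall fun n x hx => ?_) (fun _ => by fun_prop)
    simpa using mul_le_mul_of_nonneg_left (hR x hx) (by positivity)
  rw [← differentiableOn_univ]
  exact h.differentiableOn (.of_forall fun _ => by
    simpa [Finset.prod_fn] using DifferentiableOn.finsetProd (fun _ _ => by fun_prop)) isOpen_univ

lemma conj_qProd {q : ℂ} (hq : ‖q‖ < 1) (hr : starRingEnd ℂ q = q) (X : ℂ) :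
    starRingEnd ℂ (qProd q X) = qProd q (starRingEnd ℂ X) := by
  unfold qProd
  rw [(multipliable_qProd hq X).map_tprod (starRingEnd ℂ) Complex.continuous_conj]
  simp [hr]

section Theta

variable (L H : ℝ)

/-- The nome of the theta function with period `2 L` and quasi-period `2 i H`. -/
noncomputable def nome : ℂ := Complex.exp ((-(2 * π * H / L) : ℝ) : ℂ)

/-- The exponential coordinate `exp (i π w / L)` on the cylinder `ℂ / 2 L ℤ`. -/
noncomputable def cyl (w : ℂ) : ℂ := Complex.exp (π / L * Complex.I * w)

/-- A theta function: an entire function with simple zeros at the points of `2 L ℤ + 2 i H ℤ`. -/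
noncomputable def theta (w : ℂ) : ℂ :=
  qProd (nome L H) (cyl L w) * qProd (nome L H) (nome L H * cyl L (-w))

variable {L H : ℝ}

lemma norm_cyl (w : ℂ) : ‖cyl L w‖ = Real.exp (-(π / L * w.im)) := by
  rw [cyl, Complex.norm_exp]
  congr 1
  rw [show (π / L * Complex.I * w : ℂ) = ((π / L : ℝ) : ℂ) * (Complex.I * w) by push_cast; ring,
    Complex.re_ofReal_mul]
  simp

lemma cyl_add (w v : ℂ) : cyl L (w + v) = cyl L w * cyl L v := by
  simp [cyl, mul_add, Complex.exp_add]

lemma cyl_neg (w : ℂ) : cyl L (-w) = (cyl L w)⁻¹ := by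
  simp [cyl, Complex.exp_neg]

lemma cyl_ne_zero (w : ℂ) : cyl L w ≠ 0 := Complex.exp_ne_zero _

lemma norm_nome : ‖nome L H‖ = Real.exp (-(2 * π * H / L)) := by
  rw [nome, Complex.norm_exp, Complex.ofReal_re]

lemma norm_nome_lt_one (hL : 0 < L) (hH : 0 < H) : ‖nome L H‖ < 1 := by
  rw [norm_nome, Real.exp_lt_one_iff]
  have : 0 < 2 * π * H / L := by positivity
  linarith

lemma nome_ne_zero : nome L H ≠ 0 := Complex.exp_ne_zero _

lemma conj_nome : starRingEnd ℂ (nome L H) = nome L H := by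
  rw [nome, ← Complex.exp_conj, Complex.conj_ofReal]

lemma conj_cyl (w : ℂ) : starRingEnd ℂ (cyl L w) = cyl L (-starRingEnd ℂ w) := by
  rw [cyl, cyl, ← Complex.exp_conj]
  simp

lemma cyl_two_mul (hL : 0 < L) : cyl L (2 * L) = 1 := by
  have : (L : ℂ) ≠ 0 := by exact_mod_cast hL.ne'
  rw [cyl, show (π / L * Complex.I * (2 * L) : ℂ) = 2 * π * Complex.I by field_simp]
  exact Complex.exp_two_pi_mul_I

lemma cyl_height : cyl L (2 * H * Complex.I) = nome L H := by
  rw [cyl, nome]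
  congr 1
  push_cast
  linear_combination (π / L * 2 * H : ℂ) * Complex.I_mul_I

lemma differentiable_theta (hL : 0 < L) (hH : 0 < H) : Differentiable ℂ (theta L H) := by
  have h := differentiable_qProd (norm_nome_lt_one hL hH)
  have hc : Differentiable ℂ (cyl L) := by unfold cyl; fun_prop
  exact (h.comp hc).mul (h.comp ((hc.comp differentiable_neg).const_mul _))

lemma norm_theta_neg_conj (hL : 0 < L) (hH : 0 < H) (w : ℂ) :
    ‖theta L H (-starRingEnd ℂ w)‖ = ‖theta L H w‖ := by
  have hq := norm_nome_lt_one hL hH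
  rw [← Complex.norm_conj (theta L H w), theta, theta, map_mul, conj_qProd hq conj_nome,
    conj_qProd hq conj_nome, map_mul, conj_nome, conj_cyl, conj_cyl]
  simp

lemma theta_add_two_mul (hL : 0 < L) (w : ℂ) : theta L H (w + 2 * L) = theta L H w := by
  unfold theta
  rw [neg_add, cyl_add, cyl_add, cyl_neg (2 * L : ℂ), cyl_two_mul hL]
  simp

/-- The factor `1 - cyl L w` carries the zero at the origin. -/
lemma theta_eq (hL : 0 < L) (hH : 0 < H) (w : ℂ) : theta L H w = (1 - cyl L w) *
    (qProd (nome L H) (nome L H * cyl L w) * qProd (nome L H) (nome L H * cyl L (-w))) := by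
  rw [theta, qProd_eq (norm_nome_lt_one hL hH) (cyl L w), mul_assoc]

lemma norm_theta_neg (hL : 0 < L) (hH : 0 < H) (w : ℂ) :
    ‖theta L H (-w)‖ = Real.exp (π / L * w.im) * ‖theta L H w‖ := by
  have h0 := cyl_ne_zero (L := L) w
  have : theta L H (-w) = -cyl L (-w) * theta L H w := by
    rw [theta_eq hL hH, theta_eq hL hH, neg_neg, cyl_neg]
    field_simp
    ring
  rw [this, norm_mul, norm_neg, norm_cyl]
  simp

lemma norm_theta_add_height (hL : 0 < L) (hH : 0 < H) (w : ℂ) :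
    ‖theta L H (w + 2 * H * Complex.I)‖ = Real.exp (π / L * w.im) * ‖theta L H w‖ := by
  have hq := norm_nome_lt_one hL hH
  have h0 := cyl_ne_zero (L := L) w
  have hn := nome_ne_zero (L := L) (H := H)
  have : theta L H (w + 2 * H * Complex.I) = -cyl L (-w) * theta L H w := by
    rw [theta_eq hL hH w, theta, neg_add, cyl_add, cyl_add, cyl_height, cyl_neg (2 * H * Complex.I),
      cyl_height, mul_comm (cyl L (-w)), mul_inv_cancel_left₀ hn, qProd_eq hq (cyl L (-w)),
      mul_comm (cyl L w), cyl_neg]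
    field_simp
    ring
  rw [this, norm_mul, norm_neg, norm_cyl]
  simp

lemma eq_zero_of_cyl_eq_one (hL : 0 < L) {w : ℂ} (h : cyl L w = 1) (hw : |w.re| < 2 * L) :
    w = 0 := by
  rw [cyl, Complex.exp_eq_one_iff] at h
  obtain ⟨n, hn⟩ := h
  have hLc : (L : ℂ) ≠ 0 := by exact_mod_cast hL.ne'
  have hpi : (π : ℂ) ≠ 0 := by exact_mod_cast Real.pi_ne_zero
  have hw' : w = ((2 * L * n : ℝ) : ℂ) := by
    push_cast
    field_simp at hn
    linear_combination hn
  rw [hw', Complex.ofReal_re, abs_mul, abs_of_pos (by positivity : 0 < 2 * L)] at hw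
  have : |(n : ℝ)| < 1 := by nlinarith
  have hn0 : n = 0 := by
    rw [← Int.cast_abs] at this
    exact Int.abs_lt_one_iff.1 (by exact_mod_cast this)
  rw [hw', hn0]; simp

lemma norm_nome_pow_mul_cyl (hL : 0 < L) (n : ℕ) (w : ℂ) :
    ‖nome L H ^ n * cyl L w‖ = Real.exp (-(π / L * (2 * H * n + w.im))) := by
  rw [norm_mul, norm_pow, norm_nome, norm_cyl, ← Real.exp_nat_mul, ← Real.exp_add]
  congr 1
  field_simp
  ring

lemma nome_pow_mul_cyl_ne_one (hL : 0 < L) {n : ℕ} {w : ℂ} (h : 2 * H * n + w.im ≠ 0) :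
    nome L H ^ n * cyl L w ≠ 1 := by
  intro h1
  have := norm_nome_pow_mul_cyl (H := H) hL n w
  rw [h1, norm_one, eq_comm, Real.exp_eq_one_iff, neg_eq_zero] at this
  have hp : π / L ≠ 0 := by positivity
  exact h (by simpa [hp] using this)

lemma cofactor_ne_zero (hL : 0 < L) (hH : 0 < H) {w : ℂ} (him : |w.im| < 2 * H) :
    qProd (nome L H) (nome L H * cyl L w) * qProd (nome L H) (nome L H * cyl L (-w)) ≠ 0 := by
  have hq := norm_nome_lt_one hL hH
  have key : ∀ v : ℂ, |v.im| < 2 * H → qProd (nome L H) (nome L H * cyl L v) ≠ 0 := by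
    intro v hv
    refine qProd_ne_zero hq fun n => ?_
    rw [← mul_assoc, ← pow_succ]
    apply nome_pow_mul_cyl_ne_one hL
    have := (abs_lt.1 hv).1
    have hn : (0 : ℝ) ≤ n := Nat.cast_nonneg n
    push_cast
    nlinarith
  exact mul_ne_zero (key w him) (key (-w) (by simpa using him))

lemma theta_ne_zero (hL : 0 < L) (hH : 0 < H) {w : ℂ} (hre : |w.re| < 2 * L)
    (him : |w.im| < 2 * H) (h0 : w ≠ 0) : theta L H w ≠ 0 := by
  rw [theta_eq hL hH]
  refine mul_ne_zero (fun h => h0 ?_) (cofactor_ne_zero hL hH him)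
  exact eq_zero_of_cyl_eq_one hL (by linear_combination -h) hre

lemma theta_zero (hL : 0 < L) (hH : 0 < H) : theta L H 0 = 0 := by
  rw [theta_eq hL hH]; simp [cyl]

lemma deriv_theta_zero_ne_zero (hL : 0 < L) (hH : 0 < H) : deriv (theta L H) 0 ≠ 0 := by
  have hq := norm_nome_lt_one hL hH
  have h := differentiable_qProd hq
  have hc : Differentiable ℂ (cyl L) := by unfold cyl; fun_prop
  set U : ℂ → ℂ := fun w =>
    qProd (nome L H) (nome L H * cyl L w) * qProd (nome L H) (nome L H * cyl L (-w)) with hU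
  have hUd : Differentiable ℂ U :=
    (h.comp (hc.const_mul _)).mul (h.comp ((hc.comp differentiable_neg).const_mul _))
  have hU0 : U 0 ≠ 0 := cofactor_ne_zero hL hH (by simp; positivity)
  have hfun : theta L H = fun w => (1 - cyl L w) * U w := funext fun w => theta_eq hL hH w
  have hcd : HasDerivAt (fun w => 1 - cyl L w) (-(π / L * Complex.I)) 0 := by
    have h1 : HasDerivAt (fun w : ℂ => (π / L * Complex.I : ℂ) * w) (π / L * Complex.I) 0 := by
      simpa using (hasDerivAt_id (0 : ℂ)).const_mul (π / L * Complex.I : ℂ)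
    have h2 := (h1.cexp).const_sub 1
    simpa [cyl] using h2
  have hd := (hcd.mul (hUd 0).hasDerivAt).deriv
  have hfun' : theta L H = (fun w => 1 - cyl L w) * U := hfun
  rw [hfun', hd]
  have hLc : (L : ℂ) ≠ 0 := by exact_mod_cast hL.ne'
  have hpi : (π : ℂ) ≠ 0 := by exact_mod_cast Real.pi_ne_zero
  simp [cyl, hU0, hLc, hpi]

/-- The quotient `theta w / w`, an entire function, has no zeros near the fundamental rectangle. -/
lemma dslope_theta_ne_zero (hL : 0 < L) (hH : 0 < H) {w : ℂ} (hre : |w.re| < 2 * L)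
    (him : |w.im| < 2 * H) :
    dslope (theta L H) 0 w ≠ 0 := by
  by_cases h : w = 0
  · rw [h, dslope_same]; exact deriv_theta_zero_ne_zero hL hH
  · rw [dslope_of_ne _ h, slope_def_field, theta_zero hL hH, sub_zero, sub_zero]
    exact div_ne_zero (theta_ne_zero hL hH hre him h) h

lemma theta_eq_mul_dslope (hL : 0 < L) (hH : 0 < H) (w : ℂ) :
    theta L H w = w * dslope (theta L H) 0 w := by
  have := sub_smul_dslope (theta L H) 0 w
  rw [theta_zero hL hH] at this
  simpa using this.symm

lemma differentiable_dslope_theta (hL : 0 < L) (hH : 0 < H) :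
    Differentiable ℂ (dslope (theta L H) 0) := by
  rw [← differentiableOn_univ, Complex.differentiableOn_dslope univ_mem]
  exact (differentiable_theta hL hH).differentiableOn

end Theta

/-! ### Logarithmic derivatives and the Cauchy–Pompeiu formula -/

/-- A logarithmic derivative has at most a simple pole. -/
lemma exists_norm_logDeriv_mul_le {f : ℂ → ℂ} {w : ℂ} (hf : AnalyticAt ℂ f w)
    (h0 : ¬ ∀ᶠ z in 𝓝 w, f z = 0) :
    ∃ C, ∀ᶠ z in 𝓝 w, ‖logDeriv f z‖ * ‖z - w‖ ≤ C := by
  obtain ⟨n, g, hg, hg0, hfg⟩ := hf.exists_eventuallyEq_pow_smul_nonzero_iff.2 h0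
  have hcont : ContinuousAt (logDeriv g) w := by
    have : logDeriv g = fun z => deriv g z / g z := rfl
    rw [this]
    exact hg.deriv.continuousAt.div hg.continuousAt hg0
  refine ⟨n + (‖logDeriv g w‖ + 1) * 1, ?_⟩
  have hb : ∀ᶠ z in 𝓝 w, ‖logDeriv g z‖ < ‖logDeriv g w‖ + 1 :=
    hcont.norm.eventually_lt_const (lt_add_one _)
  have hball : ∀ᶠ z in 𝓝 w, ‖z - w‖ < 1 := by
    filter_upwards [Metric.ball_mem_nhds w one_pos] with z hz
    rwa [← dist_eq_norm]
  filter_upwards [hfg.eventually_nhds, hb, hball, hg.eventually_analyticAt,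
    hg.continuousAt.eventually_ne hg0] with z h1 h2 h3 h4 h5
  by_cases hz : z = w
  · subst hz; simp; positivity
  have hzw : z - w ≠ 0 := sub_ne_zero.2 hz
  have e : logDeriv f z = n / (z - w) + logDeriv g z := by
    have h1' : f =ᶠ[𝓝 z] fun z => (z - w) ^ n * g z := h1
    have : logDeriv f z = logDeriv (fun z => (z - w) ^ n * g z) z := by
      simp only [logDeriv_apply, h1'.deriv_eq, h1'.eq_of_nhds]
    rw [this, logDeriv_mul (f := fun z => (z - w) ^ n) _ (pow_ne_zero _ hzw) h5 (by fun_prop)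
      h4.differentiableAt, logDeriv_fun_pow (by fun_prop)]
    congr 1
    rw [logDeriv_apply, deriv_sub_const, deriv_id'']
    ring
  rw [e]
  refine (mul_le_mul_of_nonneg_right (norm_add_le _ _) (norm_nonneg _)).trans ?_
  rw [add_mul, norm_div]
  refine add_le_add ?_ (mul_le_mul h2.le h3.le (norm_nonneg _) (by positivity))
  rw [div_mul_cancel₀ _ (norm_ne_zero_iff.2 hzw)]
  simp

lemma integrableOn_norm_sub_rpow {s : ℝ} (hs : s < 2) (w : ℂ) (r : ℝ) :
    IntegrableOn (fun z : ℂ => ‖z - w‖ ^ (-s)) (Metric.ball w r) := by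
  have h0 : IntegrableOn (fun z : ℂ => ‖z‖ ^ (-s)) (Metric.ball 0 r) := by
    rw [integrableOn_fun_norm_addHaar volume (f := fun y : ℝ => y ^ (-s)),
      Complex.finrank_real_complex]
    rcases le_or_gt r 0 with hr | hr
    · simp [Ioo_eq_empty (not_lt.2 hr)]
    · have := (intervalIntegral.integrableOn_Ioo_rpow_iff (s := 1 - s) hr).2 (by linarith)
      refine this.congr_fun (fun y hy => ?_) measurableSet_Ioo
      simp only [smul_eq_mul, Nat.add_one_sub_one, pow_one]
      rw [sub_eq_add_neg, rpow_add hy.1, rpow_one]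
  have h1 := (measurePreserving_sub_right volume w).integrableOn_comp_preimage
    (measurableEmbedding_subRight w) (f := fun z : ℂ => ‖z‖ ^ (-s)) (s := Metric.ball 0 r)
  have h2 : (fun z => z - w) ⁻¹' Metric.ball 0 r = Metric.ball w r := by
    ext z; simp [dist_eq_norm]
  rw [h2] at h1
  exact h1.2 h0

lemma measurable_logDeriv {f : ℂ → ℂ} (hf : Differentiable ℂ f) : Measurable (logDeriv f) :=
  (measurable_deriv f).div hf.continuous.measurable

/-- The logarithmic derivative of a nonzero entire function has simple poles, so that it is locally
in `L^s` for `s < 2`. -/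
lemma locallyIntegrable_norm_logDeriv_rpow {f : ℂ → ℂ} (hf : Differentiable ℂ f)
    (hne : ∃ z, f z ≠ 0) {s : ℝ} (hs0 : 0 ≤ s) (hs : s < 2) :
    LocallyIntegrable fun z => ‖logDeriv f z‖ ^ s := by
  intro w
  have han : AnalyticOnNhd ℂ f univ := fun z _ =>
    (hf.differentiableOn.analyticOnNhd isOpen_univ) z (mem_univ z)
  have h0 : ¬ ∀ᶠ z in 𝓝 w, f z = 0 := by
    intro h
    obtain ⟨z, hz⟩ := hne
    exact hz (han.eqOn_zero_of_preconnected_of_eventuallyEq_zero isPreconnected_univ (mem_univ w) h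
      (mem_univ z))
  obtain ⟨C, hC⟩ := exists_norm_logDeriv_mul_le (han w (mem_univ w)) h0
  obtain ⟨r, hr, hball⟩ := Metric.eventually_nhds_iff_ball.1 hC
  have hC0 : 0 ≤ C := by simpa using hball w (Metric.mem_ball_self hr)
  refine ⟨Metric.ball w r, Metric.ball_mem_nhds w hr, ?_⟩
  refine Integrable.mono' ((integrableOn_norm_sub_rpow hs w r).const_mul (C ^ s))
    ((measurable_logDeriv hf).norm.pow_const s).aestronglyMeasurable ?_
  have hw : ∀ᵐ z ∂(volume.restrict (Metric.ball w r)), z ≠ w :=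
    ae_restrict_of_ae (Measure.ae_ne volume w)
  filter_upwards [hw, ae_restrict_mem Metric.isOpen_ball.measurableSet] with z hz hzb
  have hpos : 0 < ‖z - w‖ := norm_pos_iff.2 (sub_ne_zero.2 hz)
  rw [Real.norm_of_nonneg (by positivity), rpow_neg hpos.le, ← inv_rpow hpos.le,
    ← mul_rpow hC0 (by positivity)]
  refine rpow_le_rpow (norm_nonneg _) ?_ hs0
  rw [← div_eq_mul_inv, le_div_iff₀ hpos]
  exact hball z hzb

lemma locallyIntegrable_logDeriv {f : ℂ → ℂ} (hf : Differentiable ℂ f) (hne : ∃ z, f z ≠ 0) :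
    LocallyIntegrable (logDeriv f) := by
  have h := locallyIntegrable_norm_logDeriv_rpow hf hne zero_le_one one_lt_two
  simp only [rpow_one] at h
  exact h.mono (measurable_logDeriv hf).aestronglyMeasurable (by simp)

lemma integrable_mul_of_locallyIntegrable {h : ℂ → ℂ} (hh : LocallyIntegrable h) {g : ℂ → ℝ}
    (hg : Continuous g) (hgc : HasCompactSupport g) (y : ℂ) :
    Integrable fun x => h (x - y) * (g x : ℂ) := by
  have h1 : LocallyIntegrable fun x => h (x - y) := by
    intro x
    obtain ⟨u, hu, hiu⟩ := hh (x - y)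
    refine ⟨(fun x => x - y) ⁻¹' u, (continuous_sub_right y).continuousAt hu, ?_⟩
    exact ((measurePreserving_sub_right volume y).integrableOn_comp_preimage
      (measurableEmbedding_subRight y)).2 hiu
  have := h1.integrable_smul_right_of_hasCompactSupport (g := fun x => (g x : ℂ))
    (by fun_prop) (hgc.comp_left (g := fun t : ℝ => (t : ℂ)) (by simp))
  simpa using this

/-- A function holomorphic near the support of `g` is annihilated by `∂̄ g`. -/
lemma integral_mul_dbar_eq_zero {g : ℂ → ℝ} (hg : ContDiff ℝ 1 g) (hgc : HasCompactSupport g)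
    {h : ℂ → ℂ} (hh : ∀ x ∈ tsupport g, AnalyticAt ℂ h x) :
    (∫ x, h x * (fderiv ℝ g x 1 : ℂ)) +
      Complex.I * ∫ x, h x * (fderiv ℝ g x Complex.I : ℂ) = 0 := by
  set G : ℂ → ℂ := fun x => (g x : ℂ) with hG
  have hGd : Differentiable ℝ G := Complex.ofRealCLM.differentiable.comp
    (hg.differentiable one_ne_zero)
  have hGf : ∀ x v, fderiv ℝ G x v = (fderiv ℝ g x v : ℂ) := by
    intro x v
    have := (Complex.ofRealCLM.hasFDerivAt.comp x
      (hg.differentiable one_ne_zero x).hasFDerivAt).fderiv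
    change fderiv ℝ (⇑Complex.ofRealCLM ∘ g) x v = _
    rw [this]; rfl
  have hts : tsupport G = tsupport g := by
    simp only [tsupport]; congr 1; ext x; simp [hG]
  have hhd : ∀ x ∈ tsupport g, ∀ v, fderiv ℝ h x v = deriv h x * v := by
    intro x hx v
    rw [((hh x hx).differentiableAt.hasDerivAt.hasFDerivAt.restrictScalars ℝ).fderiv]
    simp [mul_comm]
  have hcon : ∀ k : ℂ → ℂ, ContinuousOn k (tsupport g) → Function.support k ⊆ tsupport g →
      Integrable k := by
    intro k hk hks
    rw [← integrableOn_iff_integrable_of_support_subset hks]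
    exact hk.integrableOn_compact hgc
  have hhc : ContinuousOn h (tsupport g) := fun x hx => (hh x hx).continuousAt.continuousWithinAt
  have hhc' : ContinuousOn (deriv h) (tsupport g) := fun x hx =>
    (hh x hx).deriv.continuousAt.continuousWithinAt
  have hgfc : ∀ v : ℂ, Continuous fun x => (fderiv ℝ g x v : ℂ) := fun v =>
    Complex.continuous_ofReal.comp ((hg.continuous_fderiv one_ne_zero).clm_apply continuous_const)
  have hzero : ∀ x ∉ tsupport g, g x = 0 := fun x hx => image_eq_zero_of_notMem_tsupport hx
  have hzero' : ∀ x ∉ tsupport g, fderiv ℝ g x = 0 := fun x hx => by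
    by_contra h'
    exact hx (support_fderiv_subset ℝ h')
  have hI : Integrable fun x => deriv h x * G x := hcon _
    (hhc'.mul (Complex.continuous_ofReal.comp hg.continuous).continuousOn) fun x hx => by
      by_contra h'
      exact hx (by simp [hG, hzero x h'])
  -- integration by parts; the two terms cancel by the Cauchy–Riemann equations for `h`
  have key : ∀ v : ℂ, ∫ x, h x * (fderiv ℝ g x v : ℂ) = -(v * ∫ x, deriv h x * G x) := by
    intro v
    have e1 : (fun x => fderiv ℝ h x v * G x) = fun x => v * (deriv h x * G x) := by
      funext x
      by_cases hx : x ∈ tsupport g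
      · rw [hhd x hx]; ring
      · simp [hG, hzero x hx]
    have := integral_mul_fderiv_eq_neg_fderiv_mul_of_integrable (μ := (volume : Measure ℂ))
      (f := h) (g := G) (v := v) ?_ ?_ ?_ ?_ ?_
    · simp only [hGf] at this
      rw [this, e1, integral_const_mul]
    · rw [e1]; exact hI.const_mul v
    · simp only [hGf]
      exact hcon _ (hhc.mul (hgfc v).continuousOn) fun x hx => by
        by_contra h'
        exact hx (by simp [hzero' x h'])
    · exact hcon _ (hhc.mul (Complex.continuous_ofReal.comp hg.continuous).continuousOn)
        fun x hx => by
          by_contra h'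
          exact hx (by simp [hG, hzero x h'])
    · intro x hx
      rw [hts] at hx
      exact (hh x hx).differentiableAt.restrictScalars ℝ
    · exact fun x _ => hGd x
  rw [key, key]
  linear_combination (-∫ x, deriv h x * G x) * Complex.I_mul_I

/-- The real part of the Cauchy–Pompeiu formula, by integration in polar coordinates. -/
lemma integral_re_inv_mul_dbar {g : ℂ → ℝ} (hg : ContDiff ℝ 1 g) (hgc : HasCompactSupport g) :
    ∫ z : ℂ, (z⁻¹ * ((fderiv ℝ g z 1 : ℂ) + Complex.I * (fderiv ℝ g z Complex.I : ℂ))).re =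
      -(2 * π * g 0) := by
  rw [← Complex.integral_comp_polarCoord_symm]
  have hgd := hg.differentiable one_ne_zero
  -- the radial derivative
  set F : ℝ × ℝ → ℝ := fun p =>
    fderiv ℝ g (p.1 * Complex.exp (p.2 * Complex.I)) (Complex.exp (p.2 * Complex.I)) with hF
  have hFc : Continuous F := by
    have h1 : Continuous fun p : ℝ × ℝ => Complex.exp (p.2 * Complex.I) := by fun_prop
    have h2 : Continuous fun p : ℝ × ℝ => (p.1 : ℂ) * Complex.exp (p.2 * Complex.I) := by fun_prop
    exact ((hg.continuous_fderiv one_ne_zero).comp h2).clm_apply h1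
  have htarget : polarCoord.target = Ioi (0 : ℝ) ×ˢ Ioo (-π) π := rfl
  -- in polar coordinates the real part of the integrand is the radial derivative
  have hpol : ∀ p ∈ Ioi (0 : ℝ) ×ˢ Ioo (-π) π,
      p.1 • ((Complex.polarCoord.symm p)⁻¹ * ((fderiv ℝ g (Complex.polarCoord.symm p) 1 : ℂ) +
        Complex.I * (fderiv ℝ g (Complex.polarCoord.symm p) Complex.I : ℂ))).re = F p := by
    intro p hp
    have hp0 : p.1 ≠ 0 := ne_of_gt hp.1
    have hz : Complex.polarCoord.symm p = p.1 * Complex.exp (p.2 * Complex.I) := by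
      rw [Complex.polarCoord_symm_apply, Complex.exp_mul_I]
      push_cast; ring
    rw [hz]
    simp only [hF]
    set z : ℂ := p.1 * Complex.exp (p.2 * Complex.I)
    have e1 : fderiv ℝ g z (Complex.exp (p.2 * Complex.I)) =
        cos p.2 * fderiv ℝ g z 1 + sin p.2 * fderiv ℝ g z Complex.I := by
      have : Complex.exp (p.2 * Complex.I) = cos p.2 • (1 : ℂ) + sin p.2 • Complex.I := by
        rw [Complex.exp_mul_I]; simp
      rw [this, map_add, map_smul, map_smul]; rfl
    have e2 : z⁻¹ = ((p.1⁻¹ : ℝ) : ℂ) * ((cos p.2 : ℂ) - sin p.2 * Complex.I) := by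
      have : (Complex.exp (p.2 * Complex.I))⁻¹ = (cos p.2 : ℂ) - sin p.2 * Complex.I := by
        rw [← Complex.exp_neg, ← neg_mul, ← Complex.ofReal_neg, Complex.exp_mul_I]
        push_cast
        rw [Complex.cos_neg, Complex.sin_neg]; ring
      rw [mul_inv, this]; push_cast; rfl
    rw [e1, e2, mul_assoc, Complex.re_ofReal_mul, smul_eq_mul, mul_inv_cancel_left₀ hp0]
    simp [Complex.mul_re, Complex.cos_ofReal_re, Complex.sin_ofReal_re, Complex.cos_ofReal_im,
      Complex.sin_ofReal_im]
  obtain ⟨R, hR⟩ := hgc.isBounded.exists_norm_le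
  set R' := max R 0 + 1
  have hzero : ∀ z : ℂ, R' ≤ ‖z‖ → fderiv ℝ g z = 0 ∧ g z = 0 := by
    intro z hz
    have hz' : z ∉ tsupport g := fun h => by
      have := hR z h
      have := le_max_left R 0
      simp only [R'] at hz
      linarith
    refine ⟨?_, image_eq_zero_of_notMem_tsupport hz'⟩
    by_contra h'
    exact hz' (support_fderiv_subset ℝ h')
  have hnorm : ∀ r : ℝ, 0 < r → ∀ θ : ℝ, ‖(r : ℂ) * Complex.exp (θ * Complex.I)‖ = r := by
    intro r hr θ
    rw [norm_mul, Complex.norm_exp_ofReal_mul_I, mul_one, Complex.norm_real, norm_of_nonneg hr.le]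
  have hFint : IntegrableOn F (Ioi (0 : ℝ) ×ˢ Ioo (-π) π) := by
    have h1 : IntegrableOn F (Icc (0 : ℝ) R' ×ˢ Icc (-π) π) :=
      hFc.continuousOn.integrableOn_compact (isCompact_Icc.prod isCompact_Icc)
    refine IntegrableOn.of_forall_sdiff_eq_zero h1 (measurableSet_Ioi.prod measurableSet_Ioo) ?_
    intro p hp
    have hp0 : 0 < p.1 := hp.1.1
    have hp1 : R' ≤ p.1 := by
      by_contra h'
      exact hp.2 ⟨⟨hp0.le, (not_le.1 h').le⟩, Ioo_subset_Icc_self hp.1.2⟩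
    simp only [hF]
    rw [(hzero _ (by rwa [hnorm _ hp0])).1]; rfl
  rw [htarget, setIntegral_congr_fun (measurableSet_Ioi.prod measurableSet_Ioo) hpol]
  rw [Measure.volume_eq_prod] at hFint ⊢
  rw [setIntegral_prod _ hFint]
  rw [integral_integral_swap (f := fun x y => F (x, y)) (by
    rw [IntegrableOn, ← Measure.prod_restrict] at hFint; exact hFint)]
  -- integration of the radial derivative along a ray
  have hinner : ∀ θ : ℝ, ∫ r in Ioi (0 : ℝ), F (r, θ) = -g 0 := by
    intro θ
    have hd : ∀ r : ℝ,
        HasDerivAt (fun r : ℝ => g (r * Complex.exp (θ * Complex.I))) (F (r, θ)) r := by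
      intro r
      have h1 : HasDerivAt (fun r : ℝ => (r : ℂ) * Complex.exp (θ * Complex.I))
          (Complex.exp (θ * Complex.I)) r := by
        simpa using (Complex.ofRealCLM.hasDerivAt (x := r)).mul_const (Complex.exp (θ * Complex.I))
      exact (hgd _).hasFDerivAt.comp_hasDerivAt r h1
    have hcθ : Continuous fun r => F (r, θ) := hFc.comp (by fun_prop)
    have hint : IntegrableOn (fun r => F (r, θ)) (Ioi 0) := by
      have h1 : IntegrableOn (fun r => F (r, θ)) (Icc 0 R') :=
        hcθ.continuousOn.integrableOn_compact isCompact_Icc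
      refine IntegrableOn.of_forall_sdiff_eq_zero h1 measurableSet_Ioi fun r hr => ?_
      have hr0 : 0 < r := hr.1
      have hr1 : R' ≤ r := by
        by_contra h'
        exact hr.2 ⟨hr0.le, (not_le.1 h').le⟩
      simp only [hF]
      rw [(hzero _ (by rwa [hnorm _ hr0])).1]; rfl
    have hlim : Tendsto (fun r : ℝ => g (r * Complex.exp (θ * Complex.I))) atTop (𝓝 0) := by
      apply tendsto_const_nhds.congr'
      filter_upwards [eventually_ge_atTop R', eventually_gt_atTop 0] with r hr hr0
      rw [(hzero _ (by rwa [hnorm _ hr0])).2]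
    have := integral_Ioi_of_hasDerivAt_of_tendsto (hd 0).continuousAt.continuousWithinAt
      (fun r _ => hd r) hint hlim
    simpa using this
  simp only [hinner]
  rw [integral_const, measureReal_restrict_apply_univ,
    Real.volume_real_Ioo_of_le (by linarith [Real.pi_pos]), smul_eq_mul]
  ring

/-! ### The gradient field of the Green potential -/

/-- The convolution of the logarithmic derivative of `theta` with a density. -/
noncomputable def zconv (L H : ℝ) (g : ℂ → ℝ) (y : ℂ) : ℂ :=
  ∫ x, logDeriv (theta L H) (x - y) * (g x : ℂ)

section

variable {L H : ℝ}

lemma exists_theta_ne_zero (hL : 0 < L) (hH : 0 < H) : ∃ z, theta L H z ≠ 0 := by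
  refine ⟨(L : ℂ), theta_ne_zero hL hH ?_ (by simpa using hH) (by exact_mod_cast hL.ne')⟩
  rw [Complex.ofReal_re, abs_of_pos hL]; linarith

lemma integrable_zconv (hL : 0 < L) (hH : 0 < H) {g : ℂ → ℝ} (hg : Continuous g)
    (hgc : HasCompactSupport g) (y : ℂ) :
    Integrable fun x => logDeriv (theta L H) (x - y) * (g x : ℂ) :=
  integrable_mul_of_locallyIntegrable
    (locallyIntegrable_logDeriv (differentiable_theta hL hH) (exists_theta_ne_zero hL hH)) hg hgc y

lemma zconv_eq_convolution (g : ℂ → ℝ) :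
    zconv L H g = convolution (fun t => logDeriv (theta L H) (-t)) (fun x => (g x : ℂ))
      (ContinuousLinearMap.mul ℝ ℂ) volume := by
  funext y
  rw [convolution_eq_swap]
  simp [zconv]

lemma locallyIntegrable_logDeriv_theta_neg (hL : 0 < L) (hH : 0 < H) :
    LocallyIntegrable fun t => logDeriv (theta L H) (-t) := by
  intro x
  obtain ⟨u, hu, hiu⟩ := (locallyIntegrable_logDeriv (differentiable_theta hL hH)
    (exists_theta_ne_zero hL hH)) (-x)
  refine ⟨(fun x => -x) ⁻¹' u, continuous_neg.continuousAt hu, ?_⟩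
  exact ((Measure.measurePreserving_neg (volume : Measure ℂ)).integrableOn_comp_preimage
      (MeasurableEquiv.neg ℂ).measurableEmbedding).2 hiu

lemma contDiff_zconv (hL : 0 < L) (hH : 0 < H) {g : ℂ → ℝ} (hg : ContDiff ℝ 1 g)
    (hgc : HasCompactSupport g) : ContDiff ℝ 1 (zconv L H g) := by
  rw [zconv_eq_convolution]
  have hg' : ContDiff ℝ 1 fun x => (g x : ℂ) := Complex.ofRealCLM.contDiff.comp hg
  exact (hgc.comp_left (g := fun t : ℝ => (t : ℂ)) (by simp)).contDiff_convolution_right _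
    (locallyIntegrable_logDeriv_theta_neg hL hH) (n := 1) hg'

lemma fderiv_zconv (hL : 0 < L) (hH : 0 < H) {g : ℂ → ℝ} (hg : ContDiff ℝ 1 g)
    (hgc : HasCompactSupport g) (y v : ℂ) :
    fderiv ℝ (zconv L H g) y v = zconv L H (fun x => fderiv ℝ g x v) y := by
  have hg' : ContDiff ℝ 1 fun x => (g x : ℂ) := Complex.ofRealCLM.contDiff.comp hg
  have hgc' : HasCompactSupport fun x => (g x : ℂ) :=
    hgc.comp_left (g := fun t : ℝ => (t : ℂ)) (by simp)
  have h := (hgc'.hasFDerivAt_convolution_right (ContinuousLinearMap.mul ℝ ℂ)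
    (locallyIntegrable_logDeriv_theta_neg hL hH) hg' y).fderiv
  rw [zconv_eq_convolution, h, zconv_eq_convolution,
    convolution_precompR_apply _ (locallyIntegrable_logDeriv_theta_neg hL hH) (hgc'.fderiv ℝ)
      (hg'.continuous_fderiv one_ne_zero)]
  congr 1
  funext x
  have := (Complex.ofRealCLM.hasFDerivAt.comp x
      (hg.differentiable one_ne_zero x).hasFDerivAt).fderiv
  change fderiv ℝ (⇑Complex.ofRealCLM ∘ g) x v = _
  rw [this]; rfl

/-- `zconv` satisfies the Cauchy–Riemann equations at points where the kernel has no poles on the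
support of the density. -/
lemma fderiv_zconv_dbar_eq_zero (hL : 0 < L) (hH : 0 < H) {g : ℂ → ℝ} (hg : ContDiff ℝ 1 g)
    (hgc : HasCompactSupport g) {y : ℂ} (hy : ∀ x ∈ tsupport g, theta L H (x - y) ≠ 0) :
    fderiv ℝ (zconv L H g) y 1 + Complex.I * fderiv ℝ (zconv L H g) y Complex.I = 0 := by
  rw [fderiv_zconv hL hH hg hgc, fderiv_zconv hL hH hg hgc]
  refine integral_mul_dbar_eq_zero hg hgc (h := fun x => logDeriv (theta L H) (x - y)) ?_
  intro x hx
  have han : ∀ z, AnalyticAt ℂ (theta L H) z := fun z => (differentiable_theta hL hH).analyticAt z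
  have h1 : AnalyticAt ℂ (logDeriv (theta L H)) (x - y) :=
    (han _).deriv.div (han _) (hy x hx)
  exact AnalyticAt.fun_comp (f := fun x => x - y) h1 (by fun_prop)

/-- At a point of the domain the Cauchy–Riemann operator maps `zconv` to `-2 π` times the density,
up to an imaginary part: the Cauchy–Pompeiu formula applies to the simple pole of
`logDeriv theta`. -/
lemma re_fderiv_zconv_dbar (hL : 0 < L) (hH : 0 < H) {g : ℂ → ℝ} (hg : ContDiff ℝ 1 g)
    (hgc : HasCompactSupport g) {y : ℂ}
    (hy : ∀ x ∈ tsupport g, |(x - y).re| < 2 * L ∧ |(x - y).im| < 2 * H) :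
    (fderiv ℝ (zconv L H g) y 1 + Complex.I * fderiv ℝ (zconv L H g) y Complex.I).re =
      -(2 * π * g y) := by
  rw [fderiv_zconv hL hH hg hgc, fderiv_zconv hL hH hg hgc]
  set T : ℂ → ℂ := dslope (theta L H) 0 with hT
  have hTan : ∀ z, AnalyticAt ℂ T z := fun z => (differentiable_dslope_theta hL hH).analyticAt z
  set h : ℂ → ℂ := fun x => logDeriv T (x - y) with hh
  have hhan : ∀ x ∈ tsupport g, AnalyticAt ℂ h x := by
    intro x hx
    have h1 : AnalyticAt ℂ (logDeriv T) (x - y) :=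
      (hTan _).deriv.div (hTan _) (dslope_theta_ne_zero hL hH (hy x hx).1 (hy x hx).2)
    exact AnalyticAt.fun_comp (f := fun x => x - y) h1 (by fun_prop)
  -- `logDeriv theta` is the sum of a simple pole and a part holomorphic near the support
  have hsplit : ∀ x ∈ tsupport g, x ≠ y →
      logDeriv (theta L H) (x - y) = (x - y)⁻¹ + h x := by
    intro x hx hxy
    have h0 : x - y ≠ 0 := sub_ne_zero.2 hxy
    have hfun : theta L H = fun w => w * T w := funext fun w => theta_eq_mul_dslope hL hH w
    rw [hfun, logDeriv_mul (f := fun w => w) _ h0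
      (dslope_theta_ne_zero hL hH (hy x hx).1 (hy x hx).2) differentiableAt_fun_id
      (hTan _).differentiableAt]
    simp only [hh, logDeriv_apply, deriv_id'', one_div]
    rfl
  have hdc : ∀ v : ℂ, Continuous fun x => fderiv ℝ g x v := fun v =>
    (hg.continuous_fderiv one_ne_zero).clm_apply continuous_const
  have hds : ∀ v : ℂ, HasCompactSupport fun x => fderiv ℝ g x v := fun v =>
    hgc.fderiv_apply ℝ v
  have hinvli : LocallyIntegrable fun z : ℂ => z⁻¹ := by
    have := locallyIntegrable_logDeriv (f := fun z => z) differentiable_id ⟨1, one_ne_zero⟩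
    convert this using 2 with z
    simp [logDeriv_apply]
  have hinv : ∀ v : ℂ, Integrable fun x => (x - y)⁻¹ * ((fderiv ℝ g x v : ℝ) : ℂ) := fun v =>
    integrable_mul_of_locallyIntegrable hinvli (hdc v) (hds v) y
  have hzero' : ∀ x ∉ tsupport g, fderiv ℝ g x = 0 := fun x hx => by
    by_contra h'
    exact hx (support_fderiv_subset ℝ h')
  have hhint : ∀ v : ℂ, Integrable fun x => h x * ((fderiv ℝ g x v : ℝ) : ℂ) := by
    intro v
    rw [← integrableOn_iff_integrable_of_support_subset (s := tsupport g)]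
    · refine ContinuousOn.integrableOn_compact (μ := volume) hgc (ContinuousOn.mul ?_ ?_)
      · exact fun x hx => (hhan x hx).continuousAt.continuousWithinAt
      · exact (Complex.continuous_ofReal.comp (hdc v)).continuousOn
    · intro x hx
      by_contra h'
      exact hx (by simp [hzero' x h'])
  have hz : ∀ v : ℂ, zconv L H (fun x => fderiv ℝ g x v) y =
      (∫ x, (x - y)⁻¹ * ((fderiv ℝ g x v : ℝ) : ℂ)) + ∫ x, h x * ((fderiv ℝ g x v : ℝ) : ℂ) := by
    intro v
    rw [← integral_add (hinv v) (hhint v), zconv]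
    refine integral_congr_ae ?_
    filter_upwards [Measure.ae_ne volume y] with x hx
    by_cases hxs : x ∈ tsupport g
    · rw [hsplit x hxs hx]; ring
    · simp [hzero' x hxs]
  have h2 := integral_mul_dbar_eq_zero hg hgc hhan
  have h3 : zconv L H (fun x => fderiv ℝ g x 1) y +
      Complex.I * zconv L H (fun x => fderiv ℝ g x Complex.I) y =
      ∫ x, (x - y)⁻¹ *
        (((fderiv ℝ g x 1 : ℝ) : ℂ) + Complex.I * (fderiv ℝ g x Complex.I : ℝ)) := by
    rw [hz, hz, mul_add, add_add_add_comm, h2, add_zero, ← integral_const_mul,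
      ← integral_add (hinv 1) ((hinv _).const_mul _)]
    congr 1; funext x; ring
  have hint : Integrable fun x =>
      (x - y)⁻¹ * (((fderiv ℝ g x 1 : ℝ) : ℂ) + Complex.I * (fderiv ℝ g x Complex.I : ℝ)) := by
    refine ((hinv 1).add ((hinv Complex.I).const_mul Complex.I)).congr (ae_of_all _ fun x => ?_)
    simp only [Pi.add_apply]; ring
  rw [h3, ← RCLike.re_eq_complex_re, ← integral_re hint]
  -- translate the pole to the origin
  set k : ℂ → ℝ := fun z => g (z + y) with hk
  have hkd : ∀ z v, fderiv ℝ k z v = fderiv ℝ g (z + y) v := fun z v => by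
    rw [hk, fderiv_comp_add_right]
  have hkc : HasCompactSupport k := hgc.comp_homeomorph (Homeomorph.addRight y)
  have h4 := integral_re_inv_mul_dbar (g := k) (hg.comp (by fun_prop)) hkc
  simp only [hkd] at h4
  rw [← integral_sub_right_eq_self _ y] at h4
  simp only [sub_add_cancel] at h4
  have hk0 : k 0 = g y := by simp [hk]
  rw [hk0] at h4
  exact h4

/-- The derivative in direction `v` with respect to the pole `y` of the Green's function of the
rectangle `(0, L) × (0, H)`. -/
noncomputable def greenKernel (L H : ℝ) (v y x : ℂ) : ℝ :=
  1 / (2 * π) * (logDeriv (theta L H) (x - y) * v + logDeriv (theta L H) (x + conj y) * conj v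
    - logDeriv (theta L H) (x - conj y) * conj v - logDeriv (theta L H) (x + y) * v).re

/-- The derivative in direction `v` of the Green potential of `g`. -/
noncomputable def potentialDeriv (L H : ℝ) (g : ℂ → ℝ) (v y : ℂ) : ℝ :=
  ∫ x, greenKernel L H v y x * g x

lemma potentialDeriv_eq (hL : 0 < L) (hH : 0 < H) {g : ℂ → ℝ} (hg : Continuous g)
    (hgc : HasCompactSupport g) (v y : ℂ) :
    potentialDeriv L H g v y = 1 / (2 * π) * ((zconv L H g y - zconv L H g (-y)) * v +
      (zconv L H g (-conj y) - zconv L H g (conj y)) * conj v).re := by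
  have hi := integrable_zconv hL hH hg hgc
  have h1 := hi y
  have h2 := hi (-conj y)
  have h3 := hi (conj y)
  have h4 := hi (-y)
  have i2 : Integrable fun x => logDeriv (theta L H) (x - y) * (g x : ℂ) * v +
      logDeriv (theta L H) (x - -conj y) * (g x : ℂ) * conj v :=
    (h1.mul_const v).add (h2.mul_const (conj v))
  have i3 : Integrable fun x => logDeriv (theta L H) (x - y) * (g x : ℂ) * v +
      logDeriv (theta L H) (x - -conj y) * (g x : ℂ) * conj v -
      logDeriv (theta L H) (x - conj y) * (g x : ℂ) * conj v :=
    i2.sub (h3.mul_const (conj v))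
  have hint : Integrable fun x => logDeriv (theta L H) (x - y) * (g x : ℂ) * v +
      logDeriv (theta L H) (x - -conj y) * (g x : ℂ) * conj v -
      logDeriv (theta L H) (x - conj y) * (g x : ℂ) * conj v -
      logDeriv (theta L H) (x - -y) * (g x : ℂ) * v := i3.sub (h4.mul_const v)
  have e : ∫ x, (logDeriv (theta L H) (x - y) * (g x : ℂ) * v +
      logDeriv (theta L H) (x - -conj y) * (g x : ℂ) * conj v -
      logDeriv (theta L H) (x - conj y) * (g x : ℂ) * conj v -
      logDeriv (theta L H) (x - -y) * (g x : ℂ) * v) =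
      zconv L H g y * v + zconv L H g (-conj y) * conj v - zconv L H g (conj y) * conj v -
        zconv L H g (-y) * v := by
    rw [integral_sub i3 (h4.mul_const v), integral_sub i2 (h3.mul_const (conj v)),
      integral_add (h1.mul_const v) (h2.mul_const (conj v))]
    simp only [integral_mul_const, zconv]
  have e2 : (zconv L H g y - zconv L H g (-y)) * v +
      (zconv L H g (-conj y) - zconv L H g (conj y)) * conj v =
      zconv L H g y * v + zconv L H g (-conj y) * conj v - zconv L H g (conj y) * conj v -
        zconv L H g (-y) * v := by ring
  rw [e2, ← e, ← RCLike.re_eq_complex_re, ← integral_re hint, ← integral_const_mul, potentialDeriv]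
  congr 1
  funext x
  rw [greenKernel, mul_assoc, RCLike.re_eq_complex_re, mul_comm _ (g x), ← Complex.re_ofReal_mul]
  congr 2
  simp only [sub_neg_eq_add]
  ring

lemma contDiff_potentialDeriv (hL : 0 < L) (hH : 0 < H) {g : ℂ → ℝ} (hg : ContDiff ℝ 1 g)
    (hgc : HasCompactSupport g) (v : ℂ) : ContDiff ℝ 1 (potentialDeriv L H g v) := by
  have : potentialDeriv L H g v = fun y =>
      1 / (2 * π) * ((zconv L H g y - zconv L H g (-y)) * v +
      (zconv L H g (-conj y) - zconv L H g (conj y)) * conj v).re :=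
    funext fun y => potentialDeriv_eq hL hH hg.continuous hgc v y
  rw [this]
  have hz := contDiff_zconv hL hH hg hgc
  have hc : ContDiff ℝ 1 fun y : ℂ => conj y := Complex.conjCLE.contDiff
  have hs : ContDiff ℝ 1 fun y => (zconv L H g y - zconv L H g (-y)) * v +
      (zconv L H g (-conj y) - zconv L H g (conj y)) * conj v :=
    ((hz.sub (hz.comp contDiff_neg)).mul contDiff_const).add
      (((hz.comp hc.neg).sub (hz.comp hc)).mul contDiff_const)
  exact contDiff_const.mul (Complex.reCLM.contDiff.comp hs)

/-- The gradient of the Green potential of `g` has divergence `-g`. -/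
lemma divergence_potentialDeriv (hL : 0 < L) (hH : 0 < H) {g : ℂ → ℝ} (hg : ContDiff ℝ 1 g)
    (hgc : HasCompactSupport g)
    (hgs : ∀ x ∈ tsupport g, x.re ∈ Ioo 0 L ∧ x.im ∈ Ioo 0 H) {y : ℂ} (hyr : y.re ∈ Ioo 0 L)
    (hyi : y.im ∈ Ioo 0 H) :
    fderiv ℝ (potentialDeriv L H g 1) y 1 +
      fderiv ℝ (potentialDeriv L H g Complex.I) y Complex.I = -g y := by
  have hzd := (contDiff_zconv hL hH hg hgc).differentiable one_ne_zero
  set Z := zconv L H g with hZ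
  have hder : ∀ v w : ℂ, fderiv ℝ (potentialDeriv L H g v) y w =
      1 / (2 * π) * ((fderiv ℝ Z y w - fderiv ℝ Z (-y) (-w)) * v +
      (fderiv ℝ Z (-conj y) (-conj w) - fderiv ℝ Z (conj y) (conj w)) * conj v).re := by
    intro v w
    have hfun : potentialDeriv L H g v = fun y =>
        1 / (2 * π) * ((Z y - Z (-y)) * v + (Z (-conj y) - Z (conj y)) * conj v).re :=
      funext fun y => potentialDeriv_eq hL hH hg.continuous hgc v y
    have hconj : HasFDerivAt (fun y : ℂ => conj y) (Complex.conjCLE : ℂ →L[ℝ] ℂ) y :=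
      Complex.conjCLE.hasFDerivAt
    have d1 := (hzd y).hasFDerivAt
    have d2 := (hzd (-y)).hasFDerivAt.comp y (hasFDerivAt_id y).neg
    have d3 := (hzd (-conj y)).hasFDerivAt.comp y hconj.neg
    have d4 := (hzd (conj y)).hasFDerivAt.comp y hconj
    have d5 := ((d1.sub d2).mul_const v).add ((d3.sub d4).mul_const (conj v))
    have d6 := (Complex.reCLM.hasFDerivAt.comp y d5).const_mul (1 / (2 * π))
    have d7 : HasFDerivAt (fun y => 1 / (2 * π) * ((Z y - Z (-y)) * v +
      (Z (-conj y) - Z (conj y)) * conj v).re) _ y := d6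
    rw [hfun, d7.fderiv]
    simp
    ring
  -- the three image points of `y` are outside the domain, so that their terms do not contribute
  have hne : ∀ x ∈ tsupport g, theta L H (x - -y) ≠ 0 ∧ theta L H (x - -conj y) ≠ 0 ∧
      theta L H (x - conj y) ≠ 0 := by
    intro x hx
    obtain ⟨⟨h1, h2⟩, ⟨h3, h4⟩⟩ := hgs x hx
    obtain ⟨h5, h6⟩ := hyr
    obtain ⟨h7, h8⟩ := hyi
    refine ⟨theta_ne_zero hL hH ?_ ?_ ?_, theta_ne_zero hL hH ?_ ?_ ?_,
      theta_ne_zero hL hH ?_ ?_ ?_⟩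
    · simp [abs_lt]; constructor <;> linarith
    · simp [abs_lt]; constructor <;> linarith
    · intro h; have := congrArg Complex.re h; simp at this; linarith
    · simp [abs_lt]; constructor <;> linarith
    · simp [abs_lt]; constructor <;> linarith
    · intro h; have := congrArg Complex.re h; simp at this; linarith
    · simp [abs_lt]; constructor <;> linarith
    · simp [abs_lt]; constructor <;> linarith
    · intro h; have := congrArg Complex.im h; simp at this; linarith
  have p0 := re_fderiv_zconv_dbar hL hH hg hgc (y := y) fun x hx => by
    obtain ⟨⟨h1, h2⟩, ⟨h3, h4⟩⟩ := hgs x hx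
    obtain ⟨h5, h6⟩ := hyr
    obtain ⟨h7, h8⟩ := hyi
    constructor
    · simp [abs_lt]; constructor <;> linarith
    · simp [abs_lt]; constructor <;> linarith
  have p1 := fderiv_zconv_dbar_eq_zero hL hH hg hgc (y := -y) fun x hx => (hne x hx).1
  have p2 := fderiv_zconv_dbar_eq_zero hL hH hg hgc (y := -conj y) fun x hx => (hne x hx).2.1
  have p3 := fderiv_zconv_dbar_eq_zero hL hH hg hgc (y := conj y) fun x hx => (hne x hx).2.2
  rw [hder, hder, ← mul_add, ← Complex.add_re]
  simp only [map_one, Complex.conj_I, mul_one, map_neg, neg_neg, sub_neg_eq_add]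
  rw [← hZ] at p0 p1 p2 p3
  have e : fderiv ℝ Z y 1 + fderiv ℝ Z (-y) 1 + (-fderiv ℝ Z (-conj y) 1 - fderiv ℝ Z (conj y) 1) +
      ((fderiv ℝ Z y Complex.I + fderiv ℝ Z (-y) Complex.I) * Complex.I +
        (fderiv ℝ Z (-conj y) Complex.I + fderiv ℝ Z (conj y) Complex.I) * -Complex.I) =
      fderiv ℝ Z y 1 + Complex.I * fderiv ℝ Z y Complex.I := by
    linear_combination p1 - p2 - p3
  rw [e, p0]
  field_simp

end

/-! ### Harmonic functions -/

open InnerProductSpace in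
/-- Harmonicity is invariant under isometries of the form `x ↦ l x + p`. -/
lemma harmonicAt_comp_isometry {E F : Type*} [NormedAddCommGroup E] [InnerProductSpace ℝ E]
    [FiniteDimensional ℝ E] [NormedAddCommGroup F] [InnerProductSpace ℝ F] [FiniteDimensional ℝ F]
    (l : E ≃ₗᵢ[ℝ] F) (p : F) {f : F → ℝ} {z : E} (h : HarmonicAt f (l z + p)) :
    HarmonicAt (fun z => f (l z + p)) z := by
  have hlap : ∀ z, Laplacian.laplacian (fun z => f (l z + p)) z =
      Laplacian.laplacian f (l z + p) := by
    intro z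
    set b := stdOrthonormalBasis ℝ E
    rw [laplacian_eq_iteratedFDeriv_orthonormalBasis _ b,
      laplacian_eq_iteratedFDeriv_orthonormalBasis f (b.map l)]
    refine Finset.sum_congr rfl fun i _ => ?_
    have h1 := l.toContinuousLinearEquiv.iteratedFDerivWithin_comp_right (fun y => f (y + p))
      uniqueDiffOn_univ (x := z) (mem_univ _) 2
    rw [preimage_univ, iteratedFDerivWithin_univ, iteratedFDerivWithin_univ,
      iteratedFDeriv_comp_add_right] at h1
    have h2 := congrArg (fun m => m ![b i, b i]) h1
    refine h2.trans ?_
    simp only [ContinuousMultilinearMap.compContinuousLinearMap_apply]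
    congr 1
    funext j
    fin_cases j <;> rfl
  have hc : Continuous fun z : E => l z + p := by fun_prop
  refine ⟨h.1.comp z (by fun_prop), ?_⟩
  filter_upwards [hc.continuousAt.eventually h.2] with w hw
  rw [hlap, hw]; rfl

open InnerProductSpace in
/-- The maximum principle: at an interior maximum, the function is constant on the largest ball
contained in the domain, and this ball touches the boundary. -/
lemma harmonic_nonpos_of_frontier {U : Set ℂ} (hU : IsOpen U) (hb : Bornology.IsBounded U)
    {u : ℂ → ℝ} (hu : HarmonicOnNhd u U) (hc : ContinuousOn u (closure U))
    (hf : ∀ z ∈ frontier U, u z ≤ 0) : ∀ z ∈ closure U, u z ≤ 0 := by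
  intro z hz
  obtain ⟨x, hx, hmax⟩ := hb.isCompact_closure.exists_isMaxOn ⟨z, hz⟩ hc
  refine (hmax hz).trans ?_
  by_cases hxU : x ∈ U
  swap
  · exact hf x (by rw [hU.frontier_eq]; exact ⟨hx, hxU⟩)
  have hne : (Uᶜ).Nonempty := by
    rw [nonempty_compl]
    rintro rfl
    exact NormedSpace.unbounded_univ ℝ ℂ hb
  obtain ⟨y, hy, hxy⟩ := hU.isClosed_compl.exists_infDist_eq_dist hne x
  have hr : 0 < dist x y := dist_pos.2 fun h => hy (h ▸ hxU)
  have hball : Metric.ball x (dist x y) ⊆ U := by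
    intro w hw
    by_contra hwU
    have := Metric.infDist_le_dist_of_mem (x := x) (show w ∈ Uᶜ from hwU)
    rw [hxy, dist_comm x w] at this
    exact absurd (Metric.mem_ball.1 hw) (not_lt.2 this)
  -- on the ball `u` is the real part of a holomorphic `F`, and the maximum modulus principle
  -- applies to `exp F`
  obtain ⟨F, hF, hFu⟩ := (hu.mono hball).exists_analyticOnNhd_ball_re_eq
  have hEd : DifferentiableOn ℂ (fun w => Complex.exp (F w)) (Metric.ball x (dist x y)) :=
    hF.differentiableOn.cexp
  have hxb : x ∈ Metric.ball x (dist x y) := Metric.mem_ball_self hr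
  have hnorm : ∀ w ∈ Metric.ball x (dist x y), ‖Complex.exp (F w)‖ = Real.exp (u w) := by
    intro w hw
    rw [Complex.norm_exp, ← hFu hw]
  have hconst := Complex.norm_eqOn_of_isPreconnected_of_isMaxOn
    (convex_ball x (dist x y)).isPreconnected Metric.isOpen_ball hEd hxb (by
      intro w hw
      simp only [Function.comp, mem_ofPred_eq]
      rw [hnorm w hw, hnorm x hxb]
      exact Real.exp_le_exp.2 (hmax (subset_closure (hball hw))))
  have heq : EqOn u (fun _ => u x) (Metric.ball x (dist x y)) := by
    intro w hw
    have := hconst hw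
    simp only [Function.const_apply, Function.comp] at this
    rw [hnorm w hw, hnorm x hxb] at this
    exact Real.exp_injective this
  have hyc : y ∈ closure (Metric.ball x (dist x y)) := by
    rw [closure_ball x hr.ne', Metric.mem_closedBall, dist_comm]
  have hyU : y ∈ closure U := closure_mono hball hyc
  have hyx : u y = u x := heq.of_subset_closure (hc.mono (closure_mono hball)) continuousOn_const
    subset_closure subset_rfl hyc
  rw [← hyx]
  exact hf y (by rw [hU.frontier_eq]; exact ⟨hyU, hy⟩)

open InnerProductSpace in
lemma harmonic_eq_zero_of_frontier {U : Set ℂ} (hU : IsOpen U) (hb : Bornology.IsBounded U)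
    {u : ℂ → ℝ} (hu : HarmonicOnNhd u U) (hc : ContinuousOn u (closure U))
    (hf : ∀ z ∈ frontier U, u z = 0) {z : ℂ} (hz : z ∈ closure U) : u z = 0 := by
  refine le_antisymm (harmonic_nonpos_of_frontier hU hb hu hc (fun z hz => (hf z hz).le) z hz) ?_
  have := harmonic_nonpos_of_frontier hU hb hu.neg hc.neg
    (fun z hz => by simp [hf z hz]) z hz
  simpa using this

/-- The derivative of `log ‖f‖` is the real part of the logarithmic derivative of `f`. -/
lemma hasFDerivAt_log_norm {f : ℂ → ℂ} {w : ℂ} (hf : DifferentiableAt ℂ f w) (h0 : f w ≠ 0) :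
    HasFDerivAt (fun z => Real.log ‖f z‖)
      (Complex.reCLM.comp ((1 : ℂ →L[ℝ] ℂ).smulRight (logDeriv f w) : ℂ →L[ℝ] ℂ)) w := by
  have h1 : HasDerivAt (fun z => Complex.log (f z / f w)) (logDeriv f w) w := by
    have := (hf.hasDerivAt.div_const (f w)).clog (by simp [div_self h0])
    simpa [logDeriv_apply, div_self h0] using this
  have h2 : HasFDerivAt (fun z => Complex.log (f z / f w))
      ((1 : ℂ →L[ℝ] ℂ).smulRight (logDeriv f w) : ℂ →L[ℝ] ℂ) w := by
    have := h1.hasFDerivAt.restrictScalars ℝ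
    refine this.congr_fderiv ?_
    ext
    all_goals simp
  have h3 := (Complex.reCLM.hasFDerivAt.comp w h2).add_const (Real.log ‖f w‖)
  refine h3.congr_of_eventuallyEq ?_
  filter_upwards [hf.continuousAt.eventually_ne h0] with z hz
  simp [Complex.log_re, Real.log_div (norm_ne_zero_iff.2 hz) (norm_ne_zero_iff.2 h0)]

/-! ### The Green's function of a rectangle -/

section

variable {L H : ℝ}

/-- The rectangle `(0, L) × (0, H)` in the complex plane. -/
def box (L H : ℝ) : Set ℂ := Ioo 0 L ×ℂ Ioo 0 H

lemma isOpen_box : IsOpen (box L H) := isOpen_Ioo.reProdIm isOpen_Ioo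

lemma closure_box (hL : 0 < L) (hH : 0 < H) : closure (box L H) = Icc 0 L ×ℂ Icc 0 H := by
  rw [box, Complex.closure_reProdIm, closure_Ioo hL.ne, closure_Ioo hH.ne]

/-- The Green's function of the rectangle `(0, L) × (0, H)`: the four points `y`, `-y`, `conj y`,
`-conj y` are the images of the pole under the reflections in the coordinate axes, and `theta` takes
care of the translates of these points by `2 L ℤ + 2 i H ℤ`. -/
noncomputable def greenFun (L H : ℝ) (y x : ℂ) : ℝ :=
  -(1 / (2 * π)) * (log ‖theta L H (x - y)‖ + log ‖theta L H (x + y)‖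
    - log ‖theta L H (x + conj y)‖ - log ‖theta L H (x - conj y)‖)

/-- The arguments of `theta` in the Green's function are no lattice points, as long as one of the
two points is in the open rectangle. -/
lemma theta_args_ne_zero (hL : 0 < L) (hH : 0 < H) {x y : ℂ} (hx : x ∈ Icc 0 L ×ℂ Icc 0 H)
    (hy : y ∈ Icc 0 L ×ℂ Icc 0 H) (h : x ∈ box L H ∨ y ∈ box L H) (hxy : x ≠ y) :
    theta L H (x - y) ≠ 0 ∧ theta L H (x + y) ≠ 0 ∧ theta L H (x + conj y) ≠ 0 ∧
      theta L H (x - conj y) ≠ 0 := by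
  obtain ⟨⟨h1, h2⟩, ⟨h3, h4⟩⟩ := hx
  obtain ⟨⟨h5, h6⟩, ⟨h7, h8⟩⟩ := hy
  have key : 0 < x.re + y.re ∧ x.re + y.re < 2 * L ∧ 0 < x.im + y.im ∧ x.im + y.im < 2 * H := by
    rcases h with h | h <;> obtain ⟨⟨k1, k2⟩, ⟨k3, k4⟩⟩ := h <;>
      refine ⟨?_, ?_, ?_, ?_⟩ <;> linarith
  obtain ⟨k1, k2, k3, k4⟩ := key
  refine ⟨theta_ne_zero hL hH ?_ ?_ (sub_ne_zero.2 hxy), theta_ne_zero hL hH ?_ ?_ ?_,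
    theta_ne_zero hL hH ?_ ?_ ?_, theta_ne_zero hL hH ?_ ?_ ?_⟩
  · rw [Complex.sub_re, abs_lt]; constructor <;> linarith
  · rw [Complex.sub_im, abs_lt]; constructor <;> linarith
  · rw [Complex.add_re, abs_lt]; constructor <;> linarith
  · rw [Complex.add_im, abs_lt]; constructor <;> linarith
  · intro h; have := congrArg Complex.re h; rw [Complex.add_re, Complex.zero_re] at this; linarith
  · rw [Complex.add_re, Complex.conj_re, abs_lt]; constructor <;> linarith
  · rw [Complex.add_im, Complex.conj_im, abs_lt]; constructor <;> linarith
  · intro h; have := congrArg Complex.re h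
    rw [Complex.add_re, Complex.conj_re, Complex.zero_re] at this; linarith
  · rw [Complex.sub_re, Complex.conj_re, abs_lt]; constructor <;> linarith
  · rw [Complex.sub_im, Complex.conj_im, abs_lt]; constructor <;> linarith
  · intro h; have := congrArg Complex.im h
    rw [Complex.sub_im, Complex.conj_im, Complex.zero_im] at this; linarith

lemma log_norm_theta_neg (hL : 0 < L) (hH : 0 < H) {w : ℂ} (h : theta L H w ≠ 0) :
    log ‖theta L H (-w)‖ = π / L * w.im + log ‖theta L H w‖ := by
  rw [norm_theta_neg hL hH, Real.log_mul (Real.exp_ne_zero _) (norm_ne_zero_iff.2 h), Real.log_exp]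

lemma log_norm_theta_conj (hL : 0 < L) (hH : 0 < H) {w : ℂ} (h : theta L H w ≠ 0) :
    log ‖theta L H (conj w)‖ = π / L * w.im + log ‖theta L H w‖ := by
  rw [← log_norm_theta_neg hL hH h, ← norm_theta_neg_conj hL hH (-w)]
  simp

lemma log_norm_theta_add_height (hL : 0 < L) (hH : 0 < H) {w : ℂ} (h : theta L H w ≠ 0) :
    log ‖theta L H (w + 2 * H * Complex.I)‖ = π / L * w.im + log ‖theta L H w‖ := by
  rw [norm_theta_add_height hL hH, Real.log_mul (Real.exp_ne_zero _) (norm_ne_zero_iff.2 h),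
    Real.log_exp]

/-- The Green's function vanishes for `x` on the boundary: reflection in the side through `x`
exchanges the images of the pole in pairs with opposite signs. -/
lemma greenFun_eq_zero_of_boundary (hL : 0 < L) (hH : 0 < H) {x y : ℂ}
    (hx : x ∈ Icc 0 L ×ℂ Icc 0 H) (hxb : x ∉ box L H) (hy : y ∈ box L H) :
    greenFun L H y x = 0 := by
  have hyc : y ∈ Icc 0 L ×ℂ Icc 0 H := ⟨Ioo_subset_Icc_self hy.1, Ioo_subset_Icc_self hy.2⟩
  obtain ⟨n1, n2, n3, n4⟩ := theta_args_ne_zero hL hH hx hyc (Or.inr hy) (fun h => hxb (h ▸ hy))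
  have hcases : x.re = 0 ∨ x.re = L ∨ x.im = 0 ∨ x.im = H := by
    by_contra! hc
    exact hxb ⟨⟨lt_of_le_of_ne hx.1.1 hc.1.symm, lt_of_le_of_ne hx.1.2 hc.2.1⟩,
      ⟨lt_of_le_of_ne hx.2.1 hc.2.2.1.symm, lt_of_le_of_ne hx.2.2 hc.2.2.2⟩⟩
  unfold greenFun
  rcases hcases with h | h | h | h
  · have hx' : conj x = -x := by apply Complex.ext <;> simp [h]
    have e1 : log ‖theta L H (x - y)‖ = log ‖theta L H (x + conj y)‖ := by
      rw [← norm_theta_neg_conj hL hH (x - y), map_sub, hx']; ring_nf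
    have e2 : log ‖theta L H (x + y)‖ = log ‖theta L H (x - conj y)‖ := by
      rw [← norm_theta_neg_conj hL hH (x + y), map_add, hx']; ring_nf
    rw [e1, e2]; ring
  · have hx' : conj x = 2 * L - x := by
      apply Complex.ext <;> simp [h]
      ring
    have e1 : log ‖theta L H (x - y)‖ = log ‖theta L H (x + conj y)‖ := by
      rw [← norm_theta_neg_conj hL hH (x - y), map_sub, hx', ← theta_add_two_mul hL]; ring_nf
    have e2 : log ‖theta L H (x + y)‖ = log ‖theta L H (x - conj y)‖ := by
      rw [← norm_theta_neg_conj hL hH (x + y), map_add, hx', ← theta_add_two_mul hL]; ring_nf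
    rw [e1, e2]; ring
  · have hx' : conj x = x := by apply Complex.ext <;> simp [h]
    have e1 := log_norm_theta_conj hL hH n1
    have e2 := log_norm_theta_conj hL hH n2
    rw [map_sub, hx'] at e1
    rw [map_add, hx'] at e2
    rw [e1, e2, Complex.sub_im, Complex.add_im, h]; ring
  · have hx' : x = conj x + 2 * H * Complex.I := by
      apply Complex.ext <;> simp [h]
      ring
    have m1 : theta L H (conj (x - y)) ≠ 0 := by
      rw [← norm_ne_zero_iff, ← norm_theta_neg_conj hL hH, Complex.conj_conj, norm_theta_neg hL hH]
      exact mul_ne_zero (Real.exp_ne_zero _) (norm_ne_zero_iff.2 n1)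
    have m2 : theta L H (conj (x + y)) ≠ 0 := by
      rw [← norm_ne_zero_iff, ← norm_theta_neg_conj hL hH, Complex.conj_conj, norm_theta_neg hL hH]
      exact mul_ne_zero (Real.exp_ne_zero _) (norm_ne_zero_iff.2 n2)
    have e1 := log_norm_theta_conj hL hH n1
    have e2 := log_norm_theta_conj hL hH n2
    have e3 := log_norm_theta_add_height hL hH m1
    have e4 := log_norm_theta_add_height hL hH m2
    have a1 : conj (x - y) + 2 * H * Complex.I = x - conj y := by
      rw [map_sub]; linear_combination -hx'
    have a2 : conj (x + y) + 2 * H * Complex.I = x + conj y := by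
      rw [map_add]; linear_combination -hx'
    rw [a1, e1, Complex.conj_im] at e3
    rw [a2, e2, Complex.conj_im] at e4
    rw [e3, e4]; ring

/-- The Green's function vanishes for a pole on the boundary, where the images of the pole coincide
in pairs with opposite signs, up to lattice translations. -/
lemma greenFun_eq_zero_of_boundary_pole (hL : 0 < L) (hH : 0 < H) {x y : ℂ}
    (hx : x ∈ box L H) (hy : y ∈ Icc 0 L ×ℂ Icc 0 H) (hyb : y ∉ box L H) :
    greenFun L H y x = 0 := by
  have hxc : x ∈ Icc 0 L ×ℂ Icc 0 H := ⟨Ioo_subset_Icc_self hx.1, Ioo_subset_Icc_self hx.2⟩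
  obtain ⟨n1, n2, n3, n4⟩ := theta_args_ne_zero hL hH hxc hy (Or.inl hx) (fun h => hyb (h ▸ hx))
  have hcases : y.re = 0 ∨ y.re = L ∨ y.im = 0 ∨ y.im = H := by
    by_contra! hc
    exact hyb ⟨⟨lt_of_le_of_ne hy.1.1 hc.1.symm, lt_of_le_of_ne hy.1.2 hc.2.1⟩,
      ⟨lt_of_le_of_ne hy.2.1 hc.2.2.1.symm, lt_of_le_of_ne hy.2.2 hc.2.2.2⟩⟩
  unfold greenFun
  rcases hcases with h | h | h | h
  · have hy' : conj y = -y := by apply Complex.ext <;> simp [h]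
    rw [hy', sub_neg_eq_add, ← sub_eq_add_neg]; ring
  · have hy' : conj y = 2 * L - y := by
      apply Complex.ext <;> simp [h]
      ring
    have e1 : theta L H (x + conj y) = theta L H (x - y) := by
      rw [← theta_add_two_mul hL (x - y), hy']; ring_nf
    have e2 : theta L H (x - conj y) = theta L H (x + y) := by
      rw [← theta_add_two_mul hL (x - conj y), hy']; ring_nf
    rw [e1, e2]; ring
  · have hy' : conj y = y := by apply Complex.ext <;> simp [h]
    rw [hy']; ring
  · have hy' : y = conj y + 2 * H * Complex.I := by
      apply Complex.ext <;> simp [h]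
      ring
    have e3 := log_norm_theta_add_height hL hH n1
    have e4 := log_norm_theta_add_height hL hH n3
    have a1 : x - y + 2 * H * Complex.I = x - conj y := by linear_combination -hy'
    have a2 : x + conj y + 2 * H * Complex.I = x + y := by linear_combination -hy'
    rw [a1] at e3
    rw [a2] at e4
    rw [e3, e4]
    simp
    ring

/-- The regular part of the Green's function. -/
noncomputable def greenCorrector (L H : ℝ) (y x : ℂ) : ℝ :=
  -(1 / (2 * π)) * (log ‖dslope (theta L H) 0 (x - y)‖ + log ‖theta L H (x + y)‖
    - log ‖theta L H (x + conj y)‖ - log ‖theta L H (x - conj y)‖)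

lemma greenFun_eq (hL : 0 < L) (hH : 0 < H) {x y : ℂ} (hx : x ∈ Icc 0 L ×ℂ Icc 0 H)
    (hy : y ∈ box L H) (hxy : x ≠ y) :
    greenFun L H y x = -(1 / (2 * π)) * log ‖x - y‖ + greenCorrector L H y x := by
  have hyc : y ∈ Icc 0 L ×ℂ Icc 0 H := ⟨Ioo_subset_Icc_self hy.1, Ioo_subset_Icc_self hy.2⟩
  have n1 := (theta_args_ne_zero hL hH hx hyc (Or.inr hy) hxy).1
  have h0 : x - y ≠ 0 := sub_ne_zero.2 hxy
  rw [theta_eq_mul_dslope hL hH] at n1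
  unfold greenFun greenCorrector
  rw [theta_eq_mul_dslope hL hH (x - y), norm_mul, Real.log_mul (norm_ne_zero_iff.2 h0)
    (norm_ne_zero_iff.2 (right_ne_zero_of_mul n1))]
  ring

lemma harmonicAt_greenCorrector (hL : 0 < L) (hH : 0 < H) {x y : ℂ}
    (hx : x ∈ Icc 0 L ×ℂ Icc 0 H) (hy : y ∈ box L H) :
    InnerProductSpace.HarmonicAt (greenCorrector L H y) x := by
  have hyc : y ∈ Icc 0 L ×ℂ Icc 0 H := ⟨Ioo_subset_Icc_self hy.1, Ioo_subset_Icc_self hy.2⟩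
  have hbox : |(x - y).re| < 2 * L ∧ |(x - y).im| < 2 * H := by
    obtain ⟨⟨h1, h2⟩, ⟨h3, h4⟩⟩ := hx
    obtain ⟨⟨h5, h6⟩, ⟨h7, h8⟩⟩ := hyc
    constructor
    · rw [Complex.sub_re, abs_lt]; constructor <;> linarith
    · rw [Complex.sub_im, abs_lt]; constructor <;> linarith
  have han : ∀ z, AnalyticAt ℂ (theta L H) z := fun z => (differentiable_theta hL hH).analyticAt z
  have hTan : ∀ z, AnalyticAt ℂ (dslope (theta L H) 0) z :=
    fun z => (differentiable_dslope_theta hL hH).analyticAt z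
  have key : ∀ (f : ℂ → ℂ) (c : ℂ), (∀ z, AnalyticAt ℂ f z) → f (x + c) ≠ 0 →
      InnerProductSpace.HarmonicAt (fun x => log ‖f (x + c)‖) x := fun f c hf h0 =>
    AnalyticAt.harmonicAt_log_norm (f := fun x => f (x + c))
      (AnalyticAt.fun_comp (f := fun x => x + c) (hf _) (by fun_prop)) h0
  -- the image terms have no singularity in the closed rectangle, even at `x = y`
  have hn : theta L H (x + y) ≠ 0 ∧ theta L H (x + conj y) ≠ 0 ∧ theta L H (x - conj y) ≠ 0 := by
    by_cases hxy : x = y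
    · subst hxy
      obtain ⟨⟨h1, h2⟩, ⟨h3, h4⟩⟩ := hy
      refine ⟨theta_ne_zero hL hH ?_ ?_ ?_, theta_ne_zero hL hH ?_ ?_ ?_,
        theta_ne_zero hL hH ?_ ?_ ?_⟩
      · rw [Complex.add_re, abs_lt]; constructor <;> linarith
      · rw [Complex.add_im, abs_lt]; constructor <;> linarith
      · intro h; have := congrArg Complex.re h
        rw [Complex.add_re, Complex.zero_re] at this; linarith
      · rw [Complex.add_re, Complex.conj_re, abs_lt]; constructor <;> linarith
      · rw [Complex.add_im, Complex.conj_im, abs_lt]; constructor <;> linarith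
      · intro h; have := congrArg Complex.re h
        rw [Complex.add_re, Complex.conj_re, Complex.zero_re] at this; linarith
      · rw [Complex.sub_re, Complex.conj_re, abs_lt]; constructor <;> linarith
      · rw [Complex.sub_im, Complex.conj_im, abs_lt]; constructor <;> linarith
      · intro h; have := congrArg Complex.im h
        rw [Complex.sub_im, Complex.conj_im, Complex.zero_im] at this; linarith
    · exact (theta_args_ne_zero hL hH hx hyc (Or.inr hy) hxy).2
  have k1 := key _ (-y) hTan (by
    rw [← sub_eq_add_neg]; exact dslope_theta_ne_zero hL hH hbox.1 hbox.2)
  have k2 := key _ y han hn.1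
  have k3 := key _ (conj y) han hn.2.1
  have k4 := key _ (-conj y) han (by rw [← sub_eq_add_neg]; exact hn.2.2)
  have k := (((k1.add k2).sub k3).sub k4).const_smul (c := -(1 / (2 * π)))
  exact k

/-- The derivative of the Green's function with respect to the pole. -/
lemma hasFDerivAt_greenFun (hL : 0 < L) (hH : 0 < H) {x y : ℂ} (hx : x ∈ box L H)
    (hy : y ∈ Icc 0 L ×ℂ Icc 0 H) (hxy : x ≠ y) :
    ∃ D : ℂ →L[ℝ] ℝ, HasFDerivAt (fun y => greenFun L H y x) D y ∧
      ∀ v, D v = greenKernel L H v y x := by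
  have hxc : x ∈ Icc 0 L ×ℂ Icc 0 H := ⟨Ioo_subset_Icc_self hx.1, Ioo_subset_Icc_self hx.2⟩
  obtain ⟨n1, n2, n3, n4⟩ := theta_args_ne_zero hL hH hxc hy (Or.inl hx) hxy
  have hd := differentiable_theta hL hH
  have hconj : HasFDerivAt (fun y : ℂ => conj y) (Complex.conjCLE : ℂ →L[ℝ] ℂ) y :=
    Complex.conjCLE.hasFDerivAt
  have d1 := (hasFDerivAt_log_norm (hd _) n1).comp y ((hasFDerivAt_id y).const_sub x)
  have d2 := (hasFDerivAt_log_norm (hd _) n2).comp y ((hasFDerivAt_id y).const_add x)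
  have d3 := (hasFDerivAt_log_norm (hd _) n3).comp y (hconj.const_add x)
  have d4 := (hasFDerivAt_log_norm (hd _) n4).comp y (hconj.const_sub x)
  have d := (((d1.add d2).sub d3).sub d4).const_mul (-(1 / (2 * π)))
  refine ⟨_, d, fun v => ?_⟩
  simp only [greenKernel]
  simp
  ring

end

/-! ### Identification of the Green's function -/

section

variable {A B C D : ℝ}

/-- The identification of the plane with `ℂ`. -/
noncomputable def planeIso : Plane ≃ₗᵢ[ℝ] ℂ := Complex.orthonormalBasisOneI.repr.symm

/-- The complex coordinate on the plane with origin `(A, C)`. -/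
noncomputable def toC (A C : ℝ) (x : Plane) : ℂ := planeIso x - (A + C * Complex.I)

@[simp] lemma planeIso_re (x : Plane) : (planeIso x).re = x 0 := by
  simp [planeIso, Complex.orthonormalBasisOneI_repr_symm_apply]

@[simp] lemma planeIso_im (x : Plane) : (planeIso x).im = x 1 := by
  simp [planeIso, Complex.orthonormalBasisOneI_repr_symm_apply]

lemma toC_re (x : Plane) : (toC A C x).re = x 0 - A := by simp [toC]

lemma toC_im (x : Plane) : (toC A C x).im = x 1 - C := by simp [toC]

lemma toC_injective : Function.Injective (toC A C) := fun _ _ h =>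
  planeIso.injective (sub_left_injective h)

lemma toC_ne {x y : Plane} (h : x ≠ y) : toC A C x ≠ toC A C y := fun h' => h (toC_injective h')

/-- The inverse of `toC`. -/
noncomputable def ofC (A C : ℝ) (z : ℂ) : Plane :=
  planeIso.symm z + planeIso.symm (A + C * Complex.I)

lemma toC_ofC (z : ℂ) : toC A C (ofC A C z) = z := by simp [toC, ofC]

lemma ofC_toC (x : Plane) : ofC A C (toC A C x) = x := toC_injective (toC_ofC _)

lemma continuous_toC : Continuous (toC A C) := by unfold toC; fun_prop

lemma continuous_ofC : Continuous (ofC A C) := by unfold ofC; fun_prop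

lemma norm_toC_sub (x y : Plane) : ‖toC A C x - toC A C y‖ = ‖x - y‖ := by
  rw [toC, toC, sub_sub_sub_cancel_right, ← map_sub, LinearIsometryEquiv.norm_map]

lemma mem_box_iff {x : Plane} : toC A C x ∈ box (B - A) (D - C) ↔ x ∈ rect A B C D := by
  simp [box, rect, Complex.mem_reProdIm, toC_re, toC_im]

lemma mem_closure_box_iff (hAB : A < B) (hCD : C < D) {x : Plane} :
    toC A C x ∈ Icc 0 (B - A) ×ℂ Icc 0 (D - C) ↔ x ∈ closure (rect A B C D) := by
  rw [closure_rect hAB hCD]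
  simp [Complex.mem_reProdIm, toC_re, toC_im]

lemma frontier_rect : frontier (rect A B C D) = closure (rect A B C D) \ rect A B C D :=
  (isOpen_rect A B C D).frontier_eq

/-- Uniqueness of the Green's function. -/
lemma eq_greenFun (hAB : A < B) (hCD : C < D) {G : Plane → Plane → ℝ}
    (hG : IsDirichletGreen (rect A B C D) G) {x y : Plane} (hx : x ∈ closure (rect A B C D))
    (hy : y ∈ rect A B C D) (hxy : x ≠ y) :
    G x y = greenFun (B - A) (D - C) (toC A C y) (toC A C x) := by
  have hL : 0 < B - A := sub_pos.2 hAB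
  have hH : 0 < D - C := sub_pos.2 hCD
  obtain ⟨h, hharm, hcont, hGh⟩ := hG.exists_corrector y hy
  have hyb := mem_box_iff.2 hy
  rw [hGh x hx hxy, greenFun_eq hL hH ((mem_closure_box_iff hAB hCD).2 hx) hyb (toC_ne hxy),
    norm_toC_sub]
  congr 1
  -- the two regular parts are harmonic with the same boundary values
  set u : ℂ → ℝ := (fun z => h (ofC A C z)) - greenCorrector (B - A) (D - C) (toC A C y) with hu
  have hclo : ∀ z, z ∈ closure (box (B - A) (D - C)) → ofC A C z ∈ closure (rect A B C D) := by
    intro z hz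
    rw [closure_box hL hH] at hz
    rwa [← mem_closure_box_iff hAB hCD, toC_ofC]
  have hb : Bornology.IsBounded (box (B - A) (D - C)) := by
    exact (Metric.isBounded_Ioo _ _).reProdIm (Metric.isBounded_Ioo _ _)
  have huh : InnerProductSpace.HarmonicOnNhd u (box (B - A) (D - C)) := by
    intro z hz
    have hz' : ofC A C z ∈ rect A B C D := by rwa [← mem_box_iff, toC_ofC]
    refine InnerProductSpace.HarmonicAt.sub ?_ (harmonicAt_greenCorrector hL hH
      ⟨Ioo_subset_Icc_self hz.1, Ioo_subset_Icc_self hz.2⟩ hyb)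
    exact harmonicAt_comp_isometry planeIso.symm (planeIso.symm (A + C * Complex.I))
      (hharm _ hz')
  have huc : ContinuousOn u (closure (box (B - A) (D - C))) := by
    refine ContinuousOn.sub (hcont.comp continuous_ofC.continuousOn hclo) ?_
    intro z hz
    rw [closure_box hL hH] at hz
    exact (harmonicAt_greenCorrector hL hH hz hyb).1.continuousAt.continuousWithinAt
  have huf : ∀ z ∈ frontier (box (B - A) (D - C)), u z = 0 := by
    intro z hz
    rw [isOpen_box.frontier_eq] at hz
    have hzc := hz.1
    rw [closure_box hL hH] at hzc
    have h1 : ofC A C z ∈ closure (rect A B C D) := hclo z hz.1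
    have h2 : ofC A C z ∉ rect A B C D := by rw [← mem_box_iff, toC_ofC]; exact hz.2
    have hne : ofC A C z ≠ y := fun h' => h2 (h' ▸ hy)
    have h3 := hG.boundary y hy (ofC A C z) (by rw [frontier_rect]; exact ⟨h1, h2⟩)
    rw [hGh _ h1 hne] at h3
    have h4 := greenFun_eq_zero_of_boundary hL hH hzc hz.2 hyb
    have hne' : z ≠ toC A C y := fun h' => hz.2 (h' ▸ hyb)
    rw [greenFun_eq hL hH hzc hyb hne', ← toC_ofC (A := A) (C := C) z, norm_toC_sub, toC_ofC] at h4
    simp only [hu, Pi.sub_apply]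
    linarith
  have := harmonic_eq_zero_of_frontier isOpen_box hb huh huc huf (z := toC A C x)
    (by rw [closure_box hL hH]; exact (mem_closure_box_iff hAB hCD).2 hx)
  simp only [hu, Pi.sub_apply, ofC_toC] at this
  linarith

/-- The derivative of the Green's function with respect to the pole, up to the boundary. The
explicit formula is differentiable across the boundary, so that the one-sided derivative
agrees with it. -/
lemma dG_eq_greenKernel (hAB : A < B) (hCD : C < D) {G : Plane → Plane → ℝ}
    (hG : IsDirichletGreen (rect A B C D) G) {x y : Plane} (hx : x ∈ rect A B C D)
    (hy : y ∈ closure (rect A B C D)) (hxy : x ≠ y) (v : Plane) :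
    dG (rect A B C D) G v y x =
      greenKernel (B - A) (D - C) (planeIso v) (toC A C y) (toC A C x) := by
  have hL : 0 < B - A := sub_pos.2 hAB
  have hH : 0 < D - C := sub_pos.2 hCD
  have hxb := mem_box_iff.2 hx
  have heq : ∀ y' ∈ closure (rect A B C D), x ≠ y' →
      G x y' = greenFun (B - A) (D - C) (toC A C y') (toC A C x) := by
    intro y' hy' hxy'
    by_cases h : y' ∈ rect A B C D
    · exact eq_greenFun hAB hCD hG (subset_closure hx) h hxy'
    · rw [hG.boundary_pole y' (by rw [frontier_rect]; exact ⟨hy', h⟩) x hx,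
        greenFun_eq_zero_of_boundary_pole hL hH hxb ((mem_closure_box_iff hAB hCD).2 hy')
          (fun h' => h (mem_box_iff.1 h'))]
  obtain ⟨D', hD, hDv⟩ := hasFDerivAt_greenFun hL hH hxb ((mem_closure_box_iff hAB hCD).2 hy)
    (toC_ne hxy)
  have hE : (fun y' => G x y') =ᶠ[𝓝[closure (rect A B C D)] y]
      fun y' => greenFun (B - A) (D - C) (toC A C y') (toC A C x) := by
    have hne : ∀ᶠ y' in 𝓝[closure (rect A B C D)] y, x ≠ y' :=
      nhdsWithin_le_nhds (isOpen_ne.mem_nhds hxy.symm |> fun h => by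
        filter_upwards [h] with y' hy' using fun h'' => hy' h''.symm)
    filter_upwards [hne, self_mem_nhdsWithin] with y' h1 h2 using heq y' h2 h1
  have hlin : HasFDerivAt (toC A C) (planeIso.toContinuousLinearEquiv : Plane →L[ℝ] ℂ) y := by
    have : HasFDerivAt (fun x => planeIso x) (planeIso.toContinuousLinearEquiv : Plane →L[ℝ] ℂ) y :=
      planeIso.toContinuousLinearEquiv.hasFDerivAt
    exact this.sub_const _
  have hcomp : HasFDerivAt (fun y' => greenFun (B - A) (D - C) (toC A C y') (toC A C x))
      (D'.comp (planeIso.toContinuousLinearEquiv : Plane →L[ℝ] ℂ)) y := hD.comp y hlin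
  have huniq : UniqueDiffWithinAt ℝ (closure (rect A B C D)) y := by
    refine uniqueDiffWithinAt_convex (convex_rect A B C D).closure ?_ (subset_closure hy)
    exact ⟨x, interior_maximal subset_closure (isOpen_rect A B C D) hx⟩
  rw [dG, hE.fderivWithin_eq (heq y hy hxy), hcomp.hasFDerivWithinAt.fderivWithin huniq, ← hDv]
  rfl

end

/-! ### Integrability of the derivative of the Green's function, and Green potentials -/

section

variable {A B C D L H : ℝ}

lemma measurePreserving_toC (A C : ℝ) (w : ℂ) :
    MeasurePreserving (fun x : Plane => toC A C x + w) volume volume := by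
  have h := (measurePreserving_add_right (volume : Measure ℂ) (w - (A + C * Complex.I))).comp
    planeIso.measurePreserving
  have e : (fun x : Plane => toC A C x + w) =
      (fun x => x + (w - (A + C * Complex.I))) ∘ planeIso := by
    funext x; simp only [toC, Function.comp_apply]; ring
  rwa [e]

lemma memLp_logDeriv {f : ℂ → ℂ} (hf : Differentiable ℂ f) (hne : ∃ z, f z ≠ 0) {s : ℝ}
    (hs0 : 0 < s) (hs : s < 2) {k : Set ℂ} (hk : IsCompact k) :
    MemLp (logDeriv f) (ENNReal.ofReal s) (volume.restrict k) := by
  rw [← integrable_norm_rpow_iff (measurable_logDeriv hf).aestronglyMeasurable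
    (by simpa using hs0) ENNReal.ofReal_ne_top, ENNReal.toReal_ofReal hs0.le]
  exact (locallyIntegrable_norm_logDeriv_rpow hf hne hs0.le hs).integrableOn_isCompact hk

lemma norm_greenKernel_le (L H : ℝ) {v : ℂ} (hv : ‖v‖ ≤ 1) (x y : ℂ) :
    ‖greenKernel L H v y x‖ ≤ ‖logDeriv (theta L H) (x - y)‖ +
      ‖logDeriv (theta L H) (x + conj y)‖ + ‖logDeriv (theta L H) (x - conj y)‖ +
      ‖logDeriv (theta L H) (x + y)‖ := by
  have hmul : ∀ a w : ℂ, ‖w‖ ≤ 1 → ‖a * w‖ ≤ ‖a‖ := fun a w hw => by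
    rw [norm_mul]; exact mul_le_of_le_one_right (norm_nonneg _) hw
  have hcv : ‖conj v‖ ≤ 1 := by rwa [RCLike.norm_conj]
  have hpi : 1 / (2 * π) ≤ 1 := by
    rw [div_le_one (by positivity)]; linarith [Real.pi_gt_three]
  rw [greenKernel, norm_mul, Real.norm_of_nonneg (by positivity : 0 ≤ 1 / (2 * π))]
  refine (mul_le_of_le_one_left (norm_nonneg _) hpi).trans ((Complex.abs_re_le_norm _).trans ?_)
  refine (norm_sub_le _ _).trans (add_le_add ((norm_sub_le _ _).trans (add_le_add
    ((norm_add_le _ _).trans (add_le_add ?_ ?_)) ?_)) ?_)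
  exacts [hmul _ _ hv, hmul _ _ hcv, hmul _ _ hcv, hmul _ _ hv]

lemma measurable_greenKernel (hL : 0 < L) (hH : 0 < H) (v y : ℂ) :
    Measurable (greenKernel L H v y) := by
  have := measurable_logDeriv (differentiable_theta hL hH)
  unfold greenKernel
  fun_prop

lemma dG_ae_eq (hAB : A < B) (hCD : C < D) {G : Plane → Plane → ℝ}
    (hG : IsDirichletGreen (rect A B C D) G) {y : Plane} (hy : y ∈ closure (rect A B C D))
    (v : Plane) : dG (rect A B C D) G v y =ᵐ[volume.restrict (rect A B C D)]
      fun x => greenKernel (B - A) (D - C) (planeIso v) (toC A C y) (toC A C x) := by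
  have h1 : ∀ᵐ x ∂(volume.restrict (rect A B C D)), x ≠ y := by
    have : ∀ᵐ x ∂(volume : Measure Plane), x ≠ y := by simp [ae_iff]
    exact ae_restrict_of_ae this
  filter_upwards [h1, ae_restrict_mem (measurableSet_rect A B C D)] with x hx hxm
  exact dG_eq_greenKernel hAB hCD hG hxm hy hx v

/-- The derivatives of the Green's function are in `L^s` for `s < 2`, uniformly in the pole. -/
lemma exists_eLpNorm_dG_le (hAB : A < B) (hCD : C < D) {G : Plane → Plane → ℝ}
    (hG : IsDirichletGreen (rect A B C D) G) {s : ℝ} (hs1 : 1 ≤ s) (hs2 : s < 2) :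
    ∃ M : ℝ, 0 ≤ M ∧ ∀ y ∈ closure (rect A B C D), ∀ v : Plane, ‖v‖ ≤ 1 →
      MemLp (dG (rect A B C D) G v y) (ENNReal.ofReal s) (volume.restrict (rect A B C D)) ∧
      (eLpNorm (dG (rect A B C D) G v y) (ENNReal.ofReal s)
        (volume.restrict (rect A B C D))).toReal ≤ M := by
  have hL : 0 < B - A := sub_pos.2 hAB
  have hH : 0 < D - C := sub_pos.2 hCD
  set q := ENNReal.ofReal s
  have hq : 1 ≤ q := by simpa [q] using hs1
  set ζ := logDeriv (theta (B - A) (D - C)) with hζ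
  have hmeas : Measurable ζ := measurable_logDeriv (differentiable_theta hL hH)
  obtain ⟨ρ, hρ⟩ : ∃ ρ, ∀ x ∈ closure (rect A B C D), ‖toC A C x‖ ≤ ρ :=
    ((isCompact_closure_rect A B C D).image continuous_toC).isBounded.exists_norm_le.imp
      fun ρ h x hx => h _ (mem_image_of_mem _ hx)
  set N := eLpNorm ζ q (volume.restrict (Metric.closedBall 0 (ρ + ρ))) with hN
  have hNfin : N < ⊤ := (memLp_logDeriv (differentiable_theta hL hH) (exists_theta_ne_zero hL hH)
    (by linarith) hs2 (isCompact_closedBall _ _)).2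
  -- each of the four terms is a translate of the same locally `L^s` function
  have hw : ∀ w : ℂ, ‖w‖ ≤ ρ →
      eLpNorm (fun x => ‖ζ (toC A C x + w)‖) q (volume.restrict (rect A B C D)) ≤ N := by
    intro w hw
    have hT := (measurePreserving_toC A C w).restrict_preimage
      (measurableSet_closedBall (x := (0 : ℂ)) (ε := ρ + ρ))
    rw [hN, ← eLpNorm_comp_measurePreserving hmeas.aestronglyMeasurable hT, eLpNorm_norm]
    refine eLpNorm_mono_measure _ (Measure.restrict_mono (fun x hx => ?_) le_rfl)
    rw [mem_preimage, mem_closedBall_zero_iff]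
    exact (norm_add_le _ _).trans (add_le_add (hρ x (subset_closure hx)) hw)
  have hmT : Measurable (toC A C) := continuous_toC.measurable
  have hm : ∀ w : ℂ, AEStronglyMeasurable (fun x => ‖ζ (toC A C x + w)‖)
      (volume.restrict (rect A B C D)) := fun w =>
    (hmeas.comp (hmT.add_const w)).norm.aestronglyMeasurable
  refine ⟨(N + N + N + N).toReal, ENNReal.toReal_nonneg, fun y hy v hv => ?_⟩
  have hye := hρ y hy
  have hcy : ‖conj (toC A C y)‖ ≤ ρ := by rwa [RCLike.norm_conj]
  have hae := dG_ae_eq hAB hCD hG hy v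
  have hle : eLpNorm (dG (rect A B C D) G v y) q (volume.restrict (rect A B C D)) ≤
      N + N + N + N := by
    rw [eLpNorm_congr_ae hae]
    have h1 := eLpNorm_add_le (((hm (-toC A C y)).add (hm (conj (toC A C y)))).add
      (hm (-conj (toC A C y)))) (hm (toC A C y)) hq
    have h2 := eLpNorm_add_le ((hm (-toC A C y)).add (hm (conj (toC A C y))))
      (hm (-conj (toC A C y))) hq
    have h3 := eLpNorm_add_le (hm (-toC A C y)) (hm (conj (toC A C y))) hq
    refine (eLpNorm_mono_real fun x => ?_).trans (h1.trans (add_le_add (h2.trans (add_le_add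
      (h3.trans (add_le_add (hw _ (by rwa [norm_neg])) (hw _ hcy))) (hw _ (by rwa [norm_neg]))))
      (hw _ hye)))
    have := norm_greenKernel_le (B - A) (D - C) (v := planeIso v)
      (by rwa [LinearIsometryEquiv.norm_map]) (toC A C x) (toC A C y)
    simpa only [Pi.add_apply, ← sub_eq_add_neg] using this
  have hfin : N + N + N + N < ⊤ := by simp [hNfin]
  refine ⟨⟨?_, hle.trans_lt hfin⟩, ENNReal.toReal_mono hfin.ne hle⟩
  exact (((measurable_greenKernel hL hH _ _).comp hmT).aestronglyMeasurable).congr hae.symm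

/-- The gradient field of the Green potential of `k` on the rectangle `rect A B C D`. -/
noncomputable def greenField (A B C D : ℝ) (k : Plane → ℝ) (y : Plane) : Plane :=
  WithLp.toLp 2 fun i => potentialDeriv (B - A) (D - C) (k ∘ ofC A C)
    (planeIso (EuclideanSpace.single i 1)) (toC A C y)

lemma contDiff_toC : ContDiff ℝ 1 (toC A C) := by
  unfold toC
  exact planeIso.contDiff.sub contDiff_const

lemma contDiff_ofC : ContDiff ℝ 1 (ofC A C) := by
  unfold ofC
  exact planeIso.symm.contDiff.add contDiff_const

lemma hasCompactSupport_comp_ofC {k : Plane → ℝ} (hkc : HasCompactSupport k) :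
    HasCompactSupport (k ∘ ofC A C) :=
  hkc.comp_homeomorph
    (⟨⟨ofC A C, toC A C, toC_ofC, ofC_toC⟩, continuous_ofC, continuous_toC⟩ : ℂ ≃ₜ Plane)

lemma contDiff_greenField (hAB : A < B) (hCD : C < D) {k : Plane → ℝ} (hk : ContDiff ℝ 1 k)
    (hkc : HasCompactSupport k) : ContDiff ℝ 1 (greenField A B C D k) := by
  refine contDiff_euclidean.2 fun i => ?_
  exact (contDiff_potentialDeriv (sub_pos.2 hAB) (sub_pos.2 hCD) (hk.comp contDiff_ofC)
    (hasCompactSupport_comp_ofC hkc) _).comp contDiff_toC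

lemma div_greenField (hAB : A < B) (hCD : C < D) {k : Plane → ℝ} (hk : ContDiff ℝ 1 k)
    (hkc : HasCompactSupport k) (hks : tsupport k ⊆ rect A B C D) {y : Plane}
    (hy : y ∈ rect A B C D) : div (greenField A B C D k) y = -k y := by
  have hL : 0 < B - A := sub_pos.2 hAB
  have hH : 0 < D - C := sub_pos.2 hCD
  have hg := hk.comp (contDiff_ofC (A := A) (C := C))
  have hgc := hasCompactSupport_comp_ofC (A := A) (C := C) hkc
  rw [div_eq_sum _ ((contDiff_greenField hAB hCD hk hkc).differentiable one_ne_zero y)]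
  have hd : ∀ i, fderiv ℝ (fun y => greenField A B C D k y i) y (EuclideanSpace.single i 1) =
      fderiv ℝ (potentialDeriv (B - A) (D - C) (k ∘ ofC A C)
        (planeIso (EuclideanSpace.single i 1))) (toC A C y)
        (planeIso (EuclideanSpace.single i 1)) := by
    intro i
    have hlin : HasFDerivAt (toC A C) (planeIso.toContinuousLinearEquiv : Plane →L[ℝ] ℂ) y := by
      have : HasFDerivAt (fun x => planeIso x)
        (planeIso.toContinuousLinearEquiv : Plane →L[ℝ] ℂ) y :=
        planeIso.toContinuousLinearEquiv.hasFDerivAt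
      exact this.sub_const _
    have h2 := ((contDiff_potentialDeriv hL hH hg hgc
      (planeIso (EuclideanSpace.single i 1))).differentiable one_ne_zero (toC A C y)).hasFDerivAt
    have h3 := (h2.comp y hlin).fderiv
    change fderiv ℝ (potentialDeriv (B - A) (D - C) (k ∘ ofC A C)
        (planeIso (EuclideanSpace.single i 1)) ∘ toC A C) y _ = _
    rw [h3]; rfl
  have e0 : planeIso (EuclideanSpace.single 0 1) = 1 := by
    apply Complex.ext <;> simp
  have e1 : planeIso (EuclideanSpace.single 1 1) = Complex.I := by
    apply Complex.ext <;> simp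
  rw [Fin.sum_univ_two, hd, hd, e0, e1]
  have hyb := mem_box_iff.2 hy
  rw [divergence_potentialDeriv hL hH hg hgc ?_ hyb.1 hyb.2, Function.comp_apply, ofC_toC]
  intro x hx
  have : x ∈ ofC A C ⁻¹' tsupport k := tsupport_comp_subset_preimage _ continuous_ofC hx
  have h := mem_box_iff.2 (hks this)
  rw [toC_ofC] at h
  exact h

/-- The Green field up to the boundary, in terms of the derivative of the Green's function. -/
lemma greenField_apply (hAB : A < B) (hCD : C < D) {G : Plane → Plane → ℝ}
    (hG : IsDirichletGreen (rect A B C D) G) {k : Plane → ℝ} (hks : tsupport k ⊆ rect A B C D)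
    {y : Plane} (hy : y ∈ closure (rect A B C D)) (i : Fin 2) :
    greenField A B C D k y i = ∫ x in rect A B C D,
      k x * dG (rect A B C D) G (EuclideanSpace.single i 1) y x := by
  have hme : MeasurableEmbedding (toC A C) := continuous_toC.measurableEmbedding toC_injective
  have hmp : MeasurePreserving (toC A C) volume volume := by
    simpa using measurePreserving_toC A C 0
  have h1 : ∀ᵐ x ∂(volume.restrict (rect A B C D)),
      k x * dG (rect A B C D) G (EuclideanSpace.single i 1) y x =
      greenKernel (B - A) (D - C) (planeIso (EuclideanSpace.single i 1)) (toC A C y)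
        (toC A C x) * (k ∘ ofC A C) (toC A C x) := by
    filter_upwards [dG_ae_eq hAB hCD hG hy (EuclideanSpace.single i 1)] with x hx
    rw [hx, Function.comp_apply, ofC_toC, mul_comm]
  rw [integral_congr_ae h1, setIntegral_eq_integral_of_forall_compl_eq_zero,
    hmp.integral_comp hme (fun z => greenKernel (B - A) (D - C)
      (planeIso (EuclideanSpace.single i 1)) (toC A C y) z * (k ∘ ofC A C) z)]
  · rfl
  · intro x hx
    rw [Function.comp_apply, ofC_toC, image_eq_zero_of_notMem_tsupport fun h => hx (hks h),
      mul_zero]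

end

/-! ### Duality in `L^s` -/

section

variable {α : Type*} [MeasurableSpace α] {μ : Measure α}

lemma integrable_mul_of_memLp {q q' : ℝ≥0∞} [q.HolderConjugate q'] {f g : α → ℝ}
    (hf : MemLp f q μ) (hg : MemLp g q' μ) : Integrable (fun x => f x * g x) μ :=
  hf.integrable_mul hg

/-- Hölder's inequality. -/
lemma abs_integral_mul_le {q q' : ℝ≥0∞} [q.HolderConjugate q'] {f g : α → ℝ}
    (hf : MemLp f q μ) (hg : MemLp g q' μ) :
    |∫ x, f x * g x ∂μ| ≤ (eLpNorm f q μ).toReal * (eLpNorm g q' μ).toReal := by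
  have h := eLpNorm_smul_le_mul_eLpNorm (p := q) (q := q') (r := 1) hg.1 hf.1
  rw [← ENNReal.toReal_mul, ← Real.norm_eq_abs, ← toReal_enorm]
  refine ENNReal.toReal_mono (ENNReal.mul_lt_top hf.2 hg.2).ne
    ((enorm_integral_le_lintegral_enorm _).trans ?_)
  simpa [eLpNorm_one_eq_lintegral_enorm, enorm_mul] using h

lemma exists_toReal_eLpNorm_le [IsFiniteMeasure μ] {p q : ℝ≥0∞} (hp : 1 ≤ p) (hpq : p ≤ q)
    (hq : q ≠ ⊤) : ∃ c : ℝ, 0 ≤ c ∧ ∀ f : α → ℝ, MemLp f q μ →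
      (eLpNorm f p μ).toReal ≤ c * (eLpNorm f q μ).toReal := by
  refine ⟨(μ univ ^ (1 / p.toReal - 1 / q.toReal)).toReal, ENNReal.toReal_nonneg, fun f hf => ?_⟩
  have h := eLpNorm_le_eLpNorm_mul_rpow_measure_univ hpq hf.1
  have h0 : 0 ≤ 1 / p.toReal - 1 / q.toReal := by
    have hp0 : 0 < p.toReal := ENNReal.toReal_pos (zero_lt_one.trans_le hp).ne'
      (ne_top_of_le_ne_top hq hpq)
    exact sub_nonneg.2 (one_div_le_one_div_of_le hp0 (ENNReal.toReal_mono hq hpq))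
  rw [mul_comm, ← ENNReal.toReal_mul]
  exact ENNReal.toReal_mono (ENNReal.mul_lt_top hf.2
    (ENNReal.rpow_lt_top_of_nonneg h0 (measure_ne_top _ _))).ne h

lemma memLp_of_abs_le [IsFiniteMeasure μ] {f : α → ℝ} (hf : Measurable f) {m : ℝ}
    (hm : ∀ x, |f x| ≤ m) (q : ℝ≥0∞) : MemLp f q μ :=
  MemLp.of_bound hf.aestronglyMeasurable m (Eventually.of_forall hm)

lemma toReal_eLpNorm_eq {s : ℝ} (hs : 0 < s) {f : α → ℝ} (hf : MemLp f (ENNReal.ofReal s) μ) :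
    (eLpNorm f (ENNReal.ofReal s) μ).toReal = (∫ x, |f x| ^ s ∂μ) ^ s⁻¹ := by
  rw [hf.eLpNorm_eq_integral_rpow_norm (by simpa using hs) ENNReal.ofReal_ne_top,
    ENNReal.toReal_ofReal hs.le, ENNReal.toReal_ofReal (by positivity)]
  rfl

/-- Bounded convergence for `L^s` norms. -/
lemma tendsto_toReal_eLpNorm [IsFiniteMeasure μ] {s : ℝ} (hs : 0 < s) {k : ℕ → α → ℝ}
    {ψ : α → ℝ} {m : ℝ} (hk : ∀ n, Measurable (k n)) (hkm : ∀ n x, |k n x| ≤ m)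
    (hψ : Measurable ψ) (hψm : ∀ x, |ψ x| ≤ m)
    (hlim : ∀ᵐ x ∂μ, Tendsto (fun n => k n x) atTop (𝓝 (ψ x))) :
    Tendsto (fun n => (eLpNorm (k n) (ENNReal.ofReal s) μ).toReal) atTop
      (𝓝 (eLpNorm ψ (ENNReal.ofReal s) μ).toReal) := by
  simp only [toReal_eLpNorm_eq hs (memLp_of_abs_le (hk _) (hkm _) _),
    toReal_eLpNorm_eq hs (memLp_of_abs_le hψ hψm _)]
  refine Tendsto.rpow_const ?_ (Or.inr (by positivity))
  refine tendsto_integral_of_dominated_convergence (fun _ => m ^ s)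
    (fun n => ((hk n).abs.pow_const s).aestronglyMeasurable) (integrable_const _) (fun n => ?_) ?_
  · refine Eventually.of_forall fun x => ?_
    rw [Real.norm_of_nonneg (by positivity)]
    exact Real.rpow_le_rpow (abs_nonneg _) (hkm n x) hs.le
  · filter_upwards [hlim] with x hx
    exact hx.abs.rpow_const (Or.inr hs.le)

/-- The converse of Hölder's inequality: a function that defines a functional bounded in the `L^t`
norm is in the dual space. -/
lemma memLp_of_forall_abs_integral_le [IsFiniteMeasure μ] {t t' : ℝ} (ht : t.HolderConjugate t')
    {h : α → ℝ} (hh : AEStronglyMeasurable h μ) {c : ℝ}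
    (H : ∀ ψ : α → ℝ, Measurable ψ → ∀ m, (∀ x, |ψ x| ≤ m) →
      |∫ x, h x * ψ x ∂μ| ≤ c * (eLpNorm ψ (ENNReal.ofReal t) μ).toReal) :
    MemLp h (ENNReal.ofReal t') μ := by
  wlog hm : Measurable h generalizing h
  · refine (memLp_congr_ae hh.ae_eq_mk).2 (this hh.stronglyMeasurable_mk.aestronglyMeasurable
      (fun ψ h1 m h2 => ?_) hh.stronglyMeasurable_mk.measurable)
    have e := integral_congr_ae (hh.ae_eq_mk.mul (ae_eq_refl ψ))
    simp only [Pi.mul_apply] at e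
    rw [← e]
    exact H ψ h1 m h2
  -- test with the extremal function of the truncation of `h`, and let the truncation tend to `h`
  have hS : ∀ N : ℕ, MeasurableSet {x | |h x| ≤ N} := fun N =>
    measurableSet_le hm.abs measurable_const
  set u : ℕ → α → ℝ := fun N => {x | |h x| ≤ N}.indicator h with hu
  have hum : ∀ N, Measurable (u N) := fun N => hm.indicator (hS N)
  have hub : ∀ N x, |u N x| ≤ N := by
    intro N x
    simp only [hu, indicator_apply, mem_ofPred_eq]
    split_ifs with hx
    · exact hx
    · simp
  have huh : ∀ N x, h x * u N x = |u N x| ^ 2 := by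
    intro N x
    simp only [hu, indicator_apply]
    split_ifs
    · rw [sq_abs, sq]
    · simp
  have htp : 0 < t' := ht.symm.pos
  have ht1 : 1 < t' := ht.symm.lt
  have hbound : ∀ N, (eLpNorm (u N) (ENNReal.ofReal t') μ).toReal ≤ max c 0 := by
    intro N
    set ψ : α → ℝ := fun x => u N x * |u N x| ^ (t' - 2) with hψ
    have hψabs : ∀ x, |ψ x| = |u N x| ^ (t' - 1) := by
      intro x
      rcases eq_or_ne (u N x) 0 with h0 | h0
      · simp [hψ, h0, Real.zero_rpow (by linarith : t' - 1 ≠ 0)]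
      · have : t' - 1 = 1 + (t' - 2) := by ring
        rw [hψ, abs_mul, abs_of_nonneg (by positivity : 0 ≤ |u N x| ^ (t' - 2)), this,
          Real.rpow_add (abs_pos.2 h0), Real.rpow_one]
    have hhψ : ∀ x, h x * ψ x = |u N x| ^ t' := by
      intro x
      rcases eq_or_ne (u N x) 0 with h0 | h0
      · simp [hψ, h0, Real.zero_rpow htp.ne']
      · have : t' = 2 + (t' - 2) := by ring
        rw [hψ, ← mul_assoc, huh]
        conv_rhs => rw [this, Real.rpow_add (abs_pos.2 h0), Real.rpow_two]
    have hψm : Measurable ψ := (hum N).mul ((hum N).abs.pow_const _)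
    have hψb : ∀ x, |ψ x| ≤ (N : ℝ) ^ (t' - 1) := fun x => by
      rw [hψabs]; exact Real.rpow_le_rpow (abs_nonneg _) (hub N x) (by linarith)
    have key := H ψ hψm _ hψb
    have hψt : ∀ x, |ψ x| ^ t = |u N x| ^ t' := fun x => by
      rw [hψabs, ← Real.rpow_mul (abs_nonneg _), ht.symm.sub_one_mul_conj]
    rw [toReal_eLpNorm_eq ht.pos (memLp_of_abs_le hψm hψb _)] at key
    simp only [hhψ, hψt] at key
    rw [toReal_eLpNorm_eq htp (memLp_of_abs_le (hum N) (hub N) _)]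
    set I := ∫ x, |u N x| ^ t' ∂μ with hI
    have hI0 : 0 ≤ I := integral_nonneg fun x => by positivity
    rcases hI0.eq_or_lt with h0 | hpos
    · rw [← h0, Real.zero_rpow (by positivity)]; exact le_max_right _ _
    · rw [abs_of_pos hpos] at key
      have e : I = I ^ t'⁻¹ * I ^ t⁻¹ := by
        rw [← Real.rpow_add hpos, add_comm, ht.inv_add_inv_eq_one, Real.rpow_one]
      have hpos' : 0 < I ^ t⁻¹ := by positivity
      have : I ^ t'⁻¹ * I ^ t⁻¹ ≤ c * I ^ t⁻¹ := by rwa [← e]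
      exact (le_of_mul_le_mul_right this hpos').trans (le_max_left _ _)
  refine ⟨hh, ?_⟩
  have hlim := Lp.eLpNorm_lim_le_liminf_eLpNorm (p := ENNReal.ofReal t') (μ := μ) (f := u)
    (fun N => (hum N).aestronglyMeasurable) h (Eventually.of_forall fun x => by
      obtain ⟨N₀, hN₀⟩ := exists_nat_ge |h x|
      refine tendsto_const_nhds.congr' ?_
      filter_upwards [eventually_ge_atTop N₀] with N hN
      have hx : x ∈ {x | |h x| ≤ N} := hN₀.trans (Nat.cast_le.2 hN)
      exact (indicator_of_mem hx h).symm)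
  refine hlim.trans_lt (lt_of_le_of_lt ?_ (ENNReal.ofReal_lt_top (r := max c 0)))
  refine liminf_le_of_le (h := fun b hb => ?_)
  obtain ⟨N, hN⟩ := hb.exists
  refine hN.trans ?_
  rw [← ENNReal.ofReal_toReal (memLp_of_abs_le (hum N) (hub N) (ENNReal.ofReal t')).2.ne]
  exact ENNReal.ofReal_le_ofReal (hbound N)

/-- The Riesz representation of a bounded functional on `L^p` for `p ≤ s ≤ 2`, on the subspace
`L^s`. -/
lemma exists_memLp_representation [IsFiniteMeasure μ] {p : ℝ≥0∞} [Fact (1 ≤ p)] {s s' : ℝ}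
    (hss : s.HolderConjugate s') (hs2 : s ≤ 2) (hps : p ≤ ENNReal.ofReal s)
    (Λ : Lp ℝ p μ →L[ℝ] ℝ) :
    ∃ g : α → ℝ, MemLp g (ENNReal.ofReal s') μ ∧
      ∀ h (hh : MemLp h (ENNReal.ofReal s) μ),
        Λ ((hh.mono_exponent hps).toLp h) = ∫ x, g x * h x ∂μ := by
  have hp1 : 1 ≤ p := Fact.out
  have hsq : ENNReal.ofReal s ≤ 2 := by
    rw [← ENNReal.ofReal_ofNat]; exact ENNReal.ofReal_le_ofReal hs2
  have hp2 : p ≤ 2 := hps.trans hsq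
  have : (ENNReal.ofReal s').HolderConjugate (ENNReal.ofReal s) := hss.symm.ennrealOfReal
  have hΛ : ∀ h (hh : MemLp h p μ), |Λ (hh.toLp h)| ≤ ‖Λ‖ * (eLpNorm h p μ).toReal := by
    intro h hh
    rw [← Lp.norm_toLp h hh]
    exact Λ.le_opNorm _
  obtain ⟨c₂, hc₂0, hc₂⟩ := exists_toReal_eLpNorm_le (μ := μ) hp1 hp2 (by simp)
  obtain ⟨c, hc0, hc⟩ := exists_toReal_eLpNorm_le (μ := μ) hp1 hps ENNReal.ofReal_ne_top
  -- the restriction of the functional to `L²`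
  let T : Lp ℝ 2 μ →L[ℝ] ℝ := LinearMap.mkContinuous
    { toFun := fun h => Λ (((Lp.memLp h).mono_exponent hp2).toLp h)
      map_add' := fun f g => by
        rw [← map_add, ← MemLp.toLp_add]
        exact congrArg Λ (MemLp.toLp_congr _ _ (Lp.coeFn_add f g))
      map_smul' := fun r f => by
        rw [RingHom.id_apply, ← map_smul, ← MemLp.toLp_const_smul]
        exact congrArg Λ (MemLp.toLp_congr _ _ (Lp.coeFn_smul r f)) }
    (‖Λ‖ * c₂) (fun h => by
      refine (hΛ _ _).trans ?_
      rw [mul_assoc, Lp.norm_def]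
      exact mul_le_mul_of_nonneg_left (hc₂ _ (Lp.memLp h)) (norm_nonneg _))
  set g : Lp ℝ 2 μ := (InnerProductSpace.toDual ℝ (Lp ℝ 2 μ)).symm T with hg
  have hgT : ∀ h (hh : MemLp h 2 μ),
      Λ ((hh.mono_exponent hp2).toLp h) = ∫ x, g x * h x ∂μ := by
    intro h hh
    have h1 : inner ℝ g (hh.toLp h) = T (hh.toLp h) := InnerProductSpace.toDual_symm_apply
    have h2 : T (hh.toLp h) = Λ ((hh.mono_exponent hp2).toLp h) :=
      congrArg Λ (MemLp.toLp_congr _ _ hh.coeFn_toLp)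
    rw [← h2, ← h1, L2.inner_def]
    refine integral_congr_ae ?_
    filter_upwards [hh.coeFn_toLp] with x hx
    rw [hx]
    simp [mul_comm]
  -- boundedness in the `L^s` norm improves the integrability of `g`
  have hgm : MemLp g (ENNReal.ofReal s') μ := by
    refine memLp_of_forall_abs_integral_le hss (c := ‖Λ‖ * c) (Lp.aestronglyMeasurable g)
      fun ψ hψ m hm => ?_
    rw [← hgT ψ (memLp_of_abs_le hψ hm 2), mul_assoc]
    exact (hΛ _ _).trans (mul_le_mul_of_nonneg_left (hc _ (memLp_of_abs_le hψ hm _))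
      (norm_nonneg _))
  refine ⟨g, hgm, fun h hh => ?_⟩
  -- both sides are continuous in `L^s` and agree on simple functions
  set Q := ‖Λ‖ * c + (eLpNorm g (ENNReal.ofReal s') μ).toReal with hQ
  have hQ0 : 0 ≤ Q := by positivity
  rw [← sub_eq_zero, ← abs_nonpos_iff]
  refine le_of_forall_pos_le_add fun δ hδ => ?_
  obtain ⟨σ, hσ, hσm⟩ := hh.exists_simpleFunc_eLpNorm_sub_lt ENNReal.ofReal_ne_top
    (ε := ENNReal.ofReal (δ / (Q + 1))) (by simp; positivity)
  have hd : MemLp (h - ⇑σ) (ENNReal.ofReal s) μ := hh.sub hσm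
  have hdl : (eLpNorm (h - ⇑σ) (ENNReal.ofReal s) μ).toReal ≤ δ / (Q + 1) :=
    ENNReal.toReal_le_of_le_ofReal (by positivity) hσ.le
  have hσ2 : MemLp σ 2 μ := by
    obtain ⟨m, hm⟩ := σ.exists_forall_norm_le
    exact memLp_of_abs_le σ.measurable hm 2
  have e1 : Λ ((hh.mono_exponent hps).toLp h) =
      Λ ((hd.mono_exponent hps).toLp (h - ⇑σ)) + ∫ x, g x * σ x ∂μ := by
    rw [← hgT σ hσ2, ← map_add, ← MemLp.toLp_add]
    exact congrArg Λ (MemLp.toLp_congr _ _ (by simp))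
  have e2 : ∫ x, g x * h x ∂μ = ∫ x, g x * (h - ⇑σ) x ∂μ + ∫ x, g x * σ x ∂μ := by
    rw [← integral_add (integrable_mul_of_memLp hgm hd) (integrable_mul_of_memLp hgm hσm)]
    exact integral_congr_ae (Eventually.of_forall fun x => by simp; ring)
  rw [e1, e2, add_sub_add_right_eq_sub, zero_add]
  calc _ ≤ |Λ ((hd.mono_exponent hps).toLp (h - ⇑σ))| + |∫ x, g x * (h - ⇑σ) x ∂μ| := abs_sub _ _
    _ ≤ ‖Λ‖ * (c * (δ / (Q + 1))) +
        (eLpNorm g (ENNReal.ofReal s') μ).toReal * (δ / (Q + 1)) := by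
      refine add_le_add ((hΛ _ _).trans (mul_le_mul_of_nonneg_left ((hc _ hd).trans
        (mul_le_mul_of_nonneg_left hdl hc0)) (norm_nonneg _))) ((abs_integral_mul_le hgm hd).trans
        (mul_le_mul_of_nonneg_left hdl ENNReal.toReal_nonneg))
    _ = Q / (Q + 1) * δ := by rw [hQ]; field_simp
    _ ≤ δ := mul_le_of_le_one_left hδ.le (by rw [div_le_one (by positivity)]; linarith)

end

/-! ### Approximation by compactly supported densities, and integrability of `BV` functions -/

section

variable {A B C D : ℝ}

/-- Bounded measurable functions are limits of bounded `C¹` functions with compact support. -/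
lemma exists_contDiff_tendsto_ae {ψ : Plane → ℝ} (hψ : Measurable ψ) {m : ℝ}
    (hm : ∀ x, |ψ x| ≤ m) :
    ∃ k : ℕ → Plane → ℝ, (∀ n, ContDiff ℝ 1 (k n)) ∧ (∀ n, HasCompactSupport (k n)) ∧
      (∀ n, tsupport (k n) ⊆ rect A B C D) ∧ (∀ n x, |k n x| ≤ m) ∧
      ∀ᵐ x ∂(volume.restrict (rect A B C D)), Tendsto (fun n => k n x) atTop (𝓝 (ψ x)) := by
  have hloc : LocallyIntegrable ψ (volume : Measure Plane) := by
    refine LocallyIntegrable.mono (g := ψ) (f := fun _ => m) ?_ hψ.aestronglyMeasurable ?_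
    · exact continuous_const.locallyIntegrable
    · exact Eventually.of_forall fun x => (hm x).trans (le_abs_self m)
  -- mollify, then cut off near the boundary
  let φ : ℕ → ContDiffBump (0 : Plane) := fun n =>
    ⟨1 / (n + 1), 2 / (n + 1), by positivity, by gcongr; norm_num⟩
  set κ : ℕ → Plane → ℝ := fun n =>
    convolution ((φ n).normed volume) ψ (ContinuousLinearMap.lsmul ℝ ℝ) volume with hκ
  have hκd : ∀ n, ContDiff ℝ 1 (κ n) := fun n =>
    (φ n).hasCompactSupport_normed.contDiff_convolution_left _ (φ n).contDiff_normed hloc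
  have hκm : ∀ n x, |κ n x| ≤ m := by
    intro n x
    have := dist_convolution_le (μ := volume) (g := ψ) (x₀ := x) (z₀ := 0)
      ((abs_nonneg _).trans (hm x)) (φ n).support_normed_eq.subset (φ n).nonneg_normed
      (φ n).integral_normed hψ.aestronglyMeasurable fun y _ => by simpa using hm y
    simpa using this
  have hκlim : ∀ᵐ x ∂(volume : Measure Plane), Tendsto (fun n => κ n x) atTop (𝓝 (ψ x)) := by
    refine ContDiffBump.ae_convolution_tendsto_right_of_locallyIntegrable (φ := φ) (K := 2) ?_ ?_
      hloc
    · have := (tendsto_one_div_add_atTop_nhds_zero_nat (𝕜 := ℝ)).const_mul 2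
      simpa [φ, div_eq_mul_inv] using this
    · exact Eventually.of_forall fun n => by simp [φ, div_eq_mul_inv]
  have hsub : ∀ n, tsupport (fun x => rectCutoff A B C D (n + 1) x * κ n x) ⊆ rect A B C D :=
    fun n => (closure_mono fun x hx => left_ne_zero_of_mul hx).trans
      (tsupport_rectCutoff_subset n.succ_pos)
  refine ⟨fun n x => rectCutoff A B C D (n + 1) x * κ n x,
    fun n => (contDiff_rectCutoff _ _ _ _ _).mul (hκd n), fun n => ?_, hsub, fun n x => ?_, ?_⟩
  · exact (isCompact_closure_rect A B C D).of_isClosed_subset (isClosed_tsupport _)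
      ((hsub n).trans subset_closure)
  · rw [abs_mul, abs_of_nonneg (rectCutoff_nonneg _ _ _ _ _ _)]
    exact (mul_le_of_le_one_left (abs_nonneg _) (rectCutoff_le_one _ _ _ _ _ _)).trans (hκm n x)
  · filter_upwards [ae_restrict_of_ae hκlim, ae_restrict_mem (measurableSet_rect A B C D)]
      with x hx hxm
    refine hx.congr' ?_
    have := (tendsto_add_atTop_nat 1).eventually (eventually_rectCutoff_eventuallyEq_one hxm)
    filter_upwards [this] with n hn
    rw [hn.self_of_nhds, one_mul]

lemma memLp_of_contDiff {k : Plane → ℝ} (hk : ContDiff ℝ 1 k) (hkc : HasCompactSupport k)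
    (q : ℝ≥0∞) : MemLp k q (volume.restrict (rect A B C D)) := by
  obtain ⟨m, hm⟩ := hkc.exists_bound_of_continuous hk.continuous
  exact memLp_of_abs_le hk.continuous.measurable hm q

/-- A functional on `L^p` is, up to a small error, given by a `C¹` density with compact support. -/
lemma exists_contDiff_approx {p : ℝ≥0∞} [Fact (1 ≤ p)] {s s' : ℝ}
    (hss : s.HolderConjugate s') (hs2 : s ≤ 2) (hps : p ≤ ENNReal.ofReal s)
    (Λ : Lp ℝ p (volume.restrict (rect A B C D)) →L[ℝ] ℝ) {ε : ℝ} (hε : 0 < ε) :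
    ∃ k : Plane → ℝ, ContDiff ℝ 1 k ∧ HasCompactSupport k ∧ tsupport k ⊆ rect A B C D ∧
      ∀ h (hh : MemLp h (ENNReal.ofReal s) (volume.restrict (rect A B C D))),
        |Λ ((hh.mono_exponent hps).toLp h) - ∫ x in rect A B C D, k x * h x| ≤
          ε * (eLpNorm h (ENNReal.ofReal s) (volume.restrict (rect A B C D))).toReal := by
  let μ := volume.restrict (rect A B C D)
  have hc : (ENNReal.ofReal s').HolderConjugate (ENNReal.ofReal s) := hss.symm.ennrealOfReal
  have hs'1 : 1 ≤ ENNReal.ofReal s' := by simpa using hss.symm.lt.le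
  obtain ⟨g, hg, hgΛ⟩ := exists_memLp_representation hss hs2 hps Λ
  obtain ⟨σ, hσ, hσm⟩ := hg.exists_simpleFunc_eLpNorm_sub_lt ENNReal.ofReal_ne_top
    (ε := ENNReal.ofReal (ε / 2)) (by simpa using hε)
  obtain ⟨m, hm⟩ := σ.exists_forall_norm_le
  obtain ⟨k, hk1, hk2, hk3, hk4, hk5⟩ := exists_contDiff_tendsto_ae (A := A) (B := B) (C := C)
    (D := D) σ.measurable hm
  have hlim := tendsto_toReal_eLpNorm (μ := μ) hss.symm.pos (k := fun n => ⇑σ - k n) (ψ := 0)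
    (m := m + m) (fun n => σ.measurable.sub (hk1 n).continuous.measurable)
    (fun n x => (abs_sub _ _).trans (add_le_add (hm x) (hk4 n x))) measurable_const
    (fun x => by
      have := (norm_nonneg _).trans (hm x)
      simpa using this)
    (by filter_upwards [hk5] with x hx; simpa using (tendsto_const_nhds (x := σ x)).sub hx)
  rw [eLpNorm_zero, ENNReal.toReal_zero] at hlim
  obtain ⟨n, hn⟩ := (hlim.eventually (Iio_mem_nhds (half_pos hε))).exists
  have hkn := memLp_of_contDiff (A := A) (B := B) (C := C) (D := D) (hk1 n) (hk2 n)
    (ENNReal.ofReal s')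
  refine ⟨k n, hk1 n, hk2 n, hk3 n, fun h hh => ?_⟩
  have hgk : (eLpNorm (g - k n) (ENNReal.ofReal s') μ).toReal ≤ ε := by
    have e : g - k n = (g - ⇑σ) + (⇑σ - k n) := by simp
    have h1 := eLpNorm_add_le (hg.sub hσm).1 (hσm.sub hkn).1 hs'1
    rw [e]
    refine (ENNReal.toReal_mono (ENNReal.add_lt_top.2 ⟨(hg.sub hσm).2, (hσm.sub hkn).2⟩).ne
      h1).trans ?_
    rw [ENNReal.toReal_add (hg.sub hσm).2.ne (hσm.sub hkn).2.ne]
    have := ENNReal.toReal_le_of_le_ofReal (half_pos hε).le hσ.le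
    have hn' : (eLpNorm (⇑σ - k n) (ENNReal.ofReal s') μ).toReal < ε / 2 := hn
    linarith
  rw [hgΛ h hh, ← integral_sub (integrable_mul_of_memLp hg hh) (integrable_mul_of_memLp hkn hh)]
  have e : ∀ x, g x * h x - k n x * h x = (g - k n) x * h x := fun x => by
    simp only [Pi.sub_apply]; ring
  simp only [e]
  exact (abs_integral_mul_le (hg.sub hkn) hh).trans
    (mul_le_mul_of_nonneg_right hgk ENNReal.toReal_nonneg)

lemma norm_single_one (i : Fin 2) : ‖(EuclideanSpace.single i 1 : Plane)‖ ≤ 1 := by simp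

/-- The Sobolev inequality for `BV`, in the weak form needed here. It follows by duality from the
fact that a density in `L^{s'}` is the divergence of a bounded field. -/
lemma IsBV.memLp (hAB : A < B) (hCD : C < D) {G : Plane → Plane → ℝ}
    (hG : IsDirichletGreen (rect A B C D) G) {f : Plane → ℝ} (hf : IsBV (rect A B C D) f)
    {s s' : ℝ} (hss : s.HolderConjugate s') (hs2 : s < 2) :
    MemLp f (ENNReal.ofReal s) (volume.restrict (rect A B C D)) := by
  have hc : (ENNReal.ofReal s').HolderConjugate (ENNReal.ofReal s) := hss.symm.ennrealOfReal
  obtain ⟨c, hc0, hcf⟩ := hf.exists_abs_integral_div_le hAB hCD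
  obtain ⟨M, hM0, hM⟩ := exists_eLpNorm_dG_le hAB hCD hG hss.lt.le hs2
  set μ := volume.restrict (rect A B C D)
  -- for a smooth density `k`, the integral of `f k` is that of `-f div Φ` with the Green field `Φ`
  have key : ∀ k, ContDiff ℝ 1 k → HasCompactSupport k → tsupport k ⊆ rect A B C D →
      |∫ x in rect A B C D, f x * k x| ≤
        c * M * (eLpNorm k (ENNReal.ofReal s') μ).toReal := by
    intro k hk hkc hks
    have hkm := memLp_of_contDiff (A := A) (B := B) (C := C) (D := D) hk hkc (ENNReal.ofReal s')
    have h1 : ∫ x in rect A B C D, f x * k x =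
        -∫ x in rect A B C D, f x * div (greenField A B C D k) x := by
      rw [← integral_neg]
      refine setIntegral_congr_fun (measurableSet_rect A B C D) fun x hx => ?_
      simp only [div_greenField hAB hCD hk hkc hks hx]
      ring
    have hb : ∀ δ > 0, |∫ x in rect A B C D, f x * k x| ≤
        c * ((eLpNorm k (ENNReal.ofReal s') μ).toReal * M + δ) := by
      intro δ hδ
      rw [h1, abs_neg]
      refine hcf _ (contDiff_greenField hAB hCD hk hkc) _ (by positivity) fun y hy i => ?_
      rw [greenField_apply hAB hCD hG hks hy]
      obtain ⟨h2, h3⟩ := hM y hy _ (norm_single_one i)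
      have h4 := (abs_integral_mul_le hkm h2).trans
        (mul_le_mul_of_nonneg_left h3 ENNReal.toReal_nonneg)
      linarith
    refine le_of_forall_pos_le_add fun δ hδ => (hb (δ / (c + 1)) (by positivity)).trans ?_
    have : c * (δ / (c + 1)) ≤ δ := by
      rw [mul_div_assoc', div_le_iff₀ (by positivity)]; nlinarith
    linarith
  refine memLp_of_forall_abs_integral_le (c := c * M) hss.symm hf.1.aestronglyMeasurable
    fun ψ hψ m hm => ?_
  obtain ⟨k, hk1, hk2, hk3, hk4, hk5⟩ := exists_contDiff_tendsto_ae (A := A) (B := B) (C := C)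
    (D := D) hψ hm
  have hl := (tendsto_toReal_eLpNorm (μ := μ) hss.symm.pos
    (fun n => (hk1 n).continuous.measurable) hk4 hψ hm hk5).const_mul (c * M)
  have hint : Tendsto (fun n => ∫ x in rect A B C D, f x * k n x) atTop
      (𝓝 (∫ x in rect A B C D, f x * ψ x)) := by
    refine tendsto_integral_of_dominated_convergence (fun x => |f x| * m)
      (fun n => hf.1.aestronglyMeasurable.mul (hk1 n).continuous.aestronglyMeasurable)
      (hf.1.abs.mul_const m) (fun n => Eventually.of_forall fun x => ?_) ?_
    · rw [norm_mul]
      exact mul_le_mul_of_nonneg_left (hk4 n x) (norm_nonneg _)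
    · filter_upwards [hk5] with x hx using hx.const_mul _
  exact le_of_tendsto_of_tendsto' hint.abs hl fun n => key _ (hk1 n) (hk2 n) (hk3 n)

end

/-! ### Optimality from a dual certificate -/

lemma exists_exponent {p : ℝ≥0∞} (hp1 : 1 ≤ p) (hp : p < 2) :
    ∃ s : ℝ, 1 < s ∧ s < 2 ∧ p ≤ ENNReal.ofReal s := by
  have hpt : p ≠ ⊤ := (hp.trans (by simp)).ne
  have h1 : p.toReal < 2 := by
    simpa using (ENNReal.toReal_lt_toReal hpt (by simp)).2 hp
  have h2 : 1 ≤ p.toReal := by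
    simpa using ENNReal.toReal_mono hpt hp1
  refine ⟨(p.toReal + 2) / 2, by linarith, by linarith, ?_⟩
  rw [← ENNReal.ofReal_toReal hpt]
  exact ENNReal.ofReal_le_ofReal (by rw [ENNReal.toReal_ofReal (by linarith)]; linarith)

lemma memLp_dG {p : ℝ≥0∞} [Fact (1 ≤ p)] (hp : p < 2) {A B C D : ℝ} (hAB : A < B) (hCD : C < D)
    {G : Plane → Plane → ℝ} (hG : IsDirichletGreen (rect A B C D) G) {y : Plane}
    (hy : y ∈ closure (rect A B C D)) {v : Plane} (hv : ‖v‖ ≤ 1) :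
    MemLp (dG (rect A B C D) G v y) p (volume.restrict (rect A B C D)) := by
  obtain ⟨s, hs1, hs2, hps⟩ := exists_exponent (Fact.out : 1 ≤ p) hp
  obtain ⟨M, -, hM⟩ := exists_eLpNorm_dG_le hAB hCD hG hs1.le hs2
  exact (hM y hy v hv).1.mono_exponent hps

lemma integrableOn_mul_div {A B C D : ℝ} {f : Plane → ℝ} (hf : IntegrableOn f (rect A B C D))
    {φ : Plane → Plane} (hφ : ContDiff ℝ 1 φ) :
    IntegrableOn (fun x => f x * div φ x) (rect A B C D) := by
  have hc : Continuous (div φ) := by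
    have := hφ.continuous_fderiv one_ne_zero
    unfold div
    fun_prop
  obtain ⟨m, hm⟩ := (isCompact_closure_rect A B C D).exists_bound_of_continuousOn hc.continuousOn
  refine Integrable.mul_bdd (c := m) hf hc.aestronglyMeasurable ?_
  filter_upwards [ae_restrict_mem (measurableSet_rect A B C D)] with x hx
  exact hm x (subset_closure hx)

section

variable {E : Type*} [MeasurableSpace E] {ν : Measure E} {p : ℝ≥0∞} [Fact (1 ≤ p)]

lemma app_eq {Ω : Set Plane} (K : Lp ℝ p (volume.restrict Ω) →L[ℝ] Lp ℝ 1 ν) {g : Plane → ℝ}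
    (hg : MemLp g p (volume.restrict Ω)) : app K g = K (hg.toLp g) := dif_pos hg

lemma app_const_smul {Ω : Set Plane} (K : Lp ℝ p (volume.restrict Ω) →L[ℝ] Lp ℝ 1 ν)
    {g : Plane → ℝ} (hg : MemLp g p (volume.restrict Ω)) (r : ℝ) :
    app K (r • g) = r • app K g := by
  rw [app_eq K hg, app_eq K (hg.const_smul r), MemLp.toLp_const_smul, map_smul]

lemma dG_smul (Ω : Set Plane) (G : Plane → Plane → ℝ) (r : ℝ) (v y : Plane) :
    dG Ω G (r • v) y = r • dG Ω G v y := by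
  funext x
  simp [dG]

variable {A B C D a b c d : ℝ}

lemma side_subset_closure (hab : a < b) (hcd : c < d) (j : Fin 4) :
    side a b c d j ⊆ closure (rect a b c d) := by
  rw [closure_rect hab hcd]
  intro y hy
  fin_cases j <;> obtain ⟨h1, h2⟩ := hy
  · exact ⟨by rw [h1]; exact left_mem_Icc.2 hab.le, Ioo_subset_Icc_self h2⟩
  · exact ⟨Ioo_subset_Icc_self h1, by rw [h2]; exact left_mem_Icc.2 hcd.le⟩
  · exact ⟨by rw [h1]; exact right_mem_Icc.2 hab.le, Ioo_subset_Icc_self h2⟩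
  · exact ⟨Ioo_subset_Icc_self h1, by rw [h2]; exact right_mem_Icc.2 hcd.le⟩

/-- Among the fields with components bounded by the weights, a field that attains the weight in the
direction of the normal has the largest normal component. -/
lemma sum_normal_mul_le {j : Fin 4} {u v : Plane} {w : Fin 2 → ℝ} (hu : ∀ i, |u i| ≤ w i)
    (hv : ∀ i, normal j i ≠ 0 → w i ≤ normal j i * v i) :
    ∑ i, normal j i * u i ≤ ∑ i, normal j i * v i := by
  refine Finset.sum_le_sum fun i _ => ?_
  by_cases h : normal j i = 0
  · simp [h]
  · have h1 : |normal j i| ≤ 1 := by fin_cases j <;> fin_cases i <;> simp [normal]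
    calc normal j i * u i ≤ |normal j i| * |u i| := (le_abs_self _).trans (abs_mul _ _).le
      _ ≤ |u i| := mul_le_of_le_one_left (abs_nonneg _) h1
      _ ≤ _ := (hu i).trans (hv i h)

/-- The optimality criterion. If a functional `ℓ` on the data space is such that the components of
`y ↦ ℓ (K ∇_y G(·; y))` are bounded by the weights, and attain them on the sides of the rectangle in
the direction of the outer normal, then the indicator function of the rectangle has the smallest
extended total variation among the functions with the same data. -/
lemma extTV_indicator_le_of_certificate (hp : p < 2) (hab : a < b) (hcd : c < d)
    (hR : rect a b c d ⊆ rect A B C D) {G : Plane → Plane → ℝ}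
    (hG : IsDirichletGreen (rect A B C D) G)
    (K : Lp ℝ p (volume.restrict (rect A B C D)) →L[ℝ] Lp ℝ 1 ν) (ℓ : Lp ℝ 1 ν →L[ℝ] ℝ)
    {w : Fin 2 → Plane → ℝ}
    (hw : ∀ y ∈ closure (rect A B C D), ∀ i,
      |ℓ (app K (dG (rect A B C D) G (EuclideanSpace.single i 1) y))| ≤ w i y)
    (hside : ∀ j, ∀ y ∈ side a b c d j, ∀ i, normal j i ≠ 0 →
      w i y ≤ normal j i * ℓ (app K (dG (rect A B C D) G (EuclideanSpace.single i 1) y)))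
    {f : Plane → ℝ} (hf : IsBV (rect A B C D) f)
    (hKf : app K f = app K ((rect a b c d).indicator fun _ => (1 : ℝ))) :
    extTV (rect A B C D) w ((rect a b c d).indicator fun _ => (1 : ℝ)) ≤
      extTV (rect A B C D) w f := by
  obtain ⟨hAB, hCD⟩ := lt_and_lt_of_rect_subset hab hcd hR
  obtain ⟨s, hs1, hs2, hps⟩ := exists_exponent (Fact.out : 1 ≤ p) hp
  have hss : s.HolderConjugate (s.conjExponent) := .conjExponent hs1
  set χ : Plane → ℝ := (rect a b c d).indicator fun _ => (1 : ℝ) with hχ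
  have hχBV : IsBV (rect A B C D) χ := isBV_indicator_rect hab hcd hR
  have hfs := hf.memLp hAB hCD hG hss hs2
  have hχs := hχBV.memLp hAB hCD hG hss hs2
  obtain ⟨M, hM0, hM⟩ := exists_eLpNorm_dG_le hAB hCD hG hs1.le hs2
  obtain ⟨cf, hcf0, hcf⟩ := hf.exists_abs_integral_div_le hAB hCD
  set nf := (eLpNorm f (ENNReal.ofReal s) (volume.restrict (rect A B C D))).toReal
  set nχ := (eLpNorm χ (ENNReal.ofReal s) (volume.restrict (rect A B C D))).toReal
  have hnf : 0 ≤ nf := ENNReal.toReal_nonneg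
  have hnχ : 0 ≤ nχ := ENNReal.toReal_nonneg
  refine iSup₂_le fun φ hφ => EReal.ge_of_forall_gt_iff_ge.1 fun z hz => ?_
  obtain ⟨hφ1, hφ2⟩ := hφ
  rw [EReal.coe_lt_coe_iff, integral_indicator_mul_div_eq_flux hab hcd hR hφ1] at hz
  set P := 2 * (b - a) + 2 * (d - c) with hP
  have hP0 : 0 ≤ P := by rw [hP]; linarith
  set Q := (M + 1) * (2 * cf + P) + nf + nχ with hQ
  have hQ0 : 0 ≤ Q := by positivity
  obtain ⟨ε, hε0, hε⟩ : ∃ ε > 0, ε * Q ≤ flux a b c d φ - z := by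
    refine ⟨(flux a b c d φ - z) / (Q + 1), div_pos (by linarith) (by linarith), ?_⟩
    rw [div_mul_eq_mul_div, div_le_iff₀ (by linarith)]
    nlinarith
  obtain ⟨k, hk, hkc, hks, hkε⟩ := exists_contDiff_approx hss hs2.le hps (ℓ.comp K) hε0
  have happ : ∀ h, MemLp h (ENNReal.ofReal s) (volume.restrict (rect A B C D)) →
      |ℓ (app K h) - ∫ x in rect A B C D, k x * h x| ≤
        ε * (eLpNorm h (ENNReal.ofReal s) (volume.restrict (rect A B C D))).toReal := by
    intro h hh
    rw [app_eq K (hh.mono_exponent hps)]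
    exact hkε h hh
  set Φ := greenField A B C D k with hΦ
  have hΦd : ContDiff ℝ 1 Φ := contDiff_greenField hAB hCD hk hkc
  set δ := ε * (M + 1) with hδ
  have hδ0 : 0 < δ := by positivity
  -- the field defined by the functional is uniformly close to the smooth field `Φ`
  have hΦδ : ∀ y ∈ closure (rect A B C D), ∀ i,
      |Φ y i - ℓ (app K (dG (rect A B C D) G (EuclideanSpace.single i 1) y))| ≤ δ := by
    intro y hy i
    obtain ⟨h1, h2⟩ := hM y hy _ (norm_single_one i)
    rw [abs_sub_comm, hΦ, greenField_apply hAB hCD hG hks hy]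
    refine (happ _ h1).trans ?_
    rw [hδ]
    exact mul_le_mul_of_nonneg_left (h2.trans (by linarith)) hε0.le
  have hdivΦ : ∀ g : Plane → ℝ, ∫ x in rect A B C D, g x * div Φ x =
      -∫ x in rect A B C D, k x * g x := by
    intro g
    rw [← integral_neg]
    refine setIntegral_congr_fun (measurableSet_rect A B C D) fun x hx => ?_
    simp only [hΦ, div_greenField hAB hCD hk hkc hks hx]
    ring
  -- upper bound for the indicator function
  have hupper : flux a b c d φ ≤ -ℓ (app K χ) + ε * nχ + δ * P := by
    have h1 : flux a b c d φ ≤ flux a b c d Φ + δ * P := by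
      refine flux_le_flux_add hab hcd (hφ1.continuousOn.mono (closure_mono hR))
        hΦd.continuous.continuousOn fun j y hy => ?_
      have hyΩ := closure_mono hR (side_subset_closure hab hcd j hy)
      have h2 := sum_normal_mul_le (j := j) (u := φ y)
        (v := WithLp.toLp 2 fun i =>
          ℓ (app K (dG (rect A B C D) G (EuclideanSpace.single i 1) y)))
        (w := fun i => w i y) (hφ2 y hyΩ) (hside j y hy)
      refine h2.trans ?_
      have h3 := fun i => abs_le.1 (hΦδ y hyΩ i)
      have h30 := h3 0
      have h31 := h3 1
      fin_cases j <;> simp [normal, Fin.sum_univ_two] <;> linarith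
    rw [← integral_indicator_mul_div_eq_flux hab hcd hR hΦd.contDiffOn, hdivΦ χ] at h1
    have h2 := abs_le.1 (happ χ hχs)
    linarith [h2.1, h2.2]
  -- lower bound for the competitor: `Φ` exceeds the weights by at most `δ`, and the thresholded
  -- field respects them
  set ψ : Plane → Plane := fun y => WithLp.toLp 2 fun i => softThreshold δ (Φ y i) with hψ
  have hψd : ContDiff ℝ 1 ψ := by
    refine contDiff_euclidean.2 fun i => ?_
    exact (contDiff_softThreshold δ (n := 1)).comp (contDiff_euclidean.1 hΦd i)
  have hψmem : ψ ∈ extTestFields (rect A B C D) w := by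
    refine ⟨hψd.contDiffOn, fun y hy i => ?_⟩
    exact (abs_softThreshold_le hδ0 (hΦδ y hy i)).trans (hw y hy i)
  have hlower : -ℓ (app K f) - ε * nf - cf * (2 * δ) ≤ ∫ x in rect A B C D, f x * div ψ x := by
    have h1 := hcf (fun y => ψ y - Φ y) (hψd.sub hΦd) (2 * δ) (by positivity)
      fun x _ i => (softThreshold_bounds hδ0 (Φ x i)).2
    have h2 : ∀ x, f x * div (fun y => ψ y - Φ y) x = f x * div ψ x - f x * div Φ x := by
      intro x
      rw [← mul_sub]
      congr 1
      simp only [div, ← Finset.sum_sub_distrib]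
      rw [fderiv_fun_sub (hψd.differentiable one_ne_zero x) (hΦd.differentiable one_ne_zero x)]
      rfl
    simp only [h2] at h1
    rw [integral_sub (integrableOn_mul_div hf.1 hψd) (integrableOn_mul_div hf.1 hΦd),
      hdivΦ f] at h1
    have h3 := (abs_le.1 h1).1
    have h4 := (abs_le.1 (happ f hfs)).1
    linarith
  refine le_trans ?_ (le_iSup₂_of_le ψ hψmem le_rfl)
  rw [EReal.coe_le_coe_iff]
  rw [hKf] at hlower
  have : ε * Q = ε * nχ + δ * P + ε * nf + cf * (2 * δ) := by rw [hQ, hδ]; ring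
  linarith

/-- The functional on `L¹` given by a bounded measurable function. -/
lemma exists_functional {q : E → ℝ} (hq : Measurable q) (hq1 : ∀ z, |q z| ≤ 1) :
    ∃ ℓ : Lp ℝ 1 ν →L[ℝ] ℝ, ∀ u : Lp ℝ 1 ν, ℓ u = ∫ z, q z * u z ∂ν := by
  have hi : ∀ u : Lp ℝ 1 ν, Integrable (fun z => q z * u z) ν := fun u =>
    (L1.integrable_coeFn u).bdd_mul hq.aestronglyMeasurable (Eventually.of_forall hq1)
  refine ⟨LinearMap.mkContinuous
    { toFun := fun u => ∫ z, q z * u z ∂ν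
      map_add' := fun u v => ?_
      map_smul' := fun r u => ?_ } 1 fun u => ?_, fun u => rfl⟩
  · rw [← integral_add (hi u) (hi v)]
    refine integral_congr_ae ?_
    filter_upwards [Lp.coeFn_add u v] with z hz
    rw [hz, Pi.add_apply, mul_add]
  · rw [RingHom.id_apply, smul_eq_mul, ← integral_const_mul]
    refine integral_congr_ae ?_
    filter_upwards [Lp.coeFn_smul r u] with z hz
    rw [hz, Pi.smul_apply, smul_eq_mul, mul_left_comm]
  · rw [one_mul, L1.norm_eq_integral_norm]
    refine (norm_integral_le_integral_norm _).trans
      (integral_mono (hi u).norm (L1.integrable_coeFn u).norm fun z => ?_)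
    simp only [norm_mul]
    exact mul_le_of_le_one_left (norm_nonneg _) (hq1 z)

lemma exists_normal_eq_smul (j : Fin 4) : ∃ i, ∃ r : ℝ, |r| = 1 ∧
    normal j = r • EuclideanSpace.single i (1 : ℝ) := by
  fin_cases j
  · exact ⟨0, -1, by simp, by ext i; fin_cases i <;> simp [normal]⟩
  · exact ⟨1, -1, by simp, by ext i; fin_cases i <;> simp [normal]⟩
  · exact ⟨0, 1, by simp, by ext i; fin_cases i <;> simp [normal]⟩
  · exact ⟨1, 1, by simp, by ext i; fin_cases i <;> simp [normal]⟩

lemma side_nonempty (hab : a < b) (hcd : c < d) (j : Fin 4) : (side a b c d j).Nonempty := by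
  have h1 : (a + b) / 2 ∈ Ioo a b := ⟨by linarith, by linarith⟩
  have h2 : (c + d) / 2 ∈ Ioo c d := ⟨by linarith, by linarith⟩
  fin_cases j
  · exact ⟨!₂[a, (c + d) / 2], by simpa [side] using h2⟩
  · exact ⟨!₂[(a + b) / 2, c], by simpa [side] using h1⟩
  · exact ⟨!₂[b, (c + d) / 2], by simpa [side] using h2⟩
  · exact ⟨!₂[(a + b) / 2, d], by simpa [side] using h1⟩

lemma measurable_sign_cast : Measurable fun t : ℝ => ((SignType.sign t : SignType) : ℝ) := by
  refine Monotone.measurable fun s t hst => ?_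
  have : SignType.sign s ≤ SignType.sign t := SignType.sign.monotone hst
  revert this
  cases SignType.sign s <;> cases SignType.sign t <;> intro h <;>
    first | exact absurd h (by decide) | norm_num

end

end WeightedTV

theorem mainTheorem3
    {E : Type*} [MeasurableSpace E] (ν : Measure E)
    (p : ℝ≥0∞) [Fact (1 ≤ p)] (hp : p < 2)
    (A B C D a b c d : ℝ) (hab : a < b) (hcd : c < d)
    (hR : WeightedTV.rect a b c d ⊆ WeightedTV.rect A B C D)
    (G : WeightedTV.Plane → WeightedTV.Plane → ℝ)
    (hG : WeightedTV.IsDirichletGreen (WeightedTV.rect A B C D) G)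
    (K : Lp ℝ p (volume.restrict (WeightedTV.rect A B C D)) →L[ℝ] Lp ℝ 1 ν)
    (F : Fin 4 → Set E) (hF_meas : ∀ j, MeasurableSet (F j))
    (hF_disj : Pairwise fun i j => Disjoint (F i) (F j)) (hF_union : ⋃ j, F j = univ)
    (h_supp : ∀ j, ∀ y ∈ WeightedTV.side a b c d j, ∀ᵐ z ∂ν, z ∉ F j →
      WeightedTV.app K
        (WeightedTV.dG (WeightedTV.rect A B C D) G (WeightedTV.normal j) y) z = 0)
    (s : Fin 4 → E → SignType)
    (h_sign : ∀ j, ∀ y ∈ WeightedTV.side a b c d j, ∀ᵐ z ∂ν, z ∈ F j →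
      SignType.sign (WeightedTV.app K
        (WeightedTV.dG (WeightedTV.rect A B C D) G (WeightedTV.normal j) y) z) = s j z) :
    (WeightedTV.rect a b c d).indicator (fun _ => (1 : ℝ)) ∈
        WeightedTV.feasible K ((WeightedTV.rect a b c d).indicator fun _ => (1 : ℝ)) ∧
      IsMinOn (WeightedTV.extTV (WeightedTV.rect A B C D) (WeightedTV.weight K G))
        (WeightedTV.feasible K ((WeightedTV.rect a b c d).indicator fun _ => (1 : ℝ)))
        ((WeightedTV.rect a b c d).indicator fun _ => (1 : ℝ)) := by
  have hχ := WeightedTV.isBV_indicator_rect hab hcd hR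
  refine ⟨⟨hχ, rfl⟩, isMinOn_iff.2 fun f hf => ?_⟩
  obtain ⟨hAB, hCD⟩ := WeightedTV.lt_and_lt_of_rect_subset hab hcd hR
  have hΩ : ∀ j, ∀ y ∈ WeightedTV.side a b c d j, y ∈ closure (WeightedTV.rect A B C D) :=
    fun j y hy => closure_mono hR (WeightedTV.side_subset_closure hab hcd j hy)
  have hmem : ∀ y ∈ closure (WeightedTV.rect A B C D), ∀ i,
      MemLp (WeightedTV.dG (WeightedTV.rect A B C D) G (EuclideanSpace.single i 1) y) p
        (volume.restrict (WeightedTV.rect A B C D)) :=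
    fun y hy i => WeightedTV.memLp_dG hp hAB hCD hG hy (WeightedTV.norm_single_one i)
  -- one pole on each side fixes the signs
  choose y₀ hy₀ using WeightedTV.side_nonempty hab hcd
  set u : Fin 4 → WeightedTV.Plane → Lp ℝ 1 ν := fun j y => WeightedTV.app K
    (WeightedTV.dG (WeightedTV.rect A B C D) G (WeightedTV.normal j) y) with hu
  set q : E → ℝ := fun z =>
    ∑ j, (F j).indicator (fun z => ((SignType.sign (u j (y₀ j) z) : SignType) : ℝ)) z with hq
  have hqF : ∀ j, ∀ z ∈ F j, q z = ((SignType.sign (u j (y₀ j) z) : SignType) : ℝ) := by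
    intro j z hz
    rw [hq]
    simp only
    rw [Finset.sum_eq_single j, indicator_of_mem hz]
    · intro i _ hij
      exact indicator_of_notMem (fun h => (hF_disj hij).le_bot ⟨h, hz⟩) _
    · simp
  have hqm : Measurable q := Finset.measurable_sum _ fun j _ =>
    (WeightedTV.measurable_sign_cast.comp (Lp.stronglyMeasurable _).measurable).indicator
      (hF_meas j)
  have hq1 : ∀ z, |q z| ≤ 1 := by
    intro z
    obtain ⟨j, hj⟩ := mem_iUnion.1 (hF_union ▸ mem_univ z)
    rw [hqF j z hj]
    cases SignType.sign (u j (y₀ j) z) <;> simp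
  obtain ⟨ℓ, hℓ⟩ := WeightedTV.exists_functional (ν := ν) hqm hq1
  refine WeightedTV.extTV_indicator_le_of_certificate hp hab hcd hR hG K ℓ (fun y hy i => ?_)
    (fun j y hy i hi => ?_) hf.1 hf.2
  · rw [hℓ]
    refine abs_integral_le_integral_abs.trans (integral_mono_of_nonneg
      (Filter.Eventually.of_forall fun z => abs_nonneg _) (L1.integrable_coeFn _).abs
      (Filter.Eventually.of_forall fun z => ?_))
    simp only [abs_mul]
    exact mul_le_of_le_one_left (abs_nonneg _) (hq1 z)
  · obtain ⟨i', r, hr, hn⟩ := WeightedTV.exists_normal_eq_smul j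
    obtain rfl : i = i' := by
      by_contra h
      exact hi (by rw [hn]; simp [h])
    have hni : WeightedTV.normal j i = r := by rw [hn]; simp
    have hur : u j y = r • WeightedTV.app K
        (WeightedTV.dG (WeightedTV.rect A B C D) G (EuclideanSpace.single i 1) y) := by
      rw [hu]
      simp only
      rw [hn, WeightedTV.dG_smul, WeightedTV.app_const_smul K (hmem y (hΩ j y hy) i)]
    rw [hni, ← smul_eq_mul, ← map_smul, ← hur, hℓ, WeightedTV.weight]
    -- on the side the certificate has the sign of the data, so that the weight is attained
    refine (integral_congr_ae ?_).le
    have hcoe := Lp.coeFn_smul r (WeightedTV.app K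
      (WeightedTV.dG (WeightedTV.rect A B C D) G (EuclideanSpace.single i 1) y))
    rw [← hur] at hcoe
    filter_upwards [hcoe, h_supp j y hy, h_sign j y hy, h_sign j (y₀ j) (hy₀ j)]
      with z h1 h2 h3 h4
    have habs : |WeightedTV.app K (WeightedTV.dG (WeightedTV.rect A B C D) G
        (EuclideanSpace.single i 1) y) z| = |u j y z| := by
      rw [h1, Pi.smul_apply, smul_eq_mul, abs_mul, hr, one_mul]
    rw [habs]
    by_cases hz : z ∈ F j
    · rw [hqF j z hz, h4 hz, ← h3 hz]
      exact (sign_mul_self _).symm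
    · rw [show u j y z = 0 from h2 hz]
      simp
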